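/- **Setting.** Let $T>0$, $d\ge 1$, and let $X=(X^{(1)},\dots,X^{(d)})$ be a continuous, centered Gaussian process on $[0,T]$ with values in $\mathbb{R}^d$, with i.i.d. components and $X_0=0$, on a probability space $(\Omega,\mathcal F,\mathbb P)$ whose $\sigma$-algebra is generated by $X$. Let $R(s,t)=\mathbb{E}[X^{(1)}_sX^{(1)}_t]$. For partitions $\{u_i\},\{v_j\}$ of $[0,T]$ put $R\binom{u_i\ u_{i+1}}{v_j\ v_{j+1}}=R(u_i,v_j)+R(u_{i+1},v_{j+1})-R(u_i,v_{j+1})-R(u_{i+1},v_j)$; $R$ has finite 2D $\rho$-variation if $\sup\sum_{i,j}\bigl|R\binom{u_i\ u_{i+1}}{v_j\ v_{j+1}}\bigr|^\rho<\infty$, the supremum being over all such pairs of partitions. The 2D Young–Stieltjes integral $\int_{[0,T]^2}f\,\mathrm dR$ is the limit of $\sum_{i,j}f(u_i,v_j)R\binom{u_i\ u_{i+1}}{v_j\ v_{j+1}}$ as the meshes of both partitions tend to $0$; likewise $\int_{[0,T]^4}f(s,r,t,q)\,\mathrm dR(s,r)\,\mathrm dR(t,q)$ is the limit, as the meshes of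 four partitions $\{s_i\},\{r_k\},\{t_j\},\{q_l\}$ of $[0,T]$ tend to $0$, of $$\sum_{i,k,j,l}f(s_i,r_k,t_j,q_l)\,R\tbinom{s_i\ s_{i+1}}{r_k\ r_{k+1}}R\tbinom{t_j\ t_{j+1}}{q_l\ q_{l+1}}.$$ $\mathcal H_1^d$ is the Hilbert space completion of the span of the functions $\mathbf 1_{[0,t)}e_u$ ($t\in[0,T]$, $1\le u\le d$) for $\langle \mathbf 1_{[0,t)}e_u,\mathbf 1_{[0,s)}e_v\rangle=\delta_{uv}R(t,s)$. For a partition $\pi=\{r_i\}$ of $[0,T]$ with mesh $\|\pi\|$ and a function $f$ on $[0,T]$ let $f^\pi=\sum_i f(r_i)\mathbf 1_{[r_i,r_{i+1})}$; a path $f:[0,T]\to\mathbb R^d$ is identified with $\lim_{\|\pi\|\to0}f^\pi$ in $\mathcal H_1^d$ when this limit exists. $\mathcal C^{p\text{-var}}_{pw}$ denotes the functions on $[0,T]$ for which there is a partition $\{t_i\}$ of $[0,T]$ such that on each open interval $(t_i,t_{i+1})$ the function is continuous and of finite $p$-variation. $\mathcal D$ is the Malliavin derivative associated with $X$, defined as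 usual on smooth cylinder functionals $f(I(h_1),\dots,I(h_n))$, where $I:\mathcal H_1^d\to L^2(\Omega)$ is the linear isometry with $I(\mathbf 1_{[0,t)}e_u)=X_t^{(u)}$; $\mathbb D^{1,2}$ and $\mathbb D^{1,2}(\mathcal H_1^d)$ are the domains of its $L^2$-closures for real and for $\mathcal H_1^d$-valued random variables, and $\delta^X$ is the adjoint of $\mathcal D$ (the Skorohod integral). **Theorem.** Assume that $R$ is continuous and of finite 2D $\rho$-variation for some $\rho\in[1,\tfrac32)$, and let $p\ge1$ satisfy $\frac1p+\frac1\rho>1$. Let $Y=(Y_t)_{t\in[0,T]}$ be an $\mathbb{R}^d$-valued process such that (i) almost surely $Y\in\mathcal C^{p\text{-var}}_{pw}([0,T];\mathbb R^d)$; (ii) there are random functions $\tilde g_1,\tilde g_2$, almost surely in $\mathcal C^{p\text{-var}}_{pw}([0,T];\mathbb R^{d\times d})$, such that, with $\mathcal D_sY_t:=\mathbf 1_{[0,t)}(s)\,\tilde g_1(t)\tilde g_2(s)$, for every $t\in[0,T]$ and $i\le d$ we have $Y^{(i)}_t\in\mathbb D^{1,2}$, and its Malliavin derivative is almost surely the element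 of $\mathcal H_1^d$ identified with the $i$-th row of $s\mapsto\mathcal D_sY_t$. Write $Y^\pi_t=\sum_iY_{r_i}\mathbf 1_{[r_i,r_{i+1})}(t)$ and $\mathcal D_sY^\pi_t=\sum_i\mathcal D_sY_{r_i}\mathbf 1_{[r_i,r_{i+1})}(t)$. Then almost surely $Y$, as well as each row of $s\mapsto\mathcal D_sY_t$ for every $t$, is identified with an element of $\mathcal H_1^d$, and all the Young–Stieltjes integrals below exist. Moreover $Y^\pi\to Y$ in $\mathbb D^{1,2}(\mathcal H_1^d)$ as $\|\pi\|\to0$ if and only if $$\mathbb E\Bigl[\int_{[0,T]^2}\langle Y^\pi_s-Y_s,\,Y^\pi_t-Y_t\rangle_{\mathbb R^d}\,\mathrm dR(s,t)\Bigr]\to0$$ and $$\mathbb E\Bigl[\int_{[0,T]^2}\Bigl(\int_{[0,T]^2}\bigl\langle\mathcal D_r(Y^\pi_t-Y_t),\,\mathcal D_q(Y^\pi_s-Y_s)\bigr\rangle_{\mathbb R^d\otimes\mathbb R^d}\,\mathrm dR(r,q)\Bigr)\mathrm dR(s,t)\Bigr]\to0$$ as $\|\pi\|\to0$ (including that these random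 variables are integrable for all $\pi$ of small enough mesh). In that case $Y$ and all $Y^\pi-Y$ lie in the domain of $\delta^X$, $\lim_{\|\pi\|\to0}\mathbb E[\delta^X(Y^\pi-Y)^2]=0$, the two random variables on the right-hand side below are integrable, and $$\mathbb E[\delta^X(Y)^2]=\mathbb E\Bigl[\int_{[0,T]^2}\langle Y_s,Y_t\rangle_{\mathbb R^d}\,\mathrm dR(s,t)\Bigr]+\mathbb E\Bigl[\int_{[0,T]^4}\mathrm{tr}\bigl(\mathcal D_rY_t\,\mathcal D_qY_s\bigr)\,\mathrm dR(s,r)\,\mathrm dR(t,q)\Bigr].$$ -/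

import Mathlib

open MeasureTheory ProbabilityTheory Filter Topology
open scoped ENNReal TensorProduct RealInnerProductSpace

attribute [local instance] Matrix.frobeniusNormedAddCommGroup

noncomputable section

namespace YoungMalliavin

/-! ### Time interval, partitions, `p`-variation -/

/-- The time interval `[0, T]`. -/
abbrev Time (T : ℝ) : Type := Set.Icc (0 : ℝ) T

/-- A partition `0 = r_0 < r_1 < ⋯ < r_n = T` of `[0, T]`. -/
structure TimePartition (T : ℝ) where
  n : ℕ
  pt : ℕ → Time T
  pt_zero : (pt 0 : ℝ) = 0
  pt_last : (pt n : ℝ) = T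
  pt_lt : ∀ i < n, pt i < pt (i + 1)

/-- The mesh `max_i (r_{i+1} - r_i)` of a partition. -/
def TimePartition.mesh {T : ℝ} (π : TimePartition T) : ℝ :=
  ⨆ i : Fin π.n, ((π.pt (i + 1) : ℝ) - (π.pt i : ℝ))

/-- The filter of partitions of `[0, T]` whose mesh tends to `0`. -/
def meshZero (T : ℝ) : Filter (TimePartition T) := comap TimePartition.mesh (𝓝 0)

/-- `f` has finite `p`-variation on the set `S ⊆ [0, T]`. -/
def FinitePVarOn {T : ℝ} {E : Type*} [PseudoMetricSpace E] (p : ℝ) (f : Time T → E)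
    (S : Set (Time T)) : Prop :=
  ∃ C : ℝ, ∀ (m : ℕ) (u : ℕ → Time T), Monotone u → (∀ i, u i ∈ S) →
    ∑ i ∈ Finset.range m, dist (f (u i)) (f (u (i + 1))) ^ p ≤ C

/-- The class `C_pw^{p-var}([0, T]; E)`: there is a partition `{t_i}` of `[0, T]` such that `f` is
continuous and of finite `p`-variation on every open interval `(t_i, t_{i+1})`. -/
def PiecewisePVar {T : ℝ} {E : Type*} [PseudoMetricSpace E] (p : ℝ) (f : Time T → E) : Prop :=
  ∃ π : TimePartition T, ∀ i < π.n,
    ContinuousOn f (Set.Ioo (π.pt i) (π.pt (i + 1))) ∧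
      FinitePVarOn p f (Set.Ioo (π.pt i) (π.pt (i + 1)))

/-- The rectangular increment of `f` over `[s, s'] × [t, t']`. -/
def rectInc {T : ℝ} (f : Time T → Time T → ℝ) (s s' t t' : Time T) : ℝ :=
  f s t + f s' t' - f s t' - f s' t

/-- `f` has finite 2D `ρ`-variation on `[0, T]²` (supremum over grid-like partitions). -/
def FinitePVar2D {T : ℝ} (ρ : ℝ) (f : Time T → Time T → ℝ) : Prop :=
  ∃ C : ℝ, ∀ π π' : TimePartition T,
    ∑ i ∈ Finset.range π.n, ∑ j ∈ Finset.range π'.n,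
      |rectInc f (π.pt i) (π.pt (i + 1)) (π'.pt j) (π'.pt (j + 1))| ^ ρ ≤ C

/-- The step function `f^π(t) = ∑ f(r_i) 1_{[r_i, r_{i+1})}(t)`. -/
def stepFun {T : ℝ} {E : Type*} [AddCommMonoid E] (π : TimePartition T) (f : Time T → E)
    (t : Time T) : E :=
  ∑ i ∈ Finset.range π.n, (Set.Ico (π.pt i) (π.pt (i + 1))).indicator (fun _ => f (π.pt i)) t

/-! ### Multi-dimensional Young–Stieltjes integrals -/

/-- The Riemann sum of `f` against `dg(u, v)` over the grid `π.1 × π.2` of `[0, T]²`. -/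
def riemannSum2 {T : ℝ} (f g : Time T → Time T → ℝ) (π : TimePartition T × TimePartition T) : ℝ :=
  ∑ i ∈ Finset.range π.1.n, ∑ j ∈ Finset.range π.2.n,
    f (π.1.pt i) (π.2.pt j) *
      rectInc g (π.1.pt i) (π.1.pt (i + 1)) (π.2.pt j) (π.2.pt (j + 1))

/-- The 2D Young–Stieltjes integral of `f` against `g` over `[0, T]²` exists. -/
def YoungExists2 {T : ℝ} (f g : Time T → Time T → ℝ) : Prop :=
  ∃ I : ℝ, Tendsto (riemannSum2 f g) (meshZero T ×ˢ meshZero T) (𝓝 I)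

/-- The 2D Young–Stieltjes integral `∫_{[0,T]²} f dg`. -/
def young2 {T : ℝ} (f g : Time T → Time T → ℝ) : ℝ :=
  limUnder (meshZero T ×ˢ meshZero T) (riemannSum2 f g)

/-- The Riemann sum of `f(s, r, t, q)` against `dg(s, r) dg(t, q)` over a grid of `[0, T]⁴`. -/
def riemannSum4 {T : ℝ} (f : Time T → Time T → Time T → Time T → ℝ) (g : Time T → Time T → ℝ)
    (π : (TimePartition T × TimePartition T) × (TimePartition T × TimePartition T)) : ℝ :=
  ∑ i ∈ Finset.range π.1.1.n, ∑ k ∈ Finset.range π.1.2.n,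
    ∑ j ∈ Finset.range π.2.1.n, ∑ l ∈ Finset.range π.2.2.n,
      f (π.1.1.pt i) (π.1.2.pt k) (π.2.1.pt j) (π.2.2.pt l) *
        rectInc g (π.1.1.pt i) (π.1.1.pt (i + 1)) (π.1.2.pt k) (π.1.2.pt (k + 1)) *
        rectInc g (π.2.1.pt j) (π.2.1.pt (j + 1)) (π.2.2.pt l) (π.2.2.pt (l + 1))

/-- The 4D Young–Stieltjes integral of `f(s, r, t, q)` against `dg(s, r) dg(t, q)` exists. -/
def YoungExists4 {T : ℝ} (f : Time T → Time T → Time T → Time T → ℝ)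
    (g : Time T → Time T → ℝ) : Prop :=
  ∃ I : ℝ, Tendsto (riemannSum4 f g)
    ((meshZero T ×ˢ meshZero T) ×ˢ (meshZero T ×ˢ meshZero T)) (𝓝 I)

/-- The 4D Young–Stieltjes integral `∫_{[0,T]⁴} f(s, r, t, q) dg(s, r) dg(t, q)`. -/
def young4 {T : ℝ} (f : Time T → Time T → Time T → Time T → ℝ) (g : Time T → Time T → ℝ) : ℝ :=
  limUnder ((meshZero T ×ˢ meshZero T) ×ˢ (meshZero T ×ˢ meshZero T)) (riemannSum4 f g)

/-! ### The Gaussian process -/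

variable {Ω : Type*} [mΩ : MeasurableSpace Ω]

/-- `X` is a continuous, centered Gaussian process in `ℝ^d` on `[0, T]` with i.i.d. components,
starting at the origin; as on the canonical path space, the events are those generated by `X`. -/
structure IsGaussianDriver (P : Measure Ω) {d : ℕ} {T : ℝ}
    (X : Time T → Ω → EuclideanSpace ℝ (Fin d)) : Prop where
  gaussian : IsGaussianProcess X P
  centered : ∀ t i, ∫ ω, X t ω i ∂P = 0
  indep : iIndepFun (fun (i : Fin d) (ω : Ω) (t : Time T) => X t ω i) P
  ident : ∀ i j : Fin d,
    IdentDistrib (fun (ω : Ω) (t : Time T) => X t ω i) (fun (ω : Ω) (t : Time T) => X t ω j) P P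
  continuous_paths : ∀ᵐ ω ∂P, Continuous fun t => X t ω
  start : ∀ t : Time T, (t : ℝ) = 0 → ∀ᵐ ω ∂P, X t ω = 0
  generated : mΩ = ⨆ t : Time T, MeasurableSpace.comap (X t) inferInstance

/-- The covariance function `R(s, t) = E[X_s^{(1)} X_t^{(1)}]` common to the components. -/
def covFun (P : Measure Ω) {d : ℕ} [NeZero d] {T : ℝ}
    (X : Time T → Ω → EuclideanSpace ℝ (Fin d)) (s t : Time T) : ℝ :=
  ∫ ω, X s ω 0 * X t ω 0 ∂P

variable {P : Measure Ω} {d : ℕ} [NeZero d] {T : ℝ}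
  {X : Time T → Ω → EuclideanSpace ℝ (Fin d)}

namespace IsGaussianDriver

theorem memLp_coord (hX : IsGaussianDriver P X) (t : Time T) (i : Fin d) :
    MemLp (fun ω => X t ω i) 2 P := by
  have h := (hX.gaussian.hasGaussianLaw_eval t).memLp_two
  exact (EuclideanSpace.proj (𝕜 := ℝ) i).comp_memLp' h

theorem integral_coord_mul (hX : IsGaussianDriver P X) (s t : Time T) (i j : Fin d) :
    ∫ ω, X s ω i * X t ω j ∂P = if i = j then covFun P X s t else 0 := by
  split_ifs with hij
  · subst hij
    have h := ((hX.ident i 0).comp (u := fun f : Time T → ℝ => f s * f t)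
      (by fun_prop)).integral_eq
    simpa [covFun, Function.comp_def] using h
  · have hm : ∀ r : Time T, Measurable fun f : Time T → ℝ => f r := fun r => measurable_pi_apply r
    have h := (hX.indep.indepFun hij).comp (φ := fun f : Time T → ℝ => f s)
      (ψ := fun f : Time T → ℝ => f t) (hm s) (hm t)
    have h2 := h.integral_fun_mul_eq_mul_integral (hX.memLp_coord s i).aestronglyMeasurable
      (hX.memLp_coord t j).aestronglyMeasurable
    simp only [Function.comp_def] at h2
    rw [h2, hX.centered s i, zero_mul]

end IsGaussianDriver

/-! ### The Hilbert space `H_1^d` -/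

/-- Formal finite linear combinations of the generators `1_{[0,t)} e_u`, `t ∈ [0, T]`,
`u = 1, …, d`. -/
def PreH1 (_ : IsGaussianDriver P X) : Type := (Time T × Fin d) →₀ ℝ

variable (hX : IsGaussianDriver P X)

instance : AddCommGroup (PreH1 hX) := inferInstanceAs (AddCommGroup ((Time T × Fin d) →₀ ℝ))
instance : Module ℝ (PreH1 hX) := inferInstanceAs (Module ℝ ((Time T × Fin d) →₀ ℝ))

/-- The generator `1_{[0,t)} e_u`. -/
def PreH1.gen (t : Time T) (u : Fin d) : PreH1 hX := Finsupp.single (t, u) (1 : ℝ)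

/-- The bilinear form determined by `⟨1_{[0,t)} e_u, 1_{[0,s)} e_v⟩ = δ_{uv} R(t, s)`. -/
def PreH1.form (a b : PreH1 hX) : ℝ :=
  Finsupp.sum (M := ℝ) a fun x c => Finsupp.sum (M := ℝ) b fun y e =>
    c * e * (if x.2 = y.2 then covFun P X x.1 y.1 else 0)

/-- The linear map with `1_{[0,t)} e_u ↦ X_t^{(u)}`, at the level of functions. -/
def PreH1.eval (a : PreH1 hX) (ω : Ω) : ℝ :=
  Finsupp.sum (M := ℝ) a fun x c => c * X x.1 ω x.2

theorem PreH1.memLp_eval (a : PreH1 hX) : MemLp (PreH1.eval hX a) 2 P := by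
  unfold PreH1.eval Finsupp.sum
  exact memLp_finsetSum _ fun x _ => (hX.memLp_coord x.1 x.2).const_mul _

theorem PreH1.form_eq (a b : PreH1 hX) :
    PreH1.form hX a b = ∫ ω, PreH1.eval hX a ω * PreH1.eval hX b ω ∂P := by
  unfold PreH1.form PreH1.eval Finsupp.sum
  have hint : ∀ x y : Time T × Fin d, ∀ c e : ℝ,
      Integrable (fun ω => c * X x.1 ω x.2 * (e * X y.1 ω y.2)) P := fun x y c e =>
    ((hX.memLp_coord x.1 x.2).const_mul c).integrable_mul ((hX.memLp_coord y.1 y.2).const_mul e)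
  simp_rw [Finset.sum_mul_sum]
  rw [integral_finsetSum _ fun x _ => integrable_finsetSum _ fun y _ => hint _ _ _ _]
  refine Finset.sum_congr rfl fun x _ => ?_
  rw [integral_finsetSum _ fun y _ => hint _ _ _ _]
  refine Finset.sum_congr rfl fun y _ => ?_
  rw [← hX.integral_coord_mul x.1 y.1 x.2 y.2, ← integral_const_mul]
  exact integral_congr_ae (Eventually.of_forall fun ω => by simp only []; ring)

theorem PreH1.eval_add (a b : PreH1 hX) (ω : Ω) :
    PreH1.eval hX (a + b) ω = PreH1.eval hX a ω + PreH1.eval hX b ω :=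
  Finsupp.sum_add_index' (fun _ => zero_mul _) fun _ _ _ => add_mul _ _ _

theorem PreH1.eval_smul (r : ℝ) (a : PreH1 hX) (ω : Ω) :
    PreH1.eval hX (r • a) ω = r * PreH1.eval hX a ω := by
  unfold PreH1.eval
  refine (Finsupp.sum_smul_index' (g := a) (b := r)
    (h := fun x c => c * X x.1 ω x.2) (fun _ => zero_mul _)).trans ?_
  unfold Finsupp.sum
  exact (Finset.sum_congr rfl fun x _ => mul_assoc _ _ _).trans (Finset.mul_sum _ _ _).symm

instance : PreInnerProductSpace.Core ℝ (PreH1 hX) where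
  inner := PreH1.form hX
  conj_inner_symm a b := by
    simp only [PreH1.form_eq, conj_trivial]
    exact integral_congr_ae (Eventually.of_forall fun ω => mul_comm _ _)
  re_inner_nonneg a := by
    simp only [PreH1.form_eq, RCLike.re_to_real]
    exact integral_nonneg fun ω => mul_self_nonneg _
  add_left a b c := by
    simp only [PreH1.form_eq, PreH1.eval_add, add_mul]
    exact integral_add ((PreH1.memLp_eval hX a).integrable_mul (PreH1.memLp_eval hX c))
      ((PreH1.memLp_eval hX b).integrable_mul (PreH1.memLp_eval hX c))
  smul_left a b r := by
    simp only [PreH1.form_eq, PreH1.eval_smul, mul_assoc, conj_trivial]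
    exact integral_const_mul _ _

instance : SeminormedAddCommGroup (PreH1 hX) :=
  InnerProductSpace.Core.toSeminormedAddCommGroup (𝕜 := ℝ)
instance : InnerProductSpace ℝ (PreH1 hX) := .ofCore _

/-- The Hilbert space `H_1^d`: the (Hausdorff) completion of the span of the generators
`1_{[0,t)} e_u` under `⟨1_{[0,t)} e_u, 1_{[0,s)} e_v⟩ = δ_{uv} R(t, s)`. -/
abbrev H1 : Type := UniformSpace.Completion (PreH1 hX)

/-- The generator `1_{[0,t)} e_u` as an element of `H_1^d`. -/
def ind (t : Time T) (u : Fin d) : H1 hX := (PreH1.gen hX t u : H1 hX)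

/-- The Hilbert space tensor product `H_1^d ⊗ H_1^d`. -/
abbrev H1Tensor : Type := UniformSpace.Completion (H1 hX ⊗[ℝ] H1 hX)

/-- The element `f^π = ∑ f(r_i) 1_{[r_i, r_{i+1})}` of `H_1^d`. -/
def stepH (π : TimePartition T) (f : Time T → EuclideanSpace ℝ (Fin d)) : H1 hX :=
  ∑ i ∈ Finset.range π.n, ∑ u : Fin d,
    f (π.pt i) u • (ind hX (π.pt (i + 1)) u - ind hX (π.pt i) u)

/-- The path `f` is identified with the element `h` of `H_1^d`: `f^π → h` as the mesh vanishes. -/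
def Represents (f : Time T → EuclideanSpace ℝ (Fin d)) (h : H1 hX) : Prop :=
  Tendsto (fun π => stepH hX π f) (meshZero T) (𝓝 h)

/-- The element of `H_1^d` with which a path `f` is identified. -/
def toH1 (f : Time T → EuclideanSpace ℝ (Fin d)) : H1 hX :=
  limUnder (meshZero T) fun π => stepH hX π f

/-! ### Malliavin calculus -/

/-- The linear map `1_{[0,t)} e_u ↦ X_t^{(u)}` into `L²(Ω)`. -/
def preWiener : PreH1 hX →ₗ[ℝ] Lp ℝ 2 P where
  toFun a := (PreH1.memLp_eval hX a).toLp _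
  map_add' a b := by
    rw [← MemLp.toLp_add]
    exact MemLp.toLp_congr _ _ (Eventually.of_forall fun ω => PreH1.eval_add hX a b ω)
  map_smul' r a := by
    rw [RingHom.id_apply, ← MemLp.toLp_const_smul]
    exact MemLp.toLp_congr _ _ (Eventually.of_forall fun ω => PreH1.eval_smul hX r a ω)

theorem norm_preWiener (a : PreH1 hX) : ‖preWiener hX a‖ = ‖a‖ := by
  have h1 : ‖preWiener hX a‖ ^ 2 = PreH1.form hX a a := by
    rw [← real_inner_self_eq_norm_sq, L2.inner_def, PreH1.form_eq]
    refine integral_congr_ae ?_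
    filter_upwards [(PreH1.memLp_eval hX a).coeFn_toLp] with ω hω
    simp only [preWiener, LinearMap.coe_mk, AddHom.coe_mk, hω]
    rfl
  have h2 : ‖a‖ ^ 2 = PreH1.form hX a a := (real_inner_self_eq_norm_sq a).symm
  exact (pow_left_inj₀ (norm_nonneg _) (norm_nonneg _) two_ne_zero).1 (h1.trans h2.symm)

/-- The linear isometry `I : H_1^d → L²(Ω)` extending `1_{[0,t)} e_u ↦ X_t^{(u)}`. -/
def wiener : H1 hX →L[ℝ] Lp ℝ 2 P :=
  ContinuousLinearMap.extend
    (LinearIsometry.mk (preWiener hX) (norm_preWiener hX)).toContinuousLinearMap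
    (UniformSpace.Completion.toComplL (𝕜 := ℝ) (E := PreH1 hX))

/-- Smooth cylinder functionals `F = f(I(h_1), …, I(h_n))`, with `f` infinitely differentiable and
bounded together with all its derivatives. -/
structure SmoothFunctional where
  n : ℕ
  h : Fin n → H1 hX
  f : (Fin n → ℝ) → ℝ
  smooth : ContDiff ℝ (⊤ : ℕ∞) f
  bounded : ∀ k : ℕ, ∃ C : ℝ, ∀ x, ‖iteratedFDeriv ℝ k f x‖ ≤ C

namespace SmoothFunctional

variable {hX}

/-- The random vector `(I(h_1), …, I(h_n))`. -/
def vec (F : SmoothFunctional hX) (ω : Ω) : Fin F.n → ℝ := fun i => wiener hX (F.h i) ω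

/-- The random variable `F`. -/
def val (F : SmoothFunctional hX) (ω : Ω) : ℝ := F.f (F.vec ω)

/-- The Malliavin derivative `DF = ∑ ∂_i f(I(h_1), …, I(h_n)) h_i`. -/
def deriv (F : SmoothFunctional hX) (ω : Ω) : H1 hX :=
  ∑ i, fderiv ℝ F.f (F.vec ω) (Pi.single i 1) • F.h i

end SmoothFunctional

/-- Smooth `H_1^d`-valued functionals `∑ F_j k_j`. -/
structure SmoothFunctionalH where
  m : ℕ
  F : Fin m → SmoothFunctional hX
  k : Fin m → H1 hX

namespace SmoothFunctionalH

variable {hX}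

/-- The random variable `∑ F_j k_j`. -/
def val (U : SmoothFunctionalH hX) (ω : Ω) : H1 hX := ∑ j, (U.F j).val ω • U.k j

/-- The Malliavin derivative `∑ DF_j ⊗ k_j`. -/
def deriv (U : SmoothFunctionalH hX) (ω : Ω) : H1Tensor hX :=
  ((∑ j, (U.F j).deriv ω ⊗ₜ[ℝ] U.k j : H1 hX ⊗[ℝ] H1 hX) : H1Tensor hX)

end SmoothFunctionalH

/-- `F ∈ 𝔻^{1,2}` with `DF = G`: the pair `(F, G)` lies in the closure, in
`L²(Ω) × L²(Ω; H_1^d)`, of the graph of `D` on smooth functionals. -/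
def IsMalliavinDeriv (F : Ω → ℝ) (G : Ω → H1 hX) : Prop :=
  MemLp F 2 P ∧ MemLp G 2 P ∧ ∃ S : ℕ → SmoothFunctional hX,
    Tendsto (fun n => eLpNorm (fun ω => (S n).val ω - F ω) 2 P) atTop (𝓝 0) ∧
    Tendsto (fun n => eLpNorm (fun ω => (S n).deriv ω - G ω) 2 P) atTop (𝓝 0)

/-- `U ∈ 𝔻^{1,2}(H_1^d)` with `DU = G`: the pair `(U, G)` lies in the closure, in
`L²(Ω; H_1^d) × L²(Ω; H_1^d ⊗ H_1^d)`, of the graph of `D` on smooth functionals. -/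
def IsMalliavinDerivH (U : Ω → H1 hX) (G : Ω → H1Tensor hX) : Prop :=
  MemLp U 2 P ∧ MemLp G 2 P ∧ ∃ S : ℕ → SmoothFunctionalH hX,
    Tendsto (fun n => eLpNorm (fun ω => (S n).val ω - U ω) 2 P) atTop (𝓝 0) ∧
    Tendsto (fun n => eLpNorm (fun ω => (S n).deriv ω - G ω) 2 P) atTop (𝓝 0)

/-- `U^π → V` in `𝔻^{1,2}(H_1^d)` as the mesh of `π` vanishes. -/
def TendstoD12 (U : TimePartition T → Ω → H1 hX) (V : Ω → H1 hX) : Prop :=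
  ∃ (DU : TimePartition T → Ω → H1Tensor hX) (DV : Ω → H1Tensor hX),
    (∀ π, IsMalliavinDerivH hX (U π) (DU π)) ∧ IsMalliavinDerivH hX V DV ∧
    Tendsto (fun π => eLpNorm (fun ω => U π ω - V ω) 2 P) (meshZero T) (𝓝 0) ∧
    Tendsto (fun π => eLpNorm (fun ω => DU π ω - DV ω) 2 P) (meshZero T) (𝓝 0)

/-- `Z = δ^X(U)`: the divergence (Skorohod integral), as the adjoint of `D`. -/
def IsSkorohodIntegral (U : Ω → H1 hX) (Z : Ω → ℝ) : Prop :=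
  MemLp U 2 P ∧ MemLp Z 2 P ∧
    ∀ F : SmoothFunctional hX, ∫ ω, ⟪F.deriv ω, U ω⟫ ∂P = ∫ ω, F.val ω * Z ω ∂P

/-- `U` lies in the domain of the divergence operator `δ^X`. -/
def InSkorohodDomain (U : Ω → H1 hX) : Prop := ∃ Z : Ω → ℝ, IsSkorohodIntegral hX U Z

open Classical in
/-- The divergence (Skorohod integral) `δ^X(U)`, defined up to null sets (and set to `0` outside
the domain). -/
def skorohod (U : Ω → H1 hX) : Ω → ℝ :=
  if h : InSkorohodDomain hX U then h.choose else 0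

/-! ### Notions used in the statement -/

/-- The random variables `Z^π` are integrable for all `π` of small mesh, and `E[Z^π] → 0` as the
mesh vanishes. -/
def ExpectationTendstoZero (P : Measure Ω) (Z : TimePartition T → Ω → ℝ) : Prop :=
  (∀ᶠ π in meshZero T, Integrable (Z π) P) ∧
    Tendsto (fun π => ∫ ω, Z π ω ∂P) (meshZero T) (𝓝 0)

/-- The matrix-valued kernel `(s, t) ↦ 1_{[0,t)}(s) g₁(t) g₂(s)`. -/
def volterra (g₁ g₂ : Time T → Matrix (Fin d) (Fin d) ℝ) (s t : Time T) :
    Matrix (Fin d) (Fin d) ℝ :=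
  if s < t then g₁ t * g₂ s else 0

/-- The `i`-th row of a matrix as a vector. -/
def rowVec (A : Matrix (Fin d) (Fin d) ℝ) (i : Fin d) : EuclideanSpace ℝ (Fin d) :=
  WithLp.toLp 2 fun j => A i j

/-- The inner product on `ℝ^d ⊗ ℝ^d`. -/
def frob (A B : Matrix (Fin d) (Fin d) ℝ) : ℝ := ∑ i, ∑ j, A i j * B i j

/-- `⟨y^π_s - y_s, y^π_t - y_t⟩`. -/
def pathErr (π : TimePartition T) (y : Time T → EuclideanSpace ℝ (Fin d)) (s t : Time T) : ℝ :=
  ⟪stepFun π y s - y s, stepFun π y t - y t⟫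

/-- `g^π(r, t) - g(r, t)`, where `g^π(r, t) = ∑ g(r, r_i) 1_{[r_i, r_{i+1})}(t)`. If `g(r, t)` is
`D_r Y_t`, this is `D_r (Y^π_t - Y_t)`. -/
def kernelErr (π : TimePartition T) (g : Time T → Time T → Matrix (Fin d) (Fin d) ℝ) (r t : Time T) :
    Matrix (Fin d) (Fin d) ℝ :=
  stepFun π (fun t' => g r t') t - g r t

end YoungMalliavin

end

open YoungMalliavin

/-! The integrals are moved into Hilbert space. The path $t\mapsto \mathbf 1_{[0,t)}e_u$ in
$\mathcal H_1^d$ (`ind`) has covariance kernel $R$, so a Riemann sum against $R$ is an inner product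
of vector-valued Riemann sums against this path. For the 2D integrals these are the elements $f^\pi$
(`inner_stepH`). For the nested integral and the 4D trace integral they are tensors in $\mathcal
H_1^d\otimes\mathcal H_1^d$ (`inner_tensorSum`, `riemannSum4_eq_inner`), the trace requiring an
exchange of the two factors. Existence of all pathwise integrals thus follows from norm convergence
of vector-valued Riemann sums, and the two quantities in the criterion become $E\|Y^\pi-Y\|^2$ and
$E\|\mathcal D Y^\pi-\mathcal D Y\|^2$.

Norm convergence is a Young argument. The squared norm of a Riemann sum of $\Phi$ against $x$ is a
2D Riemann sum of $\langle\Phi,\Phi\rangle$ against $\langle x,x\rangle$, bounded by the 2D Young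
inequality (`young_inequality_2d`), which is Young's removal of points carried out in one variable
and then in the other (`family_sewing`). Passing to a refinement replaces $x$ by its difference with
a discretised copy of itself. This difference is uniformly small with bounded $\rho$-variation,
hence has small $\rho'$-variation for $\rho'>\rho$ (`stepSum_uniformly_cauchy`).

The kernel $\mathbf 1_{[0,t)}(s)g_1(t)g_2(s)$ requires two integrations: first $k(t)=\int_0^t
g_2\,dx$, then $\int g_1k\otimes dx$. Duality between $\ell^q$ and $\ell^{q/(q-1)}$ shows that the
covariances of the indefinite Riemann sums have bounded 2D variation of order $q/(q-1)$, uniformly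
in the partitions (`exists_varBound2_stepInt`). An admissible $q>2$ exists, so $q/(q-1)<q$, and
interpolation makes the inner sums converge in $q$-variation, the order which the outer integration
accepts (`exists_volterra_integral`).

On the probabilistic side, Gaussian integration by parts gives the duality and the isometry
$E[\delta(U)^2]=E\|U\|^2+E\langle DU,\mathrm{swap}\,DU\rangle$ for smooth $U$
(`SmoothFunctionalH.integral_div_sq`). Both pass to $\mathbb D^{1,2}(\mathcal H_1^d)$ by closure.
Since $X$ generates the $\sigma$-algebra, smooth functionals separate integrable random variables
(`ae_eq_zero_of_integral_mul_smooth`), so the divergence and the derivative are unique. Hence the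
almost sure limit of $\mathcal D Y^\pi$ is $\mathcal D Y$ whenever $Y^\pi\to Y$ in $\mathbb
D^{1,2}(\mathcal H_1^d)$. This yields the criterion, and the final formula is the isometry with its
two terms evaluated pathwise. -/

noncomputable section

namespace YoungMalliavin

/-! ### The two-dimensional Young inequality -/

/-! ### Sewing a family of germs by removal of points -/

section Sewing

variable {S S' ι : Type*}

/-- The sequence `u` with the term of index `k + 1` removed. -/
def skipSeq (k : ℕ) (u : ℕ → S) (i : ℕ) : S := if i ≤ k then u i else u (i + 1)

theorem monotone_skipSeq [Preorder S] {u : ℕ → S} (hu : Monotone u) (k : ℕ) :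
    Monotone (skipSeq k u) := by
  intro i j hij
  unfold skipSeq
  split_ifs <;> exact hu (by omega)

/-- The defect of additivity of a germ. -/
def germDefect (Ξ : S → S → ℝ) (s t w : S) : ℝ := Ξ s t + Ξ t w - Ξ s w

/-- Removing an interior point merges two neighbouring intervals, which changes the sum by exactly
one defect. The induction appends intervals at the end. -/
theorem sum_germ_skipSeq (Ξ : S → S → ℝ) (u : ℕ → S) {k n : ℕ} (hk : k < n) :
    ∑ i ∈ Finset.range (n + 1), Ξ (u i) (u (i + 1)) =
      ∑ i ∈ Finset.range n, Ξ (skipSeq k u i) (skipSeq k u (i + 1)) +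
        germDefect Ξ (u k) (u (k + 1)) (u (k + 2)) := by
  obtain ⟨m, rfl⟩ := Nat.exists_eq_add_of_lt hk
  induction m with
  | zero =>
    rw [Finset.sum_range_succ, Finset.sum_range_succ _ k, Finset.sum_range_succ]
    have h : ∑ i ∈ Finset.range k, Ξ (skipSeq k u i) (skipSeq k u (i + 1)) =
        ∑ i ∈ Finset.range k, Ξ (u i) (u (i + 1)) := by
      refine Finset.sum_congr rfl fun i hi => ?_
      have := Finset.mem_range.1 hi
      simp [skipSeq, this.le, Nat.succ_le_of_lt this]
    rw [h]
    simp [skipSeq, germDefect]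
    ring
  | succ m ih =>
    rw [Finset.sum_range_succ, show k + (m + 1) + 1 = k + m + 1 + 1 by ring, ih (by omega),
      Finset.sum_range_succ _ (k + m + 1)]
    have h1 : ¬ (k + m + 1 ≤ k) := by omega
    have h2 : ¬ (k + m + 1 + 1 ≤ k) := by omega
    simp only [skipSeq, h1, h2, if_false]
    ring

theorem sum_rpow_le_rpow_sum (s : Finset ι) {f : ι → ℝ} (hf : ∀ i ∈ s, 0 ≤ f i) {p : ℝ}
    (hp : 1 ≤ p) : ∑ i ∈ s, f i ^ p ≤ (∑ i ∈ s, f i) ^ p := by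
  classical
  induction s using Finset.induction_on with
  | empty => simp [Real.zero_rpow (by linarith : p ≠ 0)]
  | insert a s ha ih =>
    rw [Finset.sum_insert ha, Finset.sum_insert ha]
    have h1 := ih fun i hi => hf i (Finset.mem_insert_of_mem hi)
    have h2 := Real.add_rpow_le_rpow_add (hf a (Finset.mem_insert_self _ _))
      (Finset.sum_nonneg fun i hi => hf i (Finset.mem_insert_of_mem hi)) hp
    linarith

/-- Young's removal of points: among $n+1$ interior points one has total defect at most $M/(n+1)$ in
$r$-th powers. Removing it costs at most $(M/(n+1))^{r'/r}$ in $r'$-th powers, because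
$\ell^r\subset\ell^{r'}$. These costs add up since $x\mapsto x^{r'}$ is subadditive for $r'\le1$,
and their series converges since $r'/r>1$. All germs of the family lose the same point, so the bound
is on a sum over the family. Such a sum is what a second sewing, in the other variable, takes as its
hypothesis. -/
theorem family_sewing [Preorder S] (s : Finset ι) (Ξ : ι → S → S → ℝ) {r r' M : ℝ} (hr : 0 < r)
    (hrr' : r < r') (hr' : r' ≤ 1)
    (hM : ∀ u : ℕ → S, Monotone u → ∀ n, ∑ l ∈ Finset.range n, ∑ κ ∈ s,
      |germDefect (Ξ κ) (u l) (u (l + 1)) (u (l + 2))| ^ r ≤ M)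
    (n : ℕ) (u : ℕ → S) (hu : Monotone u) :
    ∑ κ ∈ s, |∑ l ∈ Finset.range (n + 1), Ξ κ (u l) (u (l + 1)) - Ξ κ (u 0) (u (n + 1))| ^ r' ≤
      M ^ (r' / r) * ∑ l ∈ Finset.range n, ((l : ℝ) + 1) ^ (-(r' / r)) := by
  have hr'0 : 0 < r' := hr.trans hrr'
  have hM0 : 0 ≤ M := by simpa using hM u hu 0
  induction n generalizing u with
  | zero => simp [Real.zero_rpow hr'0.ne']
  | succ n ih =>
    obtain ⟨k, hk, hkM⟩ : ∃ k ∈ Finset.range (n + 1), ∑ κ ∈ s,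
        |germDefect (Ξ κ) (u k) (u (k + 1)) (u (k + 2))| ^ r ≤ M / (n + 1) := by
      refine Finset.exists_le_of_sum_le ⟨0, by simp⟩ ((hM u hu (n + 1)).trans (le_of_eq ?_))
      rw [Finset.sum_const, Finset.card_range, nsmul_eq_mul]
      push_cast
      field_simp
    rw [Finset.mem_range] at hk
    have h0 : skipSeq k u 0 = u 0 := by simp [skipSeq]
    have hn : skipSeq k u (n + 1) = u (n + 1 + 1) := by simp [skipSeq, not_le.2 hk]
    have h1 := ih (skipSeq k u) (monotone_skipSeq hu k)
    rw [h0, hn] at h1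
    have h2 : ∑ κ ∈ s, |germDefect (Ξ κ) (u k) (u (k + 1)) (u (k + 2))| ^ r' ≤
        M ^ (r' / r) * ((n : ℝ) + 1) ^ (-(r' / r)) := by
      have h3 := sum_rpow_le_rpow_sum s (f := fun κ =>
        |germDefect (Ξ κ) (u k) (u (k + 1)) (u (k + 2))| ^ r) (fun _ _ => by positivity)
        (p := r' / r) ((one_le_div hr).2 hrr'.le)
      have h4 : ∀ κ, (|germDefect (Ξ κ) (u k) (u (k + 1)) (u (k + 2))| ^ r) ^ (r' / r) =
          |germDefect (Ξ κ) (u k) (u (k + 1)) (u (k + 2))| ^ r' := fun κ => by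
        rw [← Real.rpow_mul (abs_nonneg _), mul_div_cancel₀ _ hr.ne']
      simp only [h4] at h3
      refine h3.trans ((Real.rpow_le_rpow (Finset.sum_nonneg fun _ _ => by positivity) hkM
        (by positivity)).trans (le_of_eq ?_))
      rw [Real.div_rpow hM0 (by positivity), Real.rpow_neg (by positivity), div_eq_mul_inv]
    rw [Finset.sum_range_succ _ n, mul_add]
    refine le_trans ?_ (add_le_add h1 h2)
    rw [← Finset.sum_add_distrib]
    refine Finset.sum_le_sum fun κ _ => ?_
    rw [sum_germ_skipSeq (Ξ κ) u hk, add_sub_right_comm]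
    refine (Real.rpow_le_rpow (abs_nonneg _) (abs_add_le _ _) hr'0.le).trans ?_
    exact Real.rpow_add_le_add_rpow (abs_nonneg _) (abs_nonneg _) hr'0.le hr'

/-- The constant of the sewing lemma. -/
def sewingConst (a : ℝ) : ℝ := ∑' l : ℕ, ((l : ℝ) + 1) ^ (-a)

theorem sum_le_sewingConst {a : ℝ} (ha : 1 < a) (n : ℕ) :
    ∑ l ∈ Finset.range n, ((l : ℝ) + 1) ^ (-a) ≤ sewingConst a := by
  refine Summable.sum_le_tsum _ (fun _ _ => by positivity) ?_
  have h := (summable_nat_add_iff 1).2 (Real.summable_nat_rpow.2 (by linarith : -a < -1))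
  simpa using h

theorem sewingConst_nonneg (a : ℝ) : 0 ≤ sewingConst a := tsum_nonneg fun _ => by positivity

end Sewing

/-! ### Grid variation, and sewing in two variables -/

section Young2D

variable {S S' : Type*}

/-- The rectangular increment of `A`. -/
def box (A : S → S' → ℝ) (s s' : S) (t t' : S') : ℝ := A s t + A s' t' - A s t' - A s' t

/-- `C` bounds the sums of the `q`-th powers of the rectangular increments of `A` over all grids. -/
def VarBound2 [Preorder S] [Preorder S'] (q : ℝ) (A : S → S' → ℝ) (C : ℝ) : Prop :=
  ∀ (u : ℕ → S) (v : ℕ → S'), Monotone u → Monotone v → ∀ m n : ℕ,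
    ∑ i ∈ Finset.range m, ∑ j ∈ Finset.range n,
      |box A (u i) (u (i + 1)) (v j) (v (j + 1))| ^ q ≤ C

/-- The constant of the two-dimensional Young inequality. -/
def youngConst (q ρ : ℝ) : ℝ :=
  sewingConst (((1 / q + 1 / ρ)⁻¹ + 1) / 2 / (1 / q + 1 / ρ)⁻¹) ^
      (1 / (((1 / q + 1 / ρ)⁻¹ + 1) / 2)) *
    sewingConst (1 / (((1 / q + 1 / ρ)⁻¹ + 1) / 2))

theorem youngConst_nonneg (q ρ : ℝ) : 0 ≤ youngConst q ρ :=
  mul_nonneg (Real.rpow_nonneg (sewingConst_nonneg _) _) (sewingConst_nonneg _)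

/-- Hölder's inequality for $|a|^r$ and $|b|^r$ with conjugate exponents $q/r$ and $\rho/r$, where
$1/r=1/q+1/\rho$. -/
theorem sum_mul_rpow_le {ι : Type*} (s : Finset ι) (a b : ι → ℝ) {q ρ CA CB : ℝ} (hq : 0 < q)
    (hρ : 0 < ρ) (hA : ∑ i ∈ s, |a i| ^ q ≤ CA) (hB : ∑ i ∈ s, |b i| ^ ρ ≤ CB) :
    ∑ i ∈ s, |a i * b i| ^ (1 / q + 1 / ρ)⁻¹ ≤
      CA ^ ((1 / q + 1 / ρ)⁻¹ / q) * CB ^ ((1 / q + 1 / ρ)⁻¹ / ρ) := by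
  set r := (1 / q + 1 / ρ)⁻¹ with hr
  have hr0 : 0 < r := by positivity
  have hconj : (q / r).HolderConjugate (ρ / r) := by
    refine Real.holderConjugate_iff.2 ⟨?_, ?_⟩
    · rw [one_lt_div hr0, hr, inv_lt_comm₀ (by positivity) hq]
      have : 0 < 1 / ρ := by positivity
      rw [inv_eq_one_div]; linarith
    · rw [hr]; field_simp
  have h := Real.inner_le_Lp_mul_Lq_of_nonneg s hconj (f := fun i => |a i| ^ r)
    (g := fun i => |b i| ^ r) (fun _ _ => by positivity) (fun _ _ => by positivity)
  have e1 : ∀ i, (|a i| ^ r) ^ (q / r) = |a i| ^ q := fun i => by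
    rw [← Real.rpow_mul (abs_nonneg _), mul_div_cancel₀ _ hr0.ne']
  have e2 : ∀ i, (|b i| ^ r) ^ (ρ / r) = |b i| ^ ρ := fun i => by
    rw [← Real.rpow_mul (abs_nonneg _), mul_div_cancel₀ _ hr0.ne']
  simp only [e1, e2, one_div_div] at h
  simp only [abs_mul, Real.mul_rpow (abs_nonneg _) (abs_nonneg _)]
  refine h.trans (mul_le_mul ?_ ?_ (by positivity) ?_)
  · exact Real.rpow_le_rpow (by positivity) hA (by positivity)
  · exact Real.rpow_le_rpow (by positivity) hB (by positivity)
  · exact Real.rpow_nonneg (le_trans (Finset.sum_nonneg fun _ _ => by positivity) hA) _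

/-- Two sewings. In the second variable the germs are increments of `A` times boxes of `B`, with
defects box `A` · box `B`, controlled in $\ell^r$ by Hölder. In the first variable the germ is a
whole sum over `j`, and its defects are exactly the inner sums just bounded. The vanishing of `A` at
`u 0` and `v 0` removes the one-interval term that each sewing leaves over. -/
theorem young_inequality_2d [Preorder S] [Preorder S'] {q ρ CA CB : ℝ} (hq : 0 < q) (hρ : 0 < ρ)
    (hqρ : 1 < 1 / q + 1 / ρ) {A B : S → S' → ℝ} (hA : VarBound2 q A CA) (hB : VarBound2 ρ B CB)
    (u : ℕ → S) (v : ℕ → S') (hu : Monotone u) (hv : Monotone v)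
    (hA1 : ∀ t, A (u 0) t = 0) (hA2 : ∀ s, A s (v 0) = 0) (m n : ℕ) :
    |∑ i ∈ Finset.range m, ∑ j ∈ Finset.range n,
      A (u i) (v j) * box B (u i) (u (i + 1)) (v j) (v (j + 1))| ≤
      youngConst q ρ * (CA ^ (1 / q) * CB ^ (1 / ρ)) := by
  have hCA : 0 ≤ CA := by simpa using hA u v hu hv 0 0
  have hCB : 0 ≤ CB := by simpa using hB u v hu hv 0 0
  have hright : 0 ≤ youngConst q ρ * (CA ^ (1 / q) * CB ^ (1 / ρ)) :=
    mul_nonneg (youngConst_nonneg _ _) (by positivity)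
  rcases m with _ | m
  · simpa using hright
  rcases n with _ | n
  · simpa using hright
  set r := (1 / q + 1 / ρ)⁻¹ with hr
  have hr0 : 0 < r := by positivity
  have hr1 : r < 1 := inv_lt_one_of_one_lt₀ hqρ
  -- An exponent strictly between $r$ and $1$: the inner sewing passes from $r$ to $r'$, the outer
  -- one from $r'$ to $1$.
  set r' := (r + 1) / 2 with hr'
  have hrr' : r < r' := by rw [hr']; linarith
  have hr'1 : r' < 1 := by rw [hr']; linarith
  have hr'0 : 0 < r' := hr0.trans hrr'
  set M := CA ^ (r / q) * CB ^ (r / ρ) with hM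
  have hM0 : 0 ≤ M := by positivity
  -- the inner sums
  have inner : ∀ w : ℕ → S, Monotone w → ∀ N,
      ∑ k ∈ Finset.range N, |∑ j ∈ Finset.range (n + 1),
        (A (w (k + 1)) (v j) - A (w k) (v j)) *
          box B (w (k + 1)) (w (k + 2)) (v j) (v (j + 1))| ^ r' ≤
      M ^ (r' / r) * sewingConst (r' / r) := by
    intro w hw N
    have h := family_sewing (Finset.range N) (fun k t t' =>
      (A (w (k + 1)) t - A (w k) t) * box B (w (k + 1)) (w (k + 2)) t t') (M := M) hr0 hrr' hr'1.le
      (fun v' hv' L => by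
        have e : ∀ l k, germDefect (fun t t' =>
            (A (w (k + 1)) t - A (w k) t) * box B (w (k + 1)) (w (k + 2)) t t')
            (v' l) (v' (l + 1)) (v' (l + 2)) =
            box A (w k) (w (k + 1)) (v' l) (v' (l + 1)) *
              box B (w (k + 1)) (w (k + 2)) (v' (l + 1)) (v' (l + 2)) := fun l k => by
          unfold germDefect box; ring
        simp only [e]
        rw [Finset.sum_comm, ← Finset.sum_product']
        refine sum_mul_rpow_le _ (fun x : ℕ × ℕ => box A (w x.1) (w (x.1 + 1)) (v' x.2)
          (v' (x.2 + 1))) (fun x : ℕ × ℕ => box B (w (x.1 + 1)) (w (x.1 + 2)) (v' (x.2 + 1))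
          (v' (x.2 + 2))) hq hρ ?_ ?_
        · rw [Finset.sum_product' (f := fun k l => |box A (w k) (w (k + 1)) (v' l)
            (v' (l + 1))| ^ q)]
          exact hA w v' hw hv' N L
        · rw [Finset.sum_product' (f := fun k l => |box B (w (k + 1)) (w (k + 2)) (v' (l + 1))
            (v' (l + 2))| ^ ρ)]
          exact hB (fun i => w (i + 1)) (fun i => v' (i + 1)) (fun _ _ h => hw (by omega))
            (fun _ _ h => hv' (by omega)) N L) n v hv
    simp only [hA2, sub_zero, zero_mul] at h
    exact h.trans (mul_le_mul_of_nonneg_left (sum_le_sewingConst ((one_lt_div hr0).2 hrr') n)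
      (by positivity))
  set M' := M ^ (r' / r) * sewingConst (r' / r) with hM'
  have hM'0 : 0 ≤ M' := mul_nonneg (by positivity) (sewingConst_nonneg _)
  -- The outer family has a single member; its defects are the inner sums, so `inner` supplies the
  -- hypothesis.
  have outer := family_sewing (Finset.range 1) (fun (_ : ℕ) s s' => ∑ j ∈ Finset.range (n + 1),
      A s (v j) * box B s s' (v j) (v (j + 1))) (M := M') hr'0 hr'1 le_rfl
      (fun w hw N => by
        refine le_trans (le_of_eq ?_) (inner w hw N)
        refine Finset.sum_congr rfl fun k _ => ?_
        rw [Finset.sum_range_one]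
        congr 2
        unfold germDefect
        rw [← Finset.sum_add_distrib, ← Finset.sum_sub_distrib]
        refine Finset.sum_congr rfl fun j _ => ?_
        unfold box; ring) m u hu
  rw [Finset.sum_range_one, Real.rpow_one] at outer
  simp only [hA1, zero_mul, Finset.sum_const_zero, sub_zero] at outer
  refine outer.trans ((mul_le_mul_of_nonneg_left
    (sum_le_sewingConst ((one_lt_div hr'0).2 hr'1) m) (by positivity)).trans (le_of_eq ?_))
  have hpow : M' ^ (1 / r') = CA ^ (1 / q) * CB ^ (1 / ρ) *
      sewingConst (r' / r) ^ (1 / r') := by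
    rw [hM', Real.mul_rpow (by positivity) (sewingConst_nonneg _), ← Real.rpow_mul hM0, hM,
      show r' / r * (1 / r') = 1 / r by field_simp,
      Real.mul_rpow (by positivity) (by positivity), ← Real.rpow_mul hCA, ← Real.rpow_mul hCB,
      show r / q * (1 / r) = 1 / q by field_simp, show r / ρ * (1 / r) = 1 / ρ by field_simp]
  rw [hpow, youngConst, ← hr, ← hr']
  ring

end Young2D

end YoungMalliavin

namespace YoungMalliavin

/-! ### Operations on kernels of finite two-dimensional variation -/

theorem abs_add_rpow_le {a b q : ℝ} (hq : 0 ≤ q) :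
    |a + b| ^ q ≤ 2 ^ q * (|a| ^ q + |b| ^ q) := by
  have h : |a + b| ≤ 2 * max |a| |b| :=
    (abs_add_le a b).trans (by linarith [le_max_left |a| |b|, le_max_right |a| |b|])
  refine (Real.rpow_le_rpow (abs_nonneg _) h hq).trans ?_
  rw [Real.mul_rpow two_pos.le (by positivity)]
  refine mul_le_mul_of_nonneg_left ?_ (by positivity)
  rcases max_cases |a| |b| with ⟨h, -⟩ | ⟨h, -⟩ <;> rw [h]
  · linarith [Real.rpow_nonneg (abs_nonneg b) q]
  · linarith [Real.rpow_nonneg (abs_nonneg a) q]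

section VarBound2

variable {S S' S₁ S₂ : Type*} [Preorder S] [Preorder S'] [Preorder S₁] [Preorder S₂]

theorem VarBound2.comp {q C : ℝ} {A : S → S' → ℝ} (h : VarBound2 q A C) {α : S₁ → S} {β : S₂ → S'}
    (hα : Monotone α) (hβ : Monotone β) : VarBound2 q (fun s t => A (α s) (β t)) C :=
  fun u v hu hv m n => h (α ∘ u) (β ∘ v) (hα.comp hu) (hβ.comp hv) m n

theorem VarBound2.mono {q C C' : ℝ} {A : S → S' → ℝ} (h : VarBound2 q A C) (hC : C ≤ C') :
    VarBound2 q A C' := fun u v hu hv m n => (h u v hu hv m n).trans hC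

theorem VarBound2.add {q C C' : ℝ} (hq : 0 ≤ q) {A B : S → S' → ℝ} (hA : VarBound2 q A C)
    (hB : VarBound2 q B C') : VarBound2 q (fun s t => A s t + B s t) (2 ^ q * (C + C')) := by
  intro u v hu hv m n
  have e : ∀ i j, box (fun s t => A s t + B s t) (u i) (u (i + 1)) (v j) (v (j + 1)) =
      box A (u i) (u (i + 1)) (v j) (v (j + 1)) + box B (u i) (u (i + 1)) (v j) (v (j + 1)) :=
    fun i j => by unfold box; ring
  calc _ ≤ ∑ i ∈ Finset.range m, ∑ j ∈ Finset.range n, 2 ^ q *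
        (|box A (u i) (u (i + 1)) (v j) (v (j + 1))| ^ q +
          |box B (u i) (u (i + 1)) (v j) (v (j + 1))| ^ q) :=
        Finset.sum_le_sum fun i _ => Finset.sum_le_sum fun j _ => by
          rw [e]; exact abs_add_rpow_le hq
    _ = 2 ^ q * (∑ i ∈ Finset.range m, ∑ j ∈ Finset.range n,
          |box A (u i) (u (i + 1)) (v j) (v (j + 1))| ^ q +
        ∑ i ∈ Finset.range m, ∑ j ∈ Finset.range n,
          |box B (u i) (u (i + 1)) (v j) (v (j + 1))| ^ q) := by
        simp only [← Finset.mul_sum, Finset.sum_add_distrib]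
    _ ≤ _ := by
        have := hA u v hu hv m n
        have := hB u v hu hv m n
        gcongr

theorem VarBound2.neg {q C : ℝ} {A : S → S' → ℝ} (hA : VarBound2 q A C) :
    VarBound2 q (fun s t => -A s t) C := by
  intro u v hu hv m n
  refine le_trans (le_of_eq ?_) (hA u v hu hv m n)
  refine Finset.sum_congr rfl fun i _ => Finset.sum_congr rfl fun j _ => ?_
  rw [← abs_neg]
  unfold box; ring_nf

/-- Every box is at most $4\varepsilon$ in size, so
$|\mathrm{box}|^{q'}\le(4\varepsilon)^{q'-q}|\mathrm{box}|^q$. Uniform smallness becomes smallness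
in variation at the price of a slightly larger exponent. -/
theorem VarBound2.interpolate {q q' C ε : ℝ} (hq : 0 ≤ q) (hqq' : q < q') {A : S → S' → ℝ}
    (hA : VarBound2 q A C) (hε : ∀ s t, |A s t| ≤ ε) :
    VarBound2 q' A ((4 * ε) ^ (q' - q) * C) := by
  intro u v hu hv m n
  have h0 : 0 ≤ ε := (abs_nonneg _).trans (hε (u 0) (v 0))
  have hbox : ∀ i j, |box A (u i) (u (i + 1)) (v j) (v (j + 1))| ≤ 4 * ε := fun i j => by
    have h1 := abs_le.1 (hε (u i) (v j))
    have h2 := abs_le.1 (hε (u (i + 1)) (v (j + 1)))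
    have h3 := abs_le.1 (hε (u i) (v (j + 1)))
    have h4 := abs_le.1 (hε (u (i + 1)) (v j))
    unfold box
    rw [abs_le]
    constructor <;> linarith
  calc _ ≤ ∑ i ∈ Finset.range m, ∑ j ∈ Finset.range n, (4 * ε) ^ (q' - q) *
        |box A (u i) (u (i + 1)) (v j) (v (j + 1))| ^ q :=
        Finset.sum_le_sum fun i _ => Finset.sum_le_sum fun j _ => by
          have : |box A (u i) (u (i + 1)) (v j) (v (j + 1))| ^ q' =
              |box A (u i) (u (i + 1)) (v j) (v (j + 1))| ^ (q' - q) *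
                |box A (u i) (u (i + 1)) (v j) (v (j + 1))| ^ q := by
            rw [← Real.rpow_add_of_nonneg (abs_nonneg _) (by linarith) hq, sub_add_cancel]
          rw [this]
          exact mul_le_mul_of_nonneg_right
            (Real.rpow_le_rpow (abs_nonneg _) (hbox i j) (by linarith)) (by positivity)
    _ ≤ _ := by
        simp only [← Finset.mul_sum]
        exact mul_le_mul_of_nonneg_left (hA u v hu hv m n) (by positivity)

variable {G H K : Type*} [NormedAddCommGroup G] [InnerProductSpace ℝ G]
  [NormedAddCommGroup H] [InnerProductSpace ℝ H] [NormedAddCommGroup K] [InnerProductSpace ℝ K]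

/-- The covariance kernel of two vector-valued paths. -/
def covKer (Φ : S → G) (Ψ : S' → G) (s : S) (t : S') : ℝ := ⟪Φ s, Ψ t⟫

omit [Preorder S] [Preorder S'] in
theorem box_covKer (Φ : S → G) (Ψ : S' → G) (s s' : S) (t t' : S') :
    box (covKer Φ Ψ) s s' t t' = ⟪Φ s' - Φ s, Ψ t' - Ψ t⟫ := by
  simp only [box, covKer, inner_sub_left, inner_sub_right]
  ring

theorem VarBound2.covKer_sub {q C : ℝ} (hq : 0 ≤ q) {Φ Ψ : S → G}
    (h11 : VarBound2 q (covKer Φ Φ) C) (h12 : VarBound2 q (covKer Φ Ψ) C)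
    (h21 : VarBound2 q (covKer Ψ Φ) C) (h22 : VarBound2 q (covKer Ψ Ψ) C) :
    VarBound2 q (covKer (fun s => Φ s - Ψ s) (fun s => Φ s - Ψ s))
      (2 ^ q * (2 ^ q * (C + C) + 2 ^ q * (C + C))) := by
  have h := (h11.add hq h12.neg).add hq (h21.neg.add hq h22)
  refine (congrArg (fun A => VarBound2 q A _) ?_).mp h
  funext s t
  simp only [covKer, inner_sub_left, inner_sub_right]
  ring

/-- Multiplicativity of the inner product under `m` turns the squared norm into a 2D Riemann sum of
the covariance of `Φ` against that of `y`. It serves both for scalar multiplication and for the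
tensor product. -/
theorem norm_sq_sum_le (m : G →ₗ[ℝ] H →ₗ[ℝ] K)
    (hm : ∀ g h g' h', ⟪m g h, m g' h'⟫ = ⟪g, g'⟫ * ⟪h, h'⟫) {q ρ CΦ CB : ℝ} (hq : 0 < q)
    (hρ : 0 < ρ) (hqρ : 1 < 1 / q + 1 / ρ) {Φ : S → G} {y : S → H}
    (hΦ : VarBound2 q (covKer Φ Φ) CΦ) (hy : VarBound2 ρ (covKer y y) CB) (u : ℕ → S)
    (hu : Monotone u) (hu0 : Φ (u 0) = 0) (n : ℕ) :
    ‖∑ i ∈ Finset.range n, m (Φ (u i)) (y (u (i + 1)) - y (u i))‖ ^ 2 ≤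
      youngConst q ρ * (CΦ ^ (1 / q) * CB ^ (1 / ρ)) := by
  refine le_trans (le_of_eq ?_) ((le_abs_self _).trans
    (young_inequality_2d hq hρ hqρ hΦ hy u u hu hu (fun t => by simp [covKer, hu0])
      (fun t => by simp [covKer, hu0]) n n))
  rw [← real_inner_self_eq_norm_sq, sum_inner]
  refine Finset.sum_congr rfl fun i _ => ?_
  rw [inner_sum]
  refine Finset.sum_congr rfl fun j _ => ?_
  rw [hm, box_covKer, covKer]

end VarBound2

/-! ### Partitions -/

namespace TimePartition

variable {T : ℝ}

theorem pt_mono (π : TimePartition T) {i j : ℕ} (hij : i ≤ j) (hj : j ≤ π.n) :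
    π.pt i ≤ π.pt j := by
  induction j, hij using Nat.le_induction with
  | base => exact le_rfl
  | succ k _ ih => exact (ih (by omega)).trans (π.pt_lt k (by omega)).le

theorem pt_strictMono (π : TimePartition T) {i j : ℕ} (hij : i < j) (hj : j ≤ π.n) :
    π.pt i < π.pt j :=
  (π.pt_lt i (by omega)).trans_le (π.pt_mono hij hj)

theorem pt_inj (π : TimePartition T) {i j : ℕ} (hi : i ≤ π.n) (hj : j ≤ π.n)
    (h : π.pt i = π.pt j) : i = j := by
  rcases lt_trichotomy i j with hij | hij | hij
  · exact absurd h (π.pt_strictMono hij hj).ne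
  · exact hij
  · exact absurd h (π.pt_strictMono hij hi).ne'

theorem le_last (π : TimePartition T) (t : Time T) : t ≤ π.pt π.n := by
  rw [← Subtype.coe_le_coe, π.pt_last]
  exact t.2.2

theorem first_le (π : TimePartition T) (t : Time T) : π.pt 0 ≤ t := by
  rw [← Subtype.coe_le_coe, π.pt_zero]
  exact t.2.1

theorem sub_le_mesh (π : TimePartition T) {i : ℕ} (hi : i < π.n) :
    (π.pt (i + 1) : ℝ) - π.pt i ≤ π.mesh :=
  le_ciSup (f := fun i : Fin π.n => ((π.pt (i + 1) : ℝ) - (π.pt i : ℝ)))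
    (Set.finite_range _).bddAbove ⟨i, hi⟩

theorem mesh_nonneg (π : TimePartition T) : 0 ≤ π.mesh :=
  Real.iSup_nonneg fun i => sub_nonneg.2 (π.pt_lt i i.2).le

open Classical in
/-- The index of the first partition point that is at least `t`. -/
def ceilIdx (π : TimePartition T) (t : Time T) : ℕ :=
  Nat.find (p := fun i => t ≤ π.pt i) ⟨π.n, π.le_last t⟩

theorem le_pt_ceilIdx (π : TimePartition T) (t : Time T) : t ≤ π.pt (π.ceilIdx t) := by
  classical
  exact Nat.find_spec (p := fun i => t ≤ π.pt i) _

theorem ceilIdx_le (π : TimePartition T) {t : Time T} {i : ℕ} (h : t ≤ π.pt i) :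
    π.ceilIdx t ≤ i := by
  classical
  exact Nat.find_min' (p := fun i => t ≤ π.pt i) _ h

theorem ceilIdx_le_n (π : TimePartition T) (t : Time T) : π.ceilIdx t ≤ π.n :=
  π.ceilIdx_le (π.le_last t)

theorem pt_lt_of_lt_ceilIdx (π : TimePartition T) {t : Time T} {i : ℕ} (h : i < π.ceilIdx t) :
    π.pt i < t := by
  classical
  exact not_le.1 (Nat.find_min (p := fun i => t ≤ π.pt i) _ h)

theorem ceilIdx_eq (π : TimePartition T) {t : Time T} {k : ℕ} (hk : k < π.n) (h1 : π.pt k < t)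
    (h2 : t ≤ π.pt (k + 1)) : π.ceilIdx t = k + 1 := by
  refine le_antisymm (π.ceilIdx_le h2) (Nat.succ_le_of_lt ?_)
  by_contra h
  exact absurd ((π.le_pt_ceilIdx t).trans (π.pt_mono (not_lt.1 h) hk.le)) (not_le.2 h1)

theorem ceilIdx_pt (π : TimePartition T) {k : ℕ} (hk : k ≤ π.n) : π.ceilIdx (π.pt k) = k := by
  refine le_antisymm (π.ceilIdx_le le_rfl) ?_
  by_contra h
  exact absurd ((π.le_pt_ceilIdx (π.pt k))) (not_le.2 (π.pt_strictMono (not_le.1 h) hk))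

theorem monotone_ceilIdx (π : TimePartition T) : Monotone π.ceilIdx := fun _ t h =>
  π.ceilIdx_le (h.trans (π.le_pt_ceilIdx t))

/-- The first partition point that is at least `t`. -/
def ceilPt (π : TimePartition T) (t : Time T) : Time T := π.pt (π.ceilIdx t)

theorem monotone_ceilPt (π : TimePartition T) : Monotone π.ceilPt := fun _ t h =>
  π.pt_mono (π.monotone_ceilIdx h) (π.ceilIdx_le_n t)

theorem dist_ceilPt_le (π : TimePartition T) (t : Time T) : dist t (π.ceilPt t) ≤ π.mesh := by
  rw [dist_comm, Subtype.dist_eq, Real.dist_eq, ceilPt,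
    abs_of_nonneg (sub_nonneg.2 (Subtype.coe_le_coe.2 (π.le_pt_ceilIdx t)))]
  rcases h : π.ceilIdx t with _ | k
  · rw [π.pt_zero]
    linarith [t.2.1, π.mesh_nonneg]
  · have h1 := π.pt_lt_of_lt_ceilIdx (t := t) (i := k) (by omega)
    have h2 := π.sub_le_mesh (i := k) (by have := π.ceilIdx_le_n t; omega)
    have h3 : (π.pt k : ℝ) < t := h1
    linarith

/-- `σ` contains all points of `π`. -/
def Refines (σ π : TimePartition T) : Prop := ∀ k ≤ π.n, ∃ i ≤ σ.n, σ.pt i = π.pt k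

/-- The partition whose points are the elements of a finite set. -/
def ofFinset (F : Finset (Time T)) (h0 : ∃ t ∈ F, (t : ℝ) = 0) (h1 : ∃ t ∈ F, (t : ℝ) = T) :
    TimePartition T :=
  have hc : 0 < F.card := Finset.card_pos.2 ⟨h0.choose, h0.choose_spec.1⟩
  { n := F.card - 1
    pt := fun i => F.orderEmbOfFin rfl ⟨min i (F.card - 1), by omega⟩
    pt_zero := by
      obtain ⟨t, ht, ht0⟩ := h0
      have h : F.orderEmbOfFin rfl ⟨0, hc⟩ ≤ t := by
        rw [Finset.orderEmbOfFin_zero rfl hc]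
        exact Finset.min'_le _ _ ht
      have h' : ((F.orderEmbOfFin rfl ⟨0, hc⟩ : Time T) : ℝ) ≤ t := h
      simp only [Nat.zero_min]
      exact le_antisymm (h'.trans ht0.le) (F.orderEmbOfFin rfl ⟨0, hc⟩).2.1
    pt_last := by
      obtain ⟨t, ht, ht0⟩ := h1
      have h : t ≤ F.orderEmbOfFin rfl ⟨F.card - 1, by omega⟩ := by
        rw [Finset.orderEmbOfFin_last rfl hc]
        exact Finset.le_max' _ _ ht
      have h' : T ≤ ((F.orderEmbOfFin rfl ⟨F.card - 1, by omega⟩ : Time T) : ℝ) := by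
        conv_lhs => rw [← ht0]
        exact h
      simp only [min_self]
      exact le_antisymm (F.orderEmbOfFin rfl ⟨F.card - 1, by omega⟩).2.2 h'
    pt_lt := fun i hi => by
      refine (F.orderEmbOfFin rfl).strictMono ?_
      rw [Fin.mk_lt_mk]
      omega }

theorem exists_pt_ofFinset (F : Finset (Time T)) (h0 : ∃ t ∈ F, (t : ℝ) = 0)
    (h1 : ∃ t ∈ F, (t : ℝ) = T) {t : Time T} (ht : t ∈ F) :
    ∃ i ≤ (ofFinset F h0 h1).n, (ofFinset F h0 h1).pt i = t := by
  have h : t ∈ Set.range (F.orderEmbOfFin rfl) := by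
    rw [Finset.range_orderEmbOfFin]; exact ht
  obtain ⟨⟨i, hi⟩, rfl⟩ := h
  refine ⟨i, by show i ≤ F.card - 1; omega, ?_⟩
  show F.orderEmbOfFin rfl ⟨min i (F.card - 1), _⟩ = _
  congr 1
  ext
  show min i (F.card - 1) = i
  omega

theorem exists_refines (π π' : TimePartition T) : ∃ σ : TimePartition T, σ.Refines π ∧
    σ.Refines π' := by
  classical
  set F : Finset (Time T) := (Finset.range (π.n + 1)).image π.pt ∪
    (Finset.range (π'.n + 1)).image π'.pt with hF
  have hm : ∀ k ≤ π.n, π.pt k ∈ F := fun k hk =>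
    Finset.mem_union_left _ (Finset.mem_image_of_mem _ (Finset.mem_range.2 (by omega)))
  have hm' : ∀ k ≤ π'.n, π'.pt k ∈ F := fun k hk =>
    Finset.mem_union_right _ (Finset.mem_image_of_mem _ (Finset.mem_range.2 (by omega)))
  have h0 : ∃ t ∈ F, (t : ℝ) = 0 := ⟨_, hm 0 (by omega), π.pt_zero⟩
  have h1 : ∃ t ∈ F, (t : ℝ) = T := ⟨_, hm π.n le_rfl, π.pt_last⟩
  exact ⟨ofFinset F h0 h1, fun k hk => exists_pt_ofFinset F h0 h1 (hm k hk),
    fun k hk => exists_pt_ofFinset F h0 h1 (hm' k hk)⟩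

end TimePartition

/-! ### Step sums -/

section StepSum

variable {T : ℝ} {G H K : Type*} [NormedAddCommGroup G] [InnerProductSpace ℝ G]
  [NormedAddCommGroup H] [InnerProductSpace ℝ H] [NormedAddCommGroup K] [InnerProductSpace ℝ K]

/-- The sum `∑ m(Φ(r_i), x(r_{i+1}) - x(r_i))` over a partition. -/
def stepSum (m : G →ₗ[ℝ] H →ₗ[ℝ] K) (Φ : Time T → G) (x : Time T → H) (π : TimePartition T) : K :=
  ∑ i ∈ Finset.range π.n, m (Φ (π.pt i)) (x (π.pt (i + 1)) - x (π.pt i))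

/-- The discretised path is constant on each $(\pi_k,\pi_{k+1}]$. On a refinement only the first
step after $\pi_k$ contributes, with the integrand taken at $\pi_k$ and the full increment over
$[\pi_k,\pi_{k+1}]$. Sums over $\pi$ and over $\sigma$ can thus be subtracted on the same partition.
-/
theorem stepSum_ceilPt (m : G →ₗ[ℝ] H →ₗ[ℝ] K) (Φ : Time T → G) (x : Time T → H)
    {σ π : TimePartition T} (h : σ.Refines π) :
    stepSum m Φ (fun t => x (π.ceilPt t)) σ = stepSum m Φ x π := by
  choose! φ hφn hφ using h
  have hlt : ∀ k < π.n, φ k < φ (k + 1) := fun k hk => by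
    by_contra hcon
    have h1 := σ.pt_mono (not_lt.1 hcon) (hφn k hk.le)
    rw [hφ _ hk.le, hφ _ hk] at h1
    exact absurd h1 (not_le.2 (π.pt_lt k hk))
  have h0 : φ 0 = 0 := by
    refine σ.pt_inj (hφn 0 (by omega)) (by omega) ?_
    rw [hφ 0 (by omega)]
    exact le_antisymm (π.first_le _) (σ.first_le _)
  have hn : φ π.n = σ.n := by
    refine σ.pt_inj (hφn _ le_rfl) le_rfl ?_
    rw [hφ _ le_rfl]
    exact le_antisymm (σ.le_last _) (π.le_last _)
  have key : ∀ k ≤ π.n, ∑ i ∈ Finset.range (φ k), m (Φ (σ.pt i))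
      (x (π.ceilPt (σ.pt (i + 1))) - x (π.ceilPt (σ.pt i))) =
      ∑ i ∈ Finset.range k, m (Φ (π.pt i)) (x (π.pt (i + 1)) - x (π.pt i)) := by
    intro k
    induction k with
    | zero => intro _; simp [h0]
    | succ k ih =>
      intro hk
      have hkn : k < π.n := hk
      have hceil : ∀ i, φ k < i → i ≤ φ (k + 1) → π.ceilPt (σ.pt i) = π.pt (k + 1) := by
        intro i hi1 hi2
        have hin : i ≤ σ.n := hi2.trans (hφn _ hk)
        rw [TimePartition.ceilPt, π.ceilIdx_eq hkn]
        · rw [← hφ k hkn.le]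
          exact σ.pt_strictMono hi1 hin
        · rw [← hφ (k + 1) hk]
          exact σ.pt_mono hi2 (hφn _ hk)
      rw [← Finset.sum_range_add_sum_Ico _ (hlt k hkn).le, ih hkn.le, Finset.sum_range_succ,
        Finset.sum_eq_sum_Ico_succ_bot (hlt k hkn),
        Finset.sum_eq_zero (s := Finset.Ico (φ k + 1) (φ (k + 1))), add_zero]
      · rw [hceil _ (Nat.lt_succ_self _) (hlt k hkn), hφ k hkn.le, TimePartition.ceilPt,
          π.ceilIdx_pt hkn.le]
      · intro i hi
        rw [Finset.mem_Ico] at hi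
        rw [hceil i (by omega) (by omega), hceil (i + 1) (by omega) (by omega), sub_self, map_zero]
  have := key π.n le_rfl
  rw [hn] at this
  exact this

/-- The extension by zero to negative times (and by the last value to times after `T`). -/
def extZero {E : Type*} [Zero E] (hT : 0 ≤ T) (Φ : Time T → E) (t : ℝ) : E :=
  if t < 0 then 0 else Φ (Set.projIcc 0 T hT t)

/-- The points of a partition, preceded by a negative time. -/
def TimePartition.extSeq (π : TimePartition T) : ℕ → ℝ
  | 0 => -1
  | i + 1 => π.pt (min i π.n)

theorem TimePartition.monotone_extSeq (π : TimePartition T) : Monotone π.extSeq := by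
  refine monotone_nat_of_le_succ fun n => ?_
  rcases n with _ | n
  · show (-1 : ℝ) ≤ π.pt (min 0 π.n)
    linarith [(π.pt (min 0 π.n)).2.1]
  · exact π.pt_mono (by omega) (by omega)

/-- Starting at time $-1$ adds a zero term and makes the integrand vanish at the first point, as the
2D Young inequality requires. -/
theorem stepSum_eq_sum_extSeq (hT : 0 ≤ T) (m : G →ₗ[ℝ] H →ₗ[ℝ] K) (Φ : Time T → G)
    (x : Time T → H) (π : TimePartition T) :
    stepSum m Φ x π = ∑ i ∈ Finset.range (π.n + 1), m (extZero hT Φ (π.extSeq i))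
      (x (Set.projIcc 0 T hT (π.extSeq (i + 1))) - x (Set.projIcc 0 T hT (π.extSeq i))) := by
  rw [Finset.sum_range_succ']
  have h0 : extZero hT Φ (π.extSeq 0) = 0 := by
    simp [extZero, TimePartition.extSeq]
  rw [h0, map_zero, LinearMap.zero_apply, add_zero]
  refine Finset.sum_congr rfl fun i hi => ?_
  rw [Finset.mem_range] at hi
  have e1 : π.extSeq (i + 1) = π.pt i := by
    show (π.pt (min i π.n) : ℝ) = _
    rw [min_eq_left hi.le]
  have e2 : π.extSeq (i + 1 + 1) = π.pt (i + 1) := by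
    show (π.pt (min (i + 1) π.n) : ℝ) = _
    rw [min_eq_left hi]
  rw [e1, e2, extZero, if_neg (not_lt.2 (π.pt i).2.1), Set.projIcc_val, Set.projIcc_val]

theorem norm_sq_stepSum_le (hT : 0 ≤ T) (m : G →ₗ[ℝ] H →ₗ[ℝ] K)
    (hm : ∀ g h g' h', ⟪m g h, m g' h'⟫ = ⟪g, g'⟫ * ⟪h, h'⟫) {q ρ CΦ CB : ℝ} (hq : 0 < q)
    (hρ : 0 < ρ) (hqρ : 1 < 1 / q + 1 / ρ) {Φ : Time T → G} {y : Time T → H}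
    (hΦ : VarBound2 q (covKer (extZero hT Φ) (extZero hT Φ)) CΦ)
    (hy : VarBound2 ρ (covKer y y) CB) (π : TimePartition T) :
    ‖stepSum m Φ y π‖ ^ 2 ≤ youngConst q ρ * (CΦ ^ (1 / q) * CB ^ (1 / ρ)) := by
  rw [stepSum_eq_sum_extSeq hT]
  exact norm_sq_sum_le m hm hq hρ hqρ (y := fun t => y (Set.projIcc 0 T hT t)) hΦ
    (hy.comp (Set.monotone_projIcc hT) (Set.monotone_projIcc hT)) π.extSeq π.monotone_extSeq
    (by simp [extZero, TimePartition.extSeq]) _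

theorem stepSum_sub_right (m : G →ₗ[ℝ] H →ₗ[ℝ] K) (Φ : Time T → G) (x y : Time T → H)
    (π : TimePartition T) :
    stepSum m Φ (fun t => x t - y t) π = stepSum m Φ x π - stepSum m Φ y π := by
  unfold stepSum
  rw [← Finset.sum_sub_distrib]
  refine Finset.sum_congr rfl fun i _ => ?_
  rw [← map_sub, sub_sub_sub_comm]

/-- Step sums over partitions of small mesh are close to each other, uniformly over integrands of
bounded two-dimensional variation. -/
theorem stepSum_uniformly_cauchy (hT : 0 ≤ T) (m : G →ₗ[ℝ] H →ₗ[ℝ] K)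
    (hm : ∀ g h g' h', ⟪m g h, m g' h'⟫ = ⟪g, g'⟫ * ⟪h, h'⟫) {q ρ CR : ℝ} (hq : 1 ≤ q)
    (hρ : 0 < ρ) (hqρ : 1 < 1 / q + 1 / ρ) {x : Time T → H} (hx : UniformContinuous x)
    (hxR : VarBound2 ρ (covKer x x) CR) (C : ℝ) {ε : ℝ} (hε : 0 < ε) :
    ∃ δ > 0, ∀ Φ : Time T → G, VarBound2 q (covKer (extZero hT Φ) (extZero hT Φ)) C →
      ∀ π π' : TimePartition T, π.mesh < δ → π'.mesh < δ →
        ‖stepSum m Φ x π - stepSum m Φ x π'‖ ≤ ε := by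
  -- Room for interpolation: $1/\rho'$ is the midpoint of $1-1/q$ and $1/\rho$.
  obtain ⟨ρ', hρρ', hqρ'⟩ : ∃ ρ' > ρ, 1 < 1 / q + 1 / ρ' := by
    have hq' : 1 / q ≤ 1 := by rw [div_le_one (by linarith)]; exact hq
    have hρ1 : 0 < 1 / ρ := by positivity
    refine ⟨1 / ((1 / ρ + (1 - 1 / q)) / 2), ?_, ?_⟩
    · rw [gt_iff_lt, lt_one_div hρ (by linarith)]
      linarith
    · rw [one_div_one_div]; linarith
  have hρ'0 : 0 < ρ' := hρ.trans hρρ'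
  set D := 2 ^ ρ * (2 ^ ρ * (CR + CR) + 2 ^ ρ * (CR + CR)) with hD
  -- The Young bound for the squared norm when the driver stays uniformly within $\eta$ of its
  -- discretisation, so that its covariance is at most $\eta^2$; it tends to $0$ with $\eta$.
  set bd : ℝ → ℝ := fun η => youngConst q ρ' *
    (C ^ (1 / q) * ((4 * (η * η)) ^ (ρ' - ρ) * D) ^ (1 / ρ')) with hbd
  have hbd0 : bd 0 = 0 := by
    have : (0 : ℝ) ^ (ρ' - ρ) = 0 := Real.zero_rpow (by linarith)
    simp [hbd, this, hρ'0.ne']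
  have hbdc : ContinuousAt bd 0 := by
    refine ContinuousAt.mul continuousAt_const (ContinuousAt.mul continuousAt_const ?_)
    refine ContinuousAt.rpow_const ?_ (Or.inr (by positivity))
    refine ContinuousAt.mul ?_ continuousAt_const
    exact ContinuousAt.rpow_const (by fun_prop) (Or.inr (by linarith))
  obtain ⟨η, hη0, hη⟩ : ∃ η > 0, bd η < (ε / 2) ^ 2 := by
    have h1 : ∀ᶠ η in 𝓝 (0 : ℝ), bd η < (ε / 2) ^ 2 :=
      hbdc.eventually_lt continuousAt_const (by rw [hbd0]; positivity)
    obtain ⟨r, hr, h2⟩ := Metric.eventually_nhds_iff.1 h1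
    exact ⟨r / 2, by positivity, h2 (by rw [Real.dist_eq, sub_zero, abs_of_pos (by positivity)]
                                        linarith)⟩
  obtain ⟨δ, hδ0, hδ⟩ := Metric.uniformContinuous_iff.1 hx η hη0
  refine ⟨δ, hδ0, fun Φ hΦ => ?_⟩
  have key : ∀ σ π : TimePartition T, σ.Refines π → π.mesh < δ →
      ‖stepSum m Φ x σ - stepSum m Φ x π‖ ≤ ε / 2 := by
    intro σ π hσπ hπ
    -- The difference is a step sum over $\sigma$ of the same integrand against `x - x ∘ π.ceilPt`.
    rw [← stepSum_ceilPt m Φ x hσπ, ← stepSum_sub_right]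
    have hid : Monotone (fun t : Time T => t) := monotone_id
    have hy : VarBound2 ρ (covKer (fun t => x t - x (π.ceilPt t))
        (fun t => x t - x (π.ceilPt t))) D :=
      VarBound2.covKer_sub (Ψ := fun t => x (π.ceilPt t)) hρ.le hxR
        (hxR.comp hid π.monotone_ceilPt)
        (hxR.comp π.monotone_ceilPt hid) (hxR.comp π.monotone_ceilPt π.monotone_ceilPt)
    have hsmall : ∀ t : Time T, ‖x t - x (π.ceilPt t)‖ ≤ η := fun t => by
      rw [← dist_eq_norm]
      exact (hδ ((π.dist_ceilPt_le t).trans_lt hπ)).le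
    have hy' := hy.interpolate hρ.le hρρ' (ε := η * η) fun s t =>
      (abs_real_inner_le_norm _ _).trans (mul_le_mul (hsmall s) (hsmall t) (norm_nonneg _) hη0.le)
    have h := norm_sq_stepSum_le hT m hm (by linarith) hρ'0 hqρ' hΦ hy' σ
    exact (abs_le_of_sq_le_sq' (h.trans hη.le) (by positivity)).2
  intro π π' hπ hπ'
  obtain ⟨σ, h1, h2⟩ := TimePartition.exists_refines π π'
  calc ‖stepSum m Φ x π - stepSum m Φ x π'‖
      = ‖(stepSum m Φ x σ - stepSum m Φ x π') - (stepSum m Φ x σ - stepSum m Φ x π)‖ := by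
        congr 1; abel
    _ ≤ ε / 2 + ε / 2 := (norm_sub_le _ _).trans (add_le_add (key σ π' h2 hπ') (key σ π h1 hπ))
    _ = ε := by ring

end StepSum

end YoungMalliavin

namespace YoungMalliavin

/-! ### One-dimensional variation -/

/-- `C` bounds the sums of the `q`-th powers of the increments of `f`. -/
def VarBound1 {S : Type*} [Preorder S] (q : ℝ) (f : S → ℝ) (C : ℝ) : Prop :=
  ∀ u : ℕ → S, Monotone u → ∀ m, ∑ i ∈ Finset.range m, |f (u (i + 1)) - f (u i)| ^ q ≤ C

section VarBound1

variable {S S₁ : Type*}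

theorem VarBound1.comp [Preorder S] [Preorder S₁] {q C : ℝ} {f : S → ℝ} (h : VarBound1 q f C)
    {α : S₁ → S} (hα : Monotone α) : VarBound1 q (fun s => f (α s)) C :=
  fun u hu m => h (α ∘ u) (hα.comp hu) m

theorem VarBound1.add [Preorder S] {q C C' : ℝ} (hq : 0 ≤ q) {f g : S → ℝ} (hf : VarBound1 q f C)
    (hg : VarBound1 q g C') : VarBound1 q (fun s => f s + g s) (2 ^ q * (C + C')) := by
  intro u hu m
  calc _ ≤ ∑ i ∈ Finset.range m, 2 ^ q *
        (|f (u (i + 1)) - f (u i)| ^ q + |g (u (i + 1)) - g (u i)| ^ q) :=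
        Finset.sum_le_sum fun i _ => by
          rw [add_sub_add_comm]; exact abs_add_rpow_le hq
    _ = 2 ^ q * (∑ i ∈ Finset.range m, |f (u (i + 1)) - f (u i)| ^ q +
          ∑ i ∈ Finset.range m, |g (u (i + 1)) - g (u i)| ^ q) := by
        simp only [← Finset.mul_sum, Finset.sum_add_distrib]
    _ ≤ _ := by
        have := hf u hu m
        have := hg u hu m
        gcongr

theorem VarBound1.mono_exponent [Preorder S] {q q' C : ℝ} (hq : 0 < q) (hqq' : q ≤ q') {f : S → ℝ}
    (h : VarBound1 q f C) : VarBound1 q' f (C ^ (q' / q)) := by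
  intro u hu m
  have h1 := sum_rpow_le_rpow_sum (Finset.range m) (f := fun i => |f (u (i + 1)) - f (u i)| ^ q)
    (fun _ _ => by positivity) (p := q' / q) ((one_le_div hq).2 hqq')
  simp only [← Real.rpow_mul (abs_nonneg _), mul_div_cancel₀ _ hq.ne'] at h1
  exact h1.trans (Real.rpow_le_rpow (Finset.sum_nonneg fun _ _ => by positivity) (h u hu m)
    (by have := hq.trans_le hqq'; positivity))

theorem VarBound2.mono_exponent [Preorder S] [Preorder S₁] {q q' C : ℝ} (hq : 0 < q)
    (hqq' : q ≤ q') {A : S → S₁ → ℝ} (h : VarBound2 q A C) : VarBound2 q' A (C ^ (q' / q)) := by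
  intro u v hu hv m n
  have h1 := sum_rpow_le_rpow_sum (Finset.range m ×ˢ Finset.range n)
    (f := fun x => |box A (u x.1) (u (x.1 + 1)) (v x.2) (v (x.2 + 1))| ^ q)
    (fun _ _ => by positivity) (p := q' / q) ((one_le_div hq).2 hqq')
  simp only [← Real.rpow_mul (abs_nonneg _), mul_div_cancel₀ _ hq.ne'] at h1
  rw [Finset.sum_product, Finset.sum_product] at h1
  refine h1.trans (Real.rpow_le_rpow (Finset.sum_nonneg fun _ _ => Finset.sum_nonneg fun _ _ =>
    by positivity) (h u v hu hv m n) (by have := hq.trans_le hqq'; positivity))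

/-- A difference of upper sets is an order-convex set, which a monotone sequence enters at most once
and leaves at most once. Each crossing costs at most $|B|^q$. -/
theorem varBound1_indicator [LinearOrder S] {U V : Set S} (hU : IsUpperSet U) (hV : IsUpperSet V)
    {f : S → ℝ} {q B C : ℝ} (hq : 0 < q) (hC0 : 0 ≤ C) (hB : ∀ t ∈ U \ V, |f t| ≤ B)
    (hC : ∀ u : ℕ → S, Monotone u → (∀ i, u i ∈ U \ V) → ∀ m,
      ∑ i ∈ Finset.range m, |f (u (i + 1)) - f (u i)| ^ q ≤ C) :
    VarBound1 q ((U \ V).indicator f) (C + 2 * |B| ^ q) := by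
  classical
  intro u hu m
  have hB0 : 0 ≤ |B| ^ q := by positivity
  set F := ((Finset.range (m + 1)).filter fun i => u i ∈ U \ V).image u with hF
  by_cases hne : F.Nonempty
  swap
  · have hno : ∀ i ≤ m, u i ∉ U \ V := fun i hi h => hne ⟨u i, Finset.mem_image_of_mem _
      (Finset.mem_filter.2 ⟨Finset.mem_range.2 (by omega), h⟩)⟩
    rw [Finset.sum_eq_zero]
    · positivity
    · intro i hi
      rw [Finset.mem_range] at hi
      rw [Set.indicator_of_notMem (hno _ hi), Set.indicator_of_notMem (hno _ hi.le), sub_zero,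
        abs_zero, Real.zero_rpow hq.ne']
  set lo := F.min' hne with hlo
  set hi := F.max' hne with hhi
  have hFI : ∀ t ∈ F, t ∈ U \ V := fun t ht => by
    obtain ⟨i, h1, rfl⟩ := Finset.mem_image.1 ht
    exact (Finset.mem_filter.1 h1).2
  have hloI := hFI lo (F.min'_mem hne)
  have hhiI := hFI hi (F.max'_mem hne)
  have hlohi : lo ≤ hi := F.min'_le _ (F.max'_mem hne)
  -- Clamping between the extreme visited points keeps the sequence inside `U \ V` and moves none of
  -- the visited points.
  set u' : ℕ → S := fun i => max lo (min hi (u i)) with hu'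
  have hu'mono : Monotone u' := fun i j hij => max_le_max le_rfl (min_le_min le_rfl (hu hij))
  have hu'I : ∀ i, u' i ∈ U \ V := fun i =>
    ⟨hU (le_max_left _ _) hloI.1, fun h => hhiI.2 (hV (max_le hlohi (min_le_left _ _)) h)⟩
  have hu'eq : ∀ i ≤ m, u i ∈ U \ V → u' i = u i := fun i him h => by
    have hm : u i ∈ F := Finset.mem_image_of_mem _
      (Finset.mem_filter.2 ⟨Finset.mem_range.2 (by omega), h⟩)
    rw [hu']
    simp only
    rw [min_eq_right (F.le_max' _ hm), max_eq_right (F.min'_le _ hm)]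
  -- An entrance is charged to the jump of the indicator of `U`, an exit to that of `V`. Both are
  -- monotone along `u`, so the charges telescope to at most one each.
  have hterm : ∀ i < m, |(U \ V).indicator f (u (i + 1)) - (U \ V).indicator f (u i)| ^ q ≤
      |f (u' (i + 1)) - f (u' i)| ^ q + |B| ^ q *
        ((U.indicator 1 (u (i + 1)) - U.indicator (1 : S → ℝ) (u i)) +
        (V.indicator 1 (u (i + 1)) - V.indicator (1 : S → ℝ) (u i))) := by
    intro i hi
    have hstep : u i ≤ u (i + 1) := hu (Nat.le_succ i)
    have hBt : ∀ t ∈ U \ V, |f t| ^ q ≤ |B| ^ q := fun t ht =>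
      Real.rpow_le_rpow (abs_nonneg _) ((hB t ht).trans (le_abs_self _)) hq.le
    have h0 : 0 ≤ |f (u' (i + 1)) - f (u' i)| ^ q := by positivity
    have hU' : u i ∈ U → u (i + 1) ∈ U := fun h => hU hstep h
    have hV' : u i ∈ V → u (i + 1) ∈ V := fun h => hV hstep h
    by_cases h1 : u i ∈ U \ V <;> by_cases h2 : u (i + 1) ∈ U \ V
    · rw [Set.indicator_of_mem h1, Set.indicator_of_mem h2, hu'eq _ hi.le h1, hu'eq _ hi h2]
      simp [h1.1, h1.2, h2.1, h2.2]
    · have h3 : u (i + 1) ∈ V := by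
        by_contra h; exact h2 ⟨hU' h1.1, h⟩
      rw [Set.indicator_of_mem h1, Set.indicator_of_notMem h2]
      have := hBt _ h1
      simp only [zero_sub, abs_neg, hU' h1.1, h1.1, h1.2, h3, Set.indicator_of_mem, Pi.one_apply,
        not_false_eq_true, Set.indicator_of_notMem]
      linarith
    · have h3 : u i ∉ U := fun h => h1 ⟨h, fun h' => h2.2 (hV' h')⟩
      have h4 : u i ∉ V := fun h => h2.2 (hV' h)
      rw [Set.indicator_of_notMem h1, Set.indicator_of_mem h2]
      have := hBt _ h2
      simp only [sub_zero, h2.1, h2.2, h3, h4, Set.indicator_of_mem, Pi.one_apply,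
        not_false_eq_true, Set.indicator_of_notMem]
      linarith
    · rw [Set.indicator_of_notMem h1, Set.indicator_of_notMem h2, sub_zero, abs_zero,
        Real.zero_rpow hq.ne']
      refine add_nonneg h0 (mul_nonneg hB0 (add_nonneg (sub_nonneg.2 ?_) (sub_nonneg.2 ?_)))
      · by_cases h : u i ∈ U
        · simp [h, hU' h]
        · rw [Set.indicator_of_notMem h]; exact Set.indicator_nonneg (fun _ _ => zero_le_one) _
      · by_cases h : u i ∈ V
        · simp [h, hV' h]
        · rw [Set.indicator_of_notMem h]; exact Set.indicator_nonneg (fun _ _ => zero_le_one) _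
  have hind : ∀ W : Set S, W.indicator 1 (u m) - W.indicator (1 : S → ℝ) (u 0) ≤ 1 := fun W => by
    have h1 : W.indicator (1 : S → ℝ) (u m) ≤ 1 :=
      Set.indicator_apply_le' (fun _ => le_rfl) fun _ => zero_le_one
    have h2 : 0 ≤ W.indicator (1 : S → ℝ) (u 0) := Set.indicator_nonneg (fun _ _ => zero_le_one) _
    linarith
  calc _ ≤ ∑ i ∈ Finset.range m, (|f (u' (i + 1)) - f (u' i)| ^ q + |B| ^ q *
        ((U.indicator 1 (u (i + 1)) - U.indicator (1 : S → ℝ) (u i)) +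
        (V.indicator 1 (u (i + 1)) - V.indicator (1 : S → ℝ) (u i)))) :=
        Finset.sum_le_sum fun i hi => hterm i (Finset.mem_range.1 hi)
    _ = ∑ i ∈ Finset.range m, |f (u' (i + 1)) - f (u' i)| ^ q + |B| ^ q *
        ((U.indicator 1 (u m) - U.indicator (1 : S → ℝ) (u 0)) +
        (V.indicator 1 (u m) - V.indicator (1 : S → ℝ) (u 0))) := by
        rw [Finset.sum_add_distrib, ← Finset.mul_sum, Finset.sum_add_distrib,
          Finset.sum_range_sub (fun i => U.indicator (1 : S → ℝ) (u i)),
          Finset.sum_range_sub (fun i => V.indicator (1 : S → ℝ) (u i))]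
    _ ≤ C + |B| ^ q * 2 := add_le_add (hC u' hu'mono hu'I m)
        (mul_le_mul_of_nonneg_left (by linarith [hind U, hind V]) hB0)
    _ = _ := by ring

theorem VarBound1.indicator [LinearOrder S] {U V : Set S} (hU : IsUpperSet U) (hV : IsUpperSet V)
    {f : S → ℝ} {q B C : ℝ} (hq : 0 < q) (hB : ∀ t, |f t| ≤ B) (hf : VarBound1 q f C) :
    VarBound1 q ((U \ V).indicator f) (C + 2 * |B| ^ q) := by
  intro u hu
  exact varBound1_indicator hU hV hq (by simpa using hf u hu 0) (fun t _ => hB t)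
    (fun u hu _ m => hf u hu m) u hu

/-- The rectangular increments of $f(s)f(t)$ are products of increments, so the double sum
factorises. -/
theorem VarBound1.covKer [Preorder S] {q C : ℝ} {f : S → ℝ} (hf : VarBound1 q f C) :
    VarBound2 q (covKer f f) (C * C) := by
  intro u v hu hv m n
  have e : ∀ i j, |box (YoungMalliavin.covKer f f) (u i) (u (i + 1)) (v j) (v (j + 1))| ^ q =
      |f (u (i + 1)) - f (u i)| ^ q * |f (v (j + 1)) - f (v j)| ^ q := fun i j => by
    rw [box_covKer, ← Real.mul_rpow (abs_nonneg _) (abs_nonneg _), ← abs_mul]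
    simp [mul_comm]
  simp only [e, ← Finset.mul_sum, ← Finset.sum_mul]
  exact mul_le_mul (hf u hu m) (hf v hv n) (Finset.sum_nonneg fun _ _ => by positivity)
    (by simpa using hf u hu 0)

variable {T : ℝ}

/-- Upper sets of $[0,T]$ pull back to upper sets of $\mathbb R$ lying in $[0,\infty)$, so the
extension by zero is again the indicator of a difference of upper sets. -/
theorem VarBound1.extZero_indicator (hT : 0 ≤ T) {U V : Set (Time T)} (hU : IsUpperSet U)
    (hV : IsUpperSet V) {b : Time T → ℝ} {q B C : ℝ} (hq : 0 < q) (hB : ∀ t, |b t| ≤ B)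
    (hb : VarBound1 q b C) :
    VarBound1 q (extZero hT ((U \ V).indicator b)) (C + 2 * |B| ^ q) := by
  have hup : ∀ W : Set (Time T), IsUpperSet W →
      IsUpperSet {t : ℝ | 0 ≤ t ∧ Set.projIcc 0 T hT t ∈ W} := fun W hW s t hst hs =>
    ⟨hs.1.trans hst, hW (Set.monotone_projIcc hT hst) hs.2⟩
  have e : extZero hT ((U \ V).indicator b) =
      ({t : ℝ | 0 ≤ t ∧ Set.projIcc 0 T hT t ∈ U} \
        {t : ℝ | 0 ≤ t ∧ Set.projIcc 0 T hT t ∈ V}).indicator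
        (fun t => b (Set.projIcc 0 T hT t)) := by
    funext t
    unfold extZero
    by_cases ht : t < 0
    · simp [ht]
    · rw [if_neg ht]
      by_cases h : Set.projIcc 0 T hT t ∈ U \ V
      · rw [Set.indicator_of_mem h]
        exact (Set.indicator_of_mem (show t ∈ {t : ℝ | 0 ≤ t ∧ Set.projIcc 0 T hT t ∈ U} \
          {t : ℝ | 0 ≤ t ∧ Set.projIcc 0 T hT t ∈ V} from
          ⟨⟨not_lt.1 ht, h.1⟩, fun h' => h.2 h'.2⟩)
          fun t => b (Set.projIcc 0 T hT t)).symm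
      · rw [Set.indicator_of_notMem h]
        exact (Set.indicator_of_notMem
          (fun h' => h ⟨h'.1.2, fun h'' => h'.2 ⟨not_lt.1 ht, h''⟩⟩)
          fun t => b (Set.projIcc 0 T hT t)).symm
  rw [e]
  exact VarBound1.indicator (hup U hU) (hup V hV) hq (fun t => hB _)
    (hb.comp (Set.monotone_projIcc hT))

theorem VarBound1.extZero (hT : 0 ≤ T) {b : Time T → ℝ} {q B C : ℝ} (hq : 0 < q)
    (hB : ∀ t, |b t| ≤ B) (hb : VarBound1 q b C) :
    VarBound1 q (extZero hT b) (C + 2 * |B| ^ q) := by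
  have h := VarBound1.extZero_indicator hT isUpperSet_univ isUpperSet_empty hq hB hb
  simpa using h

theorem Iio_eq_diff (t : Time T) : Set.Iio t = Set.univ \ Set.Ici t := by
  ext s; simp

theorem VarBound1.extZero_Iio (hT : 0 ≤ T) {b : Time T → ℝ} {q B C : ℝ} (hq : 0 < q)
    (hB : ∀ t, |b t| ≤ B) (hb : VarBound1 q b C) (t : Time T) :
    VarBound1 q (YoungMalliavin.extZero hT ((Set.Iio t).indicator b)) (C + 2 * |B| ^ q) := by
  rw [Iio_eq_diff]
  exact VarBound1.extZero_indicator hT isUpperSet_univ (isUpperSet_Ici t) hq hB hb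

/-! ### Block functions and duality -/

theorem abs_sum_rpow_le_of_card_le_two {ι : Type*} (s : Finset ι) (z : ι → ℝ) {q : ℝ} (hq : 0 < q)
    (hz : (s.filter fun i => z i ≠ 0).card ≤ 2) :
    |∑ i ∈ s, z i| ^ q ≤ 2 ^ q * ∑ i ∈ s, |z i| ^ q := by
  rw [← Finset.sum_filter_ne_zero]
  rcases (s.filter fun i => z i ≠ 0).eq_empty_or_nonempty with h | h
  · rw [h, Finset.sum_empty, abs_zero, Real.zero_rpow hq.ne']
    exact mul_nonneg (by positivity) (Finset.sum_nonneg fun _ _ => by positivity)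
  obtain ⟨k, hk, hmax⟩ := Finset.exists_max_image _ (fun i => |z i|) h
  have h1 : |∑ i ∈ s with z i ≠ 0, z i| ≤ 2 * |z k| := by
    refine (Finset.abs_sum_le_sum_abs _ _).trans ((Finset.sum_le_card_nsmul _ _ _ hmax).trans ?_)
    rw [nsmul_eq_mul]
    exact mul_le_mul_of_nonneg_right (by exact_mod_cast hz) (abs_nonneg _)
  refine (Real.rpow_le_rpow (abs_nonneg _) h1 hq.le).trans ?_
  rw [Real.mul_rpow two_pos.le (abs_nonneg _)]
  refine mul_le_mul_of_nonneg_left ?_ (by positivity)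
  exact Finset.single_le_sum (f := fun i => |z i| ^ q) (fun _ _ => by positivity)
    (Finset.mem_of_mem_filter k hk)

/-- With disjoint supports an increment sees at most two blocks, the one left and the one entered.
The constant therefore does not depend on the number of blocks. -/
theorem sum_block_increments_le [Preorder S] {f : ℕ → S → ℝ} {q C : ℝ} (hq : 0 < q)
    (hf : ∀ i, VarBound1 q (f i) C) (hd : ∀ i j t, f i t ≠ 0 → f j t ≠ 0 → i = j) (N : ℕ)
    (γ : ℕ → ℝ) (w : ℕ → S) (hw : Monotone w) (m : ℕ) :
    ∑ k ∈ Finset.range m, |∑ i ∈ Finset.range N, γ i * (f i (w (k + 1)) - f i (w k))| ^ q ≤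
      2 ^ q * C * ∑ i ∈ Finset.range N, |γ i| ^ q := by
  classical
  have hcard : ∀ k, ((Finset.range N).filter fun i =>
      γ i * (f i (w (k + 1)) - f i (w k)) ≠ 0).card ≤ 2 := by
    intro k
    have hone : ∀ t, ((Finset.range N).filter fun i => f i t ≠ 0).card ≤ 1 := fun t =>
      Finset.card_le_one.2 fun i hi j hj =>
        hd i j t (Finset.mem_filter.1 hi).2 (Finset.mem_filter.1 hj).2
    refine (Finset.card_le_card (t := ((Finset.range N).filter fun i => f i (w k) ≠ 0) ∪
      ((Finset.range N).filter fun i => f i (w (k + 1)) ≠ 0)) ?_).trans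
      ((Finset.card_union_le _ _).trans (add_le_add (hone _) (hone _)))
    intro i hi
    rw [Finset.mem_filter] at hi
    by_contra hcon
    rw [Finset.mem_union, Finset.mem_filter, Finset.mem_filter, not_or, not_and, not_and,
      not_not, not_not] at hcon
    exact hi.2 (by rw [hcon.1 hi.1, hcon.2 hi.1, sub_zero, mul_zero])
  calc _ ≤ ∑ k ∈ Finset.range m, 2 ^ q * ∑ i ∈ Finset.range N,
        |γ i * (f i (w (k + 1)) - f i (w k))| ^ q :=
        Finset.sum_le_sum fun k _ => abs_sum_rpow_le_of_card_le_two _ _ hq (hcard k)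
    _ = 2 ^ q * ∑ i ∈ Finset.range N, |γ i| ^ q *
        ∑ k ∈ Finset.range m, |f i (w (k + 1)) - f i (w k)| ^ q := by
        rw [← Finset.mul_sum, Finset.sum_comm]
        simp only [abs_mul, Real.mul_rpow (abs_nonneg _) (abs_nonneg _), Finset.mul_sum]
    _ ≤ 2 ^ q * ∑ i ∈ Finset.range N, |γ i| ^ q * C := by
        refine mul_le_mul_of_nonneg_left (Finset.sum_le_sum fun i _ => ?_) (by positivity)
        exact mul_le_mul_of_nonneg_left (hf i w hw m) (by positivity)
    _ = _ := by rw [← Finset.sum_mul]; ring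

/-- The block estimate is used in the first variable with the second frozen, then in the second. The
outcome is controlled by $\sum|\beta_{ij}|^q$ alone, as testing by duality requires. -/
theorem varBound2_block [Preorder S] [Preorder S₁] {f : ℕ → S → ℝ} {g : ℕ → S₁ → ℝ} {q C C' : ℝ}
    (hq : 0 < q) (hf : ∀ i, VarBound1 q (f i) C) (hd : ∀ i j t, f i t ≠ 0 → f j t ≠ 0 → i = j)
    (hg : ∀ i, VarBound1 q (g i) C') (hd' : ∀ i j t, g i t ≠ 0 → g j t ≠ 0 → i = j)
    (hC0 : 0 ≤ C) (M N : ℕ) (β : ℕ → ℕ → ℝ) :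
    VarBound2 q (fun s t => ∑ i ∈ Finset.range M, ∑ j ∈ Finset.range N, β i j * f i s * g j t)
      (2 ^ q * C * (2 ^ q * C') * ∑ i ∈ Finset.range M, ∑ j ∈ Finset.range N, |β i j| ^ q) := by
  intro u v hu hv m n
  have e : ∀ k l, box (fun s t => ∑ i ∈ Finset.range M, ∑ j ∈ Finset.range N, β i j * f i s * g j t)
      (u k) (u (k + 1)) (v l) (v (l + 1)) = ∑ i ∈ Finset.range M,
        (∑ j ∈ Finset.range N, β i j * (g j (v (l + 1)) - g j (v l))) *
          (f i (u (k + 1)) - f i (u k)) := fun k l => by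
    unfold box
    simp only [Finset.sum_mul, ← Finset.sum_add_distrib, ← Finset.sum_sub_distrib]
    refine Finset.sum_congr rfl fun i _ => Finset.sum_congr rfl fun j _ => ?_
    ring
  simp only [e]
  rw [Finset.sum_comm]
  calc _ ≤ ∑ l ∈ Finset.range n, 2 ^ q * C * ∑ i ∈ Finset.range M,
        |∑ j ∈ Finset.range N, β i j * (g j (v (l + 1)) - g j (v l))| ^ q :=
        Finset.sum_le_sum fun l _ => sum_block_increments_le hq hf hd M _ u hu m
    _ = 2 ^ q * C * ∑ i ∈ Finset.range M, ∑ l ∈ Finset.range n,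
        |∑ j ∈ Finset.range N, β i j * (g j (v (l + 1)) - g j (v l))| ^ q := by
        rw [← Finset.mul_sum, Finset.sum_comm]
    _ ≤ 2 ^ q * C * ∑ i ∈ Finset.range M, 2 ^ q * C' * ∑ j ∈ Finset.range N, |β i j| ^ q := by
        refine mul_le_mul_of_nonneg_left (Finset.sum_le_sum fun i _ => ?_) (by positivity)
        exact sum_block_increments_le hq hg hd' N _ v hv n
    _ = _ := by rw [← Finset.mul_sum]; ring

/-- With $q'=q/(q-1)$, test against the extremal of Hölder's inequality,
$\beta_i=\mathrm{sign}(D_i)|D_i|^{q'-1}$, for which $|\beta_i|^q=|D_i|^{q'}=\beta_iD_i$. -/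
theorem sum_rpow_le_of_dual {ι : Type*} (s : Finset ι) (D : ι → ℝ) {q Λ : ℝ} (hq : 1 < q)
    (h : ∀ β : ι → ℝ, |∑ i ∈ s, β i * D i| ≤ Λ * (∑ i ∈ s, |β i| ^ q) ^ (1 / q)) :
    ∑ i ∈ s, |D i| ^ (q / (q - 1)) ≤ |Λ| ^ (q / (q - 1)) := by
  have hq1 : 0 < q - 1 := by linarith
  have hq0 : 0 < q := by linarith
  set q' := q / (q - 1) with hq'
  have hq'1 : 1 < q' := by rw [hq', one_lt_div hq1]; linarith
  have hqq : q' - 1 = 1 / (q - 1) := by rw [hq']; field_simp; ring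
  set Z := ∑ i ∈ s, |D i| ^ q' with hZ
  have hZ0 : 0 ≤ Z := Finset.sum_nonneg fun _ _ => by positivity
  have h1 := h fun i => SignType.sign (D i) * |D i| ^ (q' - 1)
  have e1 : ∀ i, (SignType.sign (D i) * |D i| ^ (q' - 1)) * D i = |D i| ^ q' := fun i => by
    rw [mul_right_comm, sign_mul_self, mul_comm, ← Real.rpow_add_one' (abs_nonneg _) (by linarith),
      sub_add_cancel]
  have e2 : ∀ i, |SignType.sign (D i) * |D i| ^ (q' - 1)| ^ q = |D i| ^ q' := fun i => by
    rcases eq_or_ne (D i) 0 with h0 | h0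
    · simp [h0, Real.zero_rpow (by linarith : q' ≠ 0), Real.zero_rpow hq0.ne']
    · have hs : |((SignType.sign (D i) : SignType) : ℝ)| = 1 := by
        rcases lt_or_gt_of_ne h0 with h | h <;> simp [h]
      rw [abs_mul, hs, one_mul, abs_of_nonneg (by positivity), ← Real.rpow_mul (abs_nonneg _), hqq]
      congr 1
      rw [hq']; field_simp
  simp only [e1, e2] at h1
  rw [← hZ, abs_of_nonneg hZ0] at h1
  rcases hZ0.eq_or_lt with h0 | h0
  · rw [← h0]; positivity
  have h2 : Z ^ (1 / q') ≤ |Λ| := by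
    have hsplit : Z = Z ^ (1 / q') * Z ^ (1 / q) := by
      rw [← Real.rpow_add h0]
      have : 1 / q' + 1 / q = 1 := by rw [hq']; field_simp; ring
      rw [this, Real.rpow_one]
    have hpos : 0 < Z ^ (1 / q) := by positivity
    refine le_of_mul_le_mul_right ?_ hpos
    rw [← hsplit]
    exact h1.trans (mul_le_mul_of_nonneg_right (le_abs_self _) hpos.le)
  calc Z = (Z ^ (1 / q')) ^ q' := by
        rw [← Real.rpow_mul hZ0, one_div_mul_cancel (by linarith), Real.rpow_one]
    _ ≤ _ := Real.rpow_le_rpow (by positivity) h2 (by linarith)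

end VarBound1

end YoungMalliavin

namespace YoungMalliavin

/-! ### The mesh filter -/

section Mesh

variable {T : ℝ}

theorem eventually_mesh_lt {δ : ℝ} (hδ : 0 < δ) : ∀ᶠ π in meshZero T, π.mesh < δ :=
  (eventually_lt_nhds hδ).comap _

theorem eventually_meshZero_of_mesh_lt {p : TimePartition T → Prop} {δ : ℝ} (hδ : 0 < δ)
    (h : ∀ π : TimePartition T, π.mesh < δ → p π) : ∀ᶠ π in meshZero T, p π :=
  (eventually_mesh_lt hδ).mono h

/-- Countable generation is what makes almost sure limits along the mesh filter measurable. -/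
instance : (meshZero T).IsCountablyGenerated := by
  unfold meshZero; infer_instance

/-- The partition of `[0, T]` into `n + 1` intervals of equal length. -/
def uniformPartition (hT : 0 < T) (n : ℕ) : TimePartition T where
  n := n + 1
  pt i := Set.projIcc 0 T hT.le (T * i / (n + 1))
  pt_zero := by simp [Set.projIcc, hT.le]
  pt_last := by
    have : T * ((n + 1 : ℕ) : ℝ) / (n + 1) = T := by push_cast; field_simp
    rw [this]
    simp [Set.projIcc, hT.le]
  pt_lt i hi := by
    have hn : (0 : ℝ) < n + 1 := by positivity
    have hin : (i : ℝ) + 1 ≤ n + 1 := by exact_mod_cast hi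
    have h1 : T * (i : ℝ) / (n + 1) ∈ Set.Icc 0 T :=
      ⟨by positivity, by rw [div_le_iff₀ hn]; nlinarith⟩
    have h2 : T * ((i + 1 : ℕ) : ℝ) / (n + 1) ∈ Set.Icc 0 T :=
      ⟨by positivity, by rw [div_le_iff₀ hn]; push_cast; nlinarith⟩
    rw [Set.projIcc_of_mem _ h1, Set.projIcc_of_mem _ h2, Subtype.mk_lt_mk]
    push_cast
    gcongr
    linarith

theorem mesh_uniformPartition_le (hT : 0 < T) (n : ℕ) :
    (uniformPartition hT n).mesh ≤ T / (n + 1) := by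
  have : Nonempty (Fin (uniformPartition hT n).n) := ⟨⟨0, Nat.succ_pos _⟩⟩
  refine ciSup_le fun i => ?_
  have hn : (0 : ℝ) < n + 1 := by positivity
  have hi : (i : ℕ) < n + 1 := i.2
  have hin : ((i : ℕ) : ℝ) + 1 ≤ n + 1 := by exact_mod_cast hi
  have h1 : T * ((i : ℕ) : ℝ) / (n + 1) ∈ Set.Icc 0 T :=
    ⟨by positivity, by rw [div_le_iff₀ hn]; nlinarith⟩
  have h2 : T * (((i : ℕ) + 1 : ℕ) : ℝ) / (n + 1) ∈ Set.Icc 0 T :=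
    ⟨by positivity, by rw [div_le_iff₀ hn]; push_cast; nlinarith⟩
  show ((Set.projIcc 0 T hT.le (T * (((i : ℕ) + 1 : ℕ) : ℝ) / (n + 1)) : ℝ)) -
    (Set.projIcc 0 T hT.le (T * ((i : ℕ) : ℝ) / (n + 1)) : ℝ) ≤ _
  rw [Set.projIcc_of_mem _ h1, Set.projIcc_of_mem _ h2]
  refine le_of_eq ?_
  push_cast
  field_simp
  ring

theorem tendsto_uniformPartition (hT : 0 < T) :
    Tendsto (uniformPartition hT) atTop (meshZero T) := by
  refine tendsto_comap_iff.2 ?_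
  refine squeeze_zero (fun n => TimePartition.mesh_nonneg _) (mesh_uniformPartition_le hT) ?_
  have h := tendsto_one_div_add_atTop_nhds_zero_nat (𝕜 := ℝ)
  have := h.const_mul T
  simpa [div_eq_mul_inv] using this

theorem meshZero_neBot (hT : 0 < T) : (meshZero T).NeBot :=
  (tendsto_uniformPartition hT).neBot

end Mesh

/-! ### Convergence of step sums -/

section Limits

variable {T : ℝ} {G H K : Type*} [NormedAddCommGroup G] [InnerProductSpace ℝ G]
  [NormedAddCommGroup H] [InnerProductSpace ℝ H] [NormedAddCommGroup K] [InnerProductSpace ℝ K]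

/-- Step sums converge, uniformly over integrands of bounded two-dimensional variation. -/
theorem exists_limit_stepSum [CompleteSpace K] {ι : Type*} (hT : 0 < T) (m : G →ₗ[ℝ] H →ₗ[ℝ] K)
    (hm : ∀ g h g' h', ⟪m g h, m g' h'⟫ = ⟪g, g'⟫ * ⟪h, h'⟫) {q ρ CR C : ℝ} (hq : 1 ≤ q)
    (hρ : 0 < ρ) (hqρ : 1 < 1 / q + 1 / ρ) {x : Time T → H} (hx : UniformContinuous x)
    (hxR : VarBound2 ρ (covKer x x) CR) {Φ : ι → Time T → G}
    (hΦ : ∀ t, VarBound2 q (covKer (extZero hT.le (Φ t)) (extZero hT.le (Φ t))) C) :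
    ∃ L : ι → K, ∀ ε > 0, ∃ δ > 0, ∀ t, ∀ π : TimePartition T, π.mesh < δ →
      ‖stepSum m (Φ t) x π - L t‖ ≤ ε := by
  have := meshZero_neBot hT
  have hlim : ∀ t, ∃ L, Tendsto (stepSum m (Φ t) x) (meshZero T) (𝓝 L) := fun t => by
    refine cauchy_map_iff_exists_tendsto.1 ?_
    rw [Metric.cauchy_iff]
    refine ⟨inferInstance, fun ε hε => ?_⟩
    obtain ⟨δ, hδ, h⟩ := stepSum_uniformly_cauchy hT.le m hm hq hρ hqρ hx hxR C (half_pos hε)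
    refine ⟨_, image_mem_map (eventually_mesh_lt hδ), ?_⟩
    rintro _ ⟨π, hπ, rfl⟩ _ ⟨π', hπ', rfl⟩
    rw [dist_eq_norm]
    exact (h _ (hΦ t) π π' hπ hπ').trans_lt (half_lt_self hε)
  choose L hL using hlim
  refine ⟨L, fun ε hε => ?_⟩
  obtain ⟨δ, hδ, h⟩ := stepSum_uniformly_cauchy hT.le m hm hq hρ hqρ hx hxR C hε
  refine ⟨δ, hδ, fun t π hπ => ?_⟩
  refine le_of_tendsto ((tendsto_const_nhds.sub (hL t)).norm) ?_
  exact eventually_meshZero_of_mesh_lt hδ fun π' hπ' => h _ (hΦ t) π π' hπ hπ'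

theorem inner_smul_smul_eq (g : ℝ) (h : H) (g' : ℝ) (h' : H) :
    ⟪(LinearMap.lsmul ℝ H : ℝ →ₗ[ℝ] H →ₗ[ℝ] H) g h,
      (LinearMap.lsmul ℝ H : ℝ →ₗ[ℝ] H →ₗ[ℝ] H) g' h'⟫ = ⟪g, g'⟫ * ⟪h, h'⟫ := by
  simp [real_inner_smul_left, real_inner_smul_right]
  ring

/-- The Riemann sum of `b` against a vector-valued path `x`. -/
def stepInt (b : Time T → ℝ) (x : Time T → H) (π : TimePartition T) : H :=
  stepSum (LinearMap.lsmul ℝ H : ℝ →ₗ[ℝ] H →ₗ[ℝ] H) b x π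

theorem stepInt_Iio_sub (b : Time T → ℝ) (x : Time T → H) (π : TimePartition T) {s t : Time T}
    (hst : s ≤ t) :
    stepInt ((Set.Iio t).indicator b) x π - stepInt ((Set.Iio s).indicator b) x π =
      stepInt ((Set.Ici s \ Set.Ici t).indicator b) x π := by
  unfold stepInt stepSum
  rw [← Finset.sum_sub_distrib]
  refine Finset.sum_congr rfl fun i _ => ?_
  rw [LinearMap.lsmul_apply, LinearMap.lsmul_apply, LinearMap.lsmul_apply, ← sub_smul]
  congr 1
  by_cases h1 : π.pt i < s
  · simp [Set.indicator, h1, h1.trans_le hst, not_le.2 h1]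
  · simp [Set.indicator, h1, not_lt.1 h1]

/-- The indefinite Riemann sums of a function of finite variation have mutual covariances of
two-dimensional variation bounded uniformly over the partitions. -/
theorem exists_varBound2_stepInt (hT : 0 ≤ T) {q ρ CR : ℝ} (hq : 1 < q) (hρ : 0 < ρ)
    (hqρ : 1 < 1 / q + 1 / ρ) {x : Time T → H} (hxR : VarBound2 ρ (covKer x x) CR)
    {b : Time T → ℝ} {B C : ℝ} (hB : ∀ t, |b t| ≤ B) (hb : VarBound1 q b C) :
    ∃ Λ : ℝ, ∀ π σ : TimePartition T, VarBound2 (q / (q - 1))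
      (covKer (fun t => stepInt ((Set.Iio t).indicator b) x π)
        (fun t => stepInt ((Set.Iio t).indicator b) x σ)) Λ := by
  have hq0 : 0 < q := by linarith
  set C₁ := C + 2 * |B| ^ q with hC₁
  have hC0 : 0 ≤ C := by simpa using hb (fun _ => ⟨0, le_rfl, hT⟩) monotone_const 0
  have hC₁0 : 0 ≤ C₁ := by positivity
  set κ := 2 ^ q * C₁ * (2 ^ q * C₁) with hκ
  have hκ0 : 0 ≤ κ := by positivity
  -- The Young bound for a block kernel with $\sum|\beta_{ij}|^q=1$, raised to the conjugate
  -- exponent; `κ` is the constant of `varBound2_block`.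
  refine ⟨|youngConst q ρ * (κ ^ (1 / q) * CR ^ (1 / ρ))| ^ (q / (q - 1)), ?_⟩
  intro π σ u v hu hv m n
  have e : ∀ i j, box (covKer (fun t => stepInt ((Set.Iio t).indicator b) x π)
        (fun t => stepInt ((Set.Iio t).indicator b) x σ)) (u i) (u (i + 1)) (v j) (v (j + 1)) =
      ⟪stepInt ((Set.Ici (u i) \ Set.Ici (u (i + 1))).indicator b) x π,
        stepInt ((Set.Ici (v j) \ Set.Ici (v (j + 1))).indicator b) x σ⟫ := fun i j => by
    rw [box_covKer, stepInt_Iio_sub _ _ _ (hu (Nat.le_succ i)),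
      stepInt_Iio_sub _ _ _ (hv (Nat.le_succ j))]
  simp only [e]
  rw [← Finset.sum_product']
  -- The matrix of boxes is tested against an arbitrary $\beta$. The pairing is a single 2D Riemann
  -- sum against $\langle x,x\rangle$ of the block kernel $\sum\beta_{ij}\,(b\mathbf
  -- 1_{[u_i,u_{i+1})})\otimes(b\mathbf 1_{[v_j,v_{j+1})})$, whose $q$-variation is at most
  -- $\kappa\sum|\beta_{ij}|^q$.
  refine sum_rpow_le_of_dual _ (fun z : ℕ × ℕ =>
    ⟪stepInt ((Set.Ici (u z.1) \ Set.Ici (u (z.1 + 1))).indicator b) x π,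
      stepInt ((Set.Ici (v z.2) \ Set.Ici (v (z.2 + 1))).indicator b) x σ⟫) hq fun β => ?_
  have hvar : ∀ w : ℕ → Time T, ∀ i : ℕ,
      VarBound1 q (extZero hT ((Set.Ici (w i) \ Set.Ici (w (i + 1))).indicator b)) C₁ :=
    fun w i => VarBound1.extZero_indicator hT (isUpperSet_Ici _) (isUpperSet_Ici _) hq0 hB hb
  have hdis : ∀ w : ℕ → Time T, Monotone w → ∀ (i j : ℕ) (t : ℝ),
      extZero hT ((Set.Ici (w i) \ Set.Ici (w (i + 1))).indicator b) t ≠ 0 →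
      extZero hT ((Set.Ici (w j) \ Set.Ici (w (j + 1))).indicator b) t ≠ 0 → i = j := by
    intro w hw i j t hi hj
    have hmem : ∀ k, extZero hT ((Set.Ici (w k) \ Set.Ici (w (k + 1))).indicator b) t ≠ 0 →
        w k ≤ Set.projIcc 0 T hT t ∧ Set.projIcc 0 T hT t < w (k + 1) := fun k hk => by
      unfold extZero at hk
      by_cases ht : t < 0
      · simp [ht] at hk
      · rw [if_neg ht] at hk
        have := Set.mem_of_indicator_ne_zero hk
        exact ⟨this.1, not_le.1 this.2⟩
    have hi' := hmem i hi
    have hj' := hmem j hj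
    by_contra hne
    rcases lt_or_gt_of_ne hne with h | h
    · exact absurd ((hw (show i + 1 ≤ j from h)).trans hj'.1) (not_le.2 hi'.2)
    · exact absurd ((hw (show j + 1 ≤ i from h)).trans hi'.1) (not_le.2 hj'.2)
  set A : ℝ → ℝ → ℝ := fun s t => ∑ i ∈ Finset.range m, ∑ j ∈ Finset.range n, β (i, j) *
    extZero hT ((Set.Ici (u i) \ Set.Ici (u (i + 1))).indicator b) s *
    extZero hT ((Set.Ici (v j) \ Set.Ici (v (j + 1))).indicator b) t with hA
  have hAvar := varBound2_block hq0 (hvar u) (hdis u hu) (hvar v) (hdis v hv) hC₁0 m n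
    (fun i j => β (i, j))
  have hneg : ∀ f : Time T → ℝ, extZero hT f (-1) = 0 := fun f => by simp [extZero]
  have hyoung := young_inequality_2d hq0 hρ hqρ hAvar
    (hxR.comp (Set.monotone_projIcc hT) (Set.monotone_projIcc hT)) π.extSeq σ.extSeq
    π.monotone_extSeq σ.monotone_extSeq
    (fun t => by
      show ∑ i ∈ Finset.range m, ∑ j ∈ Finset.range n, β (i, j) * extZero hT _ (-1) * _ = 0
      simp [hneg])
    (fun t => by
      show ∑ i ∈ Finset.range m, ∑ j ∈ Finset.range n, β (i, j) * _ * extZero hT _ (-1) = 0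
      simp [hneg]) (π.n + 1) (σ.n + 1)
  have hsum : ∑ z ∈ Finset.range m ×ˢ Finset.range n, β z *
      ⟪stepInt ((Set.Ici (u z.1) \ Set.Ici (u (z.1 + 1))).indicator b) x π,
        stepInt ((Set.Ici (v z.2) \ Set.Ici (v (z.2 + 1))).indicator b) x σ⟫ =
      ∑ k ∈ Finset.range (π.n + 1), ∑ l ∈ Finset.range (σ.n + 1),
        A (π.extSeq k) (σ.extSeq l) * box (fun s t => covKer x x (Set.projIcc 0 T hT s)
          (Set.projIcc 0 T hT t)) (π.extSeq k) (π.extSeq (k + 1)) (σ.extSeq l)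
          (σ.extSeq (l + 1)) := by
    have hbox : ∀ k l, box (fun s t => covKer x x (Set.projIcc 0 T hT s)
          (Set.projIcc 0 T hT t)) (π.extSeq k) (π.extSeq (k + 1)) (σ.extSeq l)
          (σ.extSeq (l + 1)) = ⟪x (Set.projIcc 0 T hT (π.extSeq (k + 1))) -
            x (Set.projIcc 0 T hT (π.extSeq k)), x (Set.projIcc 0 T hT (σ.extSeq (l + 1))) -
            x (Set.projIcc 0 T hT (σ.extSeq l))⟫ := fun k l => by
      rw [← box_covKer]; rfl
    simp only [hbox]
    unfold stepInt
    simp only [stepSum_eq_sum_extSeq hT, sum_inner, inner_sum, inner_smul_smul_eq, hA,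
      Finset.sum_product, Finset.sum_mul, Finset.mul_sum]
    have inner4 : ∀ F : ℕ → ℕ → ℕ → ℕ → ℝ,
        ∑ i ∈ Finset.range m, ∑ j ∈ Finset.range n, ∑ l ∈ Finset.range (σ.n + 1),
          ∑ k ∈ Finset.range (π.n + 1), F i j k l =
        ∑ k ∈ Finset.range (π.n + 1), ∑ l ∈ Finset.range (σ.n + 1),
          ∑ i ∈ Finset.range m, ∑ j ∈ Finset.range n, F i j k l := fun F => by
      calc _ = ∑ i ∈ Finset.range m, ∑ j ∈ Finset.range n, ∑ k ∈ Finset.range (π.n + 1),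
            ∑ l ∈ Finset.range (σ.n + 1), F i j k l :=
            Finset.sum_congr rfl fun i _ => Finset.sum_congr rfl fun j _ => Finset.sum_comm
        _ = ∑ i ∈ Finset.range m, ∑ k ∈ Finset.range (π.n + 1), ∑ j ∈ Finset.range n,
            ∑ l ∈ Finset.range (σ.n + 1), F i j k l :=
            Finset.sum_congr rfl fun i _ => Finset.sum_comm
        _ = ∑ i ∈ Finset.range m, ∑ k ∈ Finset.range (π.n + 1), ∑ l ∈ Finset.range (σ.n + 1),
            ∑ j ∈ Finset.range n, F i j k l :=
            Finset.sum_congr rfl fun i _ => Finset.sum_congr rfl fun k _ => Finset.sum_comm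
        _ = ∑ k ∈ Finset.range (π.n + 1), ∑ i ∈ Finset.range m, ∑ l ∈ Finset.range (σ.n + 1),
            ∑ j ∈ Finset.range n, F i j k l := Finset.sum_comm
        _ = _ := Finset.sum_congr rfl fun k _ => Finset.sum_comm
    rw [inner4]
    refine Finset.sum_congr rfl fun k _ => Finset.sum_congr rfl fun l _ =>
      Finset.sum_congr rfl fun i _ => Finset.sum_congr rfl fun j _ => ?_
    simp only [RCLike.inner_apply, conj_trivial]
    ring
  rw [hsum]
  refine hyoung.trans (le_of_eq ?_)
  rw [← hκ, Real.mul_rpow hκ0 (Finset.sum_nonneg fun _ _ => Finset.sum_nonneg fun _ _ =>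
    by positivity), Finset.sum_product]
  ring

end Limits

end YoungMalliavin

namespace YoungMalliavin

/-! ### Multiplication by a function of finite variation -/

section Product

variable {S H : Type*} [Preorder S] [NormedAddCommGroup H] [InnerProductSpace ℝ H]

/-- A discrete product rule. The term carrying the increments of `a` needs a bound on `Ψ` itself;
this is a bound on the increment from `s₀`, where `Ψ` vanishes. -/
theorem sum_test_smul_le {a : S → ℝ} {Ψ : S → H} {q B Ca M : ℝ} (hq : 0 < q) {s₀ : S}
    (hs₀ : ∀ s, s₀ ≤ s) (hΨ0 : Ψ s₀ = 0) (hB : ∀ s, |a s| ≤ B) (ha : VarBound1 q a Ca) {ι : Type*}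
    (J : Finset ι) (w : ι → H)
    (hM : ∀ u : ℕ → S, Monotone u → ∀ m, ∑ i ∈ Finset.range m, ∑ j ∈ J,
      |⟪Ψ (u (i + 1)) - Ψ (u i), w j⟫| ^ q ≤ M)
    (u : ℕ → S) (hu : Monotone u) (m : ℕ) :
    ∑ i ∈ Finset.range m, ∑ j ∈ J,
      |⟪a (u (i + 1)) • Ψ (u (i + 1)) - a (u i) • Ψ (u i), w j⟫| ^ q ≤
      2 ^ q * (|B| ^ q + Ca) * M := by
  have hone : ∀ s, ∑ j ∈ J, |⟪Ψ s, w j⟫| ^ q ≤ M := fun s => by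
    have h := hM (fun i => if i = 0 then s₀ else s) (monotone_nat_of_le_succ fun i => by
      by_cases hi : i = 0 <;> simp [hi, hs₀]) 1
    simpa [hΨ0] using h
  have hM0 : 0 ≤ M := (Finset.sum_nonneg fun _ _ => by positivity).trans (hone s₀)
  have e : ∀ i j, |⟪a (u (i + 1)) • Ψ (u (i + 1)) - a (u i) • Ψ (u i), w j⟫| ^ q ≤
      2 ^ q * (|B| ^ q * |⟪Ψ (u (i + 1)) - Ψ (u i), w j⟫| ^ q +
        |a (u (i + 1)) - a (u i)| ^ q * |⟪Ψ (u i), w j⟫| ^ q) := fun i j => by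
    have h1 : ⟪a (u (i + 1)) • Ψ (u (i + 1)) - a (u i) • Ψ (u i), w j⟫ =
        a (u (i + 1)) * ⟪Ψ (u (i + 1)) - Ψ (u i), w j⟫ +
          (a (u (i + 1)) - a (u i)) * ⟪Ψ (u i), w j⟫ := by
      simp only [inner_sub_left, real_inner_smul_left]; ring
    rw [h1]
    refine (abs_add_rpow_le hq.le).trans ?_
    rw [abs_mul, abs_mul, Real.mul_rpow (abs_nonneg _) (abs_nonneg _),
      Real.mul_rpow (abs_nonneg _) (abs_nonneg _)]
    have : |a (u (i + 1))| ^ q ≤ |B| ^ q :=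
      Real.rpow_le_rpow (abs_nonneg _) ((hB _).trans (le_abs_self _)) hq.le
    gcongr
  calc _ ≤ ∑ i ∈ Finset.range m, ∑ j ∈ J,
        2 ^ q * (|B| ^ q * |⟪Ψ (u (i + 1)) - Ψ (u i), w j⟫| ^ q +
        |a (u (i + 1)) - a (u i)| ^ q * |⟪Ψ (u i), w j⟫| ^ q) :=
        Finset.sum_le_sum fun i _ => Finset.sum_le_sum fun j _ => e i j
    _ = 2 ^ q * (|B| ^ q * ∑ i ∈ Finset.range m, ∑ j ∈ J,
          |⟪Ψ (u (i + 1)) - Ψ (u i), w j⟫| ^ q +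
        ∑ i ∈ Finset.range m, |a (u (i + 1)) - a (u i)| ^ q * ∑ j ∈ J, |⟪Ψ (u i), w j⟫| ^ q) := by
        simp only [← Finset.mul_sum, Finset.sum_add_distrib]
    _ ≤ 2 ^ q * (|B| ^ q * M + ∑ i ∈ Finset.range m, |a (u (i + 1)) - a (u i)| ^ q * M) := by
        have h1 := hM u hu m
        have h2 : ∀ i ∈ Finset.range m, |a (u (i + 1)) - a (u i)| ^ q *
            ∑ j ∈ J, |⟪Ψ (u i), w j⟫| ^ q ≤ |a (u (i + 1)) - a (u i)| ^ q * M := fun i _ =>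
          mul_le_mul_of_nonneg_left (hone _) (by positivity)
        have h3 := Finset.sum_le_sum h2
        gcongr
    _ ≤ 2 ^ q * (|B| ^ q * M + Ca * M) := by
        rw [← Finset.sum_mul]
        have := ha u hu m
        gcongr
    _ = _ := by ring

/-- The factor is inserted in one variable at a time: the test vectors are first the increments of
`Ψ`, then those of `a • Ψ`. -/
theorem VarBound2.covKer_smul {a : S → ℝ} {Ψ : S → H} {q B Ca M : ℝ} (hq : 0 < q) {s₀ : S}
    (hs₀ : ∀ s, s₀ ≤ s) (hΨ0 : Ψ s₀ = 0) (hB : ∀ s, |a s| ≤ B) (ha : VarBound1 q a Ca)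
    (hΨ : VarBound2 q (covKer Ψ Ψ) M) :
    VarBound2 q (covKer (fun s => a s • Ψ s) (fun s => a s • Ψ s))
      (2 ^ q * (|B| ^ q + Ca) * (2 ^ q * (|B| ^ q + Ca) * M)) := by
  have h1 : ∀ u v : ℕ → S, Monotone u → Monotone v → ∀ m n,
      ∑ i ∈ Finset.range m, ∑ j ∈ Finset.range n,
        |⟪a (u (i + 1)) • Ψ (u (i + 1)) - a (u i) • Ψ (u i), Ψ (v (j + 1)) - Ψ (v j)⟫| ^ q ≤
        2 ^ q * (|B| ^ q + Ca) * M := fun u v hu hv m n =>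
    sum_test_smul_le hq hs₀ hΨ0 hB ha (Finset.range n) (fun j => Ψ (v (j + 1)) - Ψ (v j))
      (fun u' hu' m' => by simpa only [box_covKer] using hΨ u' v hu' hv m' n) u hu m
  intro u v hu hv m n
  simp only [box_covKer]
  rw [Finset.sum_comm]
  have h2 := sum_test_smul_le hq hs₀ hΨ0 hB ha (Finset.range m)
    (fun i => a (u (i + 1)) • Ψ (u (i + 1)) - a (u i) • Ψ (u i))
    (fun v' hv' n' => by
      rw [Finset.sum_comm]
      simpa only [real_inner_comm] using h1 u v' hu hv' m n') v hv n
  simpa only [real_inner_comm] using h2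

theorem VarBound2.of_tendsto {ι : Type*} {l : Filter ι} [l.NeBot] {Φ : ι → S → H} {Φ' : S → H}
    {q C : ℝ} (hq : 0 ≤ q) (h : ∀ᶠ i in l, VarBound2 q (covKer (Φ i) (Φ i)) C)
    (hlim : ∀ s, Tendsto (fun i => Φ i s) l (𝓝 (Φ' s))) : VarBound2 q (covKer Φ' Φ') C := by
  intro u v hu hv m n
  refine le_of_tendsto (f := fun k => ∑ i ∈ Finset.range m, ∑ j ∈ Finset.range n,
    |box (covKer (Φ k) (Φ k)) (u i) (u (i + 1)) (v j) (v (j + 1))| ^ q) ?_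
    (h.mono fun k hk => hk u v hu hv m n)
  refine tendsto_finsetSum _ fun i _ => tendsto_finsetSum _ fun j _ => ?_
  simp only [box_covKer]
  exact ((((hlim _).sub (hlim _)).inner ((hlim _).sub (hlim _))).abs).rpow_const (Or.inr hq)

end Product

/-! ### Volterra integrals -/

section Volterra

variable {T : ℝ} {H H' K : Type*} [NormedAddCommGroup H] [InnerProductSpace ℝ H]
  [NormedAddCommGroup H'] [InnerProductSpace ℝ H'] [NormedAddCommGroup K] [InnerProductSpace ℝ K]

/-- A path in a Hilbert space along which functions of finite `q`-variation can be integrated. -/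
structure IsYoungPath (q : ℝ) (x : Time T → H) : Prop where
  two_lt : 2 < q
  uniformContinuous : UniformContinuous x
  exists_varBound : ∃ ρ CR : ℝ, 0 < ρ ∧ 1 < 1 / q + 1 / ρ ∧ VarBound2 ρ (covKer x x) CR

/-- A bounded function of finite `q`-variation. -/
def BoundedVar (q : ℝ) (b : Time T → ℝ) : Prop :=
  ∃ B C : ℝ, (∀ t, |b t| ≤ B) ∧ VarBound1 q b C

/-- The integrands $\mathbf 1_{[0,t)}b$ have $q$-variation bounded uniformly in $t$, so the Riemann
sums converge uniformly in $t$. The covariance of the error has bounded variation of the smaller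
order $q/(q-1)$, and interpolation with the uniform smallness makes its $q$-variation small. -/
theorem exists_indefinite_integral [CompleteSpace H] (hT : 0 < T) {q : ℝ} {x : Time T → H}
    (hx : IsYoungPath q x) {b : Time T → ℝ} (hb : BoundedVar q b) :
    ∃ k : Time T → H,
      (∀ t, Tendsto (stepInt ((Set.Iio t).indicator b) x) (meshZero T) (𝓝 (k t))) ∧
      (∃ C, VarBound2 q (covKer k k) C) ∧
      ∀ ε > 0, ∃ δ > 0, ∀ π : TimePartition T, π.mesh < δ → VarBound2 q
        (covKer (fun t => stepInt ((Set.Iio t).indicator b) x π - k t)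
          (fun t => stepInt ((Set.Iio t).indicator b) x π - k t)) ε := by
  obtain ⟨hq2, hxc, ρ, CR, hρ, hqρ, hxR⟩ := hx
  obtain ⟨B, C, hB, hb⟩ := hb
  have := meshZero_neBot hT
  have hq0 : 0 < q := by linarith
  have hq1 : 1 < q := by linarith
  have hq'0 : 0 < q / (q - 1) := div_pos hq0 (by linarith)
  -- Here $q>2$ is essential: the order obtained by duality must lie strictly below $q$.
  have hq'q : q / (q - 1) < q := by rw [div_lt_iff₀ (by linarith)]; nlinarith
  obtain ⟨k, hk⟩ := exists_limit_stepSum hT _ inner_smul_smul_eq hq1.le hρ hqρ hxc hxR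
    (Φ := fun t : Time T => (Set.Iio t).indicator b)
    (fun t => (VarBound1.extZero_Iio hT.le hq0 hB hb t).covKer)
  have hlim : ∀ t, Tendsto (stepInt ((Set.Iio t).indicator b) x) (meshZero T) (𝓝 (k t)) := by
    intro t
    rw [Metric.tendsto_nhds]
    intro ε hε
    obtain ⟨δ, hδ, h⟩ := hk (ε / 2) (half_pos hε)
    refine eventually_meshZero_of_mesh_lt hδ fun π hπ => ?_
    rw [dist_eq_norm]
    exact (h t π hπ).trans_lt (half_lt_self hε)
  obtain ⟨Λ, hΛ⟩ := exists_varBound2_stepInt hT.le hq1 hρ hqρ hxR hB hb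
  refine ⟨k, hlim, ⟨_, VarBound2.mono_exponent hq'0 hq'q.le
    (VarBound2.of_tendsto hq'0.le (Eventually.of_forall fun π => hΛ π π) hlim)⟩, fun ε hε => ?_⟩
  set D := 2 ^ (q / (q - 1)) * (2 ^ (q / (q - 1)) * (Λ + Λ) + 2 ^ (q / (q - 1)) * (Λ + Λ)) with hD
  -- The error is the limit in $\sigma$ of the difference of the sums over $\pi$ and over $\sigma$,
  -- whose mutual covariances are bounded uniformly; grid bounds survive pointwise limits.
  have hdiff : ∀ π, VarBound2 (q / (q - 1))
      (covKer (fun t => stepInt ((Set.Iio t).indicator b) x π - k t)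
        (fun t => stepInt ((Set.Iio t).indicator b) x π - k t)) D := fun π =>
    VarBound2.of_tendsto hq'0.le (Eventually.of_forall fun σ => VarBound2.covKer_sub hq'0.le
      (hΛ π π) (hΛ π σ) (hΛ σ π) (hΛ σ σ)) fun t => tendsto_const_nhds.sub (hlim t)
  have hcont : ContinuousAt (fun η : ℝ => (4 * (η * η)) ^ (q - q / (q - 1)) * D) 0 := by
    refine ContinuousAt.mul ?_ continuousAt_const
    exact ContinuousAt.rpow_const (by fun_prop) (Or.inr (by linarith))
  have hev : ∀ᶠ η in 𝓝 (0 : ℝ), (4 * (η * η)) ^ (q - q / (q - 1)) * D < ε := by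
    refine hcont.eventually_lt continuousAt_const ?_
    have : (0 : ℝ) ^ (q - q / (q - 1)) = 0 := Real.zero_rpow (by linarith)
    simpa [this] using hε
  obtain ⟨r, hr, hη⟩ := Metric.eventually_nhds_iff.1 hev
  obtain ⟨δ, hδ, h⟩ := hk (r / 2) (half_pos hr)
  refine ⟨δ, hδ, fun π hπ => ?_⟩
  refine ((hdiff π).interpolate hq'0.le hq'q (ε := r / 2 * (r / 2)) fun s t =>
    (abs_real_inner_le_norm _ _).trans (mul_le_mul (h s π hπ) (h t π hπ) (norm_nonneg _)
      (half_pos hr).le)).mono (hη ?_).le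
  rw [Real.dist_eq, sub_zero, abs_of_pos (half_pos hr)]
  linarith

/-- The initial time. -/
def zeroTime (hT : 0 ≤ T) : Time T := ⟨0, Set.left_mem_Icc.2 hT⟩

omit [InnerProductSpace ℝ H] in
theorem extZero_of_apply_zero (hT : 0 ≤ T) {Φ : Time T → H} (h0 : Φ (zeroTime hT) = 0) :
    extZero hT Φ = fun t => Φ (Set.projIcc 0 T hT t) := by
  funext t
  unfold extZero
  split_ifs with ht
  · rw [Set.projIcc_of_le_left hT ht.le]; exact h0.symm
  · rfl

theorem stepSum_sub_left (m : H →ₗ[ℝ] H' →ₗ[ℝ] K) (Φ Ψ : Time T → H) (x : Time T → H')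
    (π : TimePartition T) :
    stepSum m (fun t => Φ t - Ψ t) x π = stepSum m Φ x π - stepSum m Ψ x π := by
  unfold stepSum
  rw [← Finset.sum_sub_distrib]
  refine Finset.sum_congr rfl fun i _ => ?_
  exact LinearMap.map_sub₂ m _ _ _

/-- The inner integral $k$ vanishes at time $0$, and $ak$ inherits a finite $q$-variation, so the
outer sums converge. Replacing $k$ by its Riemann sum over a fine partition changes the outer sum
little, uniformly in the outer partition. Hence the joint limit in two independent meshes exists and
equals the iterated one. -/
theorem exists_volterra_integral [CompleteSpace H] [CompleteSpace K] (hT : 0 < T) {q : ℝ}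
    {x : Time T → H} (hx : IsYoungPath q x) {x' : Time T → H'} (hx' : IsYoungPath q x')
    (m : H →ₗ[ℝ] H' →ₗ[ℝ] K) (hm : ∀ g h g' h', ⟪m g h, m g' h'⟫ = ⟪g, g'⟫ * ⟪h, h'⟫)
    {a b : Time T → ℝ} (ha : BoundedVar q a) (hb : BoundedVar q b) :
    ∃ (k : Time T → H) (Λ : K),
      (∀ t, Tendsto (stepInt ((Set.Iio t).indicator b) x) (meshZero T) (𝓝 (k t))) ∧
      Tendsto (stepSum m (fun t => a t • k t) x') (meshZero T) (𝓝 Λ) ∧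
      Tendsto (fun π : TimePartition T × TimePartition T =>
        stepSum m (fun t => a t • stepInt ((Set.Iio t).indicator b) x π.1) x' π.2)
        (meshZero T ×ˢ meshZero T) (𝓝 Λ) := by
  obtain ⟨k, hlim, ⟨C, hC⟩, hsmall⟩ := exists_indefinite_integral hT hx hb
  have := meshZero_neBot hT
  obtain ⟨hq2, hxc, ρ, CR, hρ, hqρ, hxR⟩ := hx'
  obtain ⟨B, Ca, hB, ha⟩ := ha
  have hq0 : 0 < q := by linarith
  have hbot : ∀ s : Time T, ((zeroTime hT.le) : Time T) ≤ s := fun s => s.2.1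
  have hstep0 : ∀ π, stepInt ((Set.Iio ((zeroTime hT.le) : Time T)).indicator b) x π = 0 := by
    intro π
    unfold stepInt stepSum
    refine Finset.sum_eq_zero fun i _ => ?_
    have h0 : (Set.Iio (zeroTime hT.le)).indicator b (π.pt i) = 0 :=
      Set.indicator_of_notMem (s := Set.Iio (zeroTime hT.le))
        (fun h => absurd (Set.mem_Iio.1 h) (not_lt.2 (hbot _))) b
    rw [h0, map_zero, LinearMap.zero_apply]
  have hk0 : k (zeroTime hT.le) = 0 :=
    tendsto_nhds_unique (hlim _) (by simp only [funext hstep0]; exact tendsto_const_nhds)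
  have hvar : ∀ {Ψ : Time T → H} {M : ℝ}, Ψ (zeroTime hT.le) = 0 → VarBound2 q (covKer Ψ Ψ) M →
      VarBound2 q (covKer (extZero hT.le fun t => a t • Ψ t) (extZero hT.le fun t => a t • Ψ t))
        (2 ^ q * (|B| ^ q + Ca) * (2 ^ q * (|B| ^ q + Ca) * M)) := fun h0 hM => by
    rw [extZero_of_apply_zero hT.le (by simp [h0])]
    exact (VarBound2.covKer_smul hq0 hbot h0 hB ha hM).comp (Set.monotone_projIcc hT.le)
      (Set.monotone_projIcc hT.le)
  obtain ⟨L, hL⟩ := exists_limit_stepSum (ι := Unit) hT m hm (by linarith) hρ hqρ hxc hxR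
    (Φ := fun _ t => a t • k t) (fun _ => hvar hk0 hC)
  have hLlim : Tendsto (stepSum m (fun t => a t • k t) x') (meshZero T) (𝓝 (L ())) := by
    rw [Metric.tendsto_nhds]
    intro ε hε
    obtain ⟨δ, hδ, h⟩ := hL (ε / 2) (half_pos hε)
    refine eventually_meshZero_of_mesh_lt hδ fun π hπ => ?_
    rw [dist_eq_norm]
    exact (h () π hπ).trans_lt (half_lt_self hε)
  refine ⟨k, L (), hlim, hLlim, ?_⟩
  set κ := 2 ^ q * (|B| ^ q + Ca) with hκ
  have herr : ∀ ε > 0, ∃ δ > 0, ∀ π : TimePartition T, π.mesh < δ → ∀ π' : TimePartition T,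
      ‖stepSum m (fun t => a t • stepInt ((Set.Iio t).indicator b) x π) x' π' -
        stepSum m (fun t => a t • k t) x' π'‖ ≤ ε := by
    intro ε hε
    have hcont : ContinuousAt (fun η : ℝ =>
        youngConst q ρ * ((κ * (κ * η)) ^ (1 / q) * CR ^ (1 / ρ))) 0 := by
      refine ContinuousAt.mul continuousAt_const (ContinuousAt.mul ?_ continuousAt_const)
      exact ContinuousAt.rpow_const (by fun_prop) (Or.inr (by positivity))
    have hev : ∀ᶠ η in 𝓝 (0 : ℝ),
        youngConst q ρ * ((κ * (κ * η)) ^ (1 / q) * CR ^ (1 / ρ)) < ε ^ 2 := by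
      refine hcont.eventually_lt continuousAt_const ?_
      have : (0 : ℝ) ^ (1 / q) = 0 := Real.zero_rpow (by positivity)
      simp only [mul_zero, this, zero_mul]
      positivity
    obtain ⟨r, hr, hη⟩ := Metric.eventually_nhds_iff.1 hev
    obtain ⟨δ, hδ, h⟩ := hsmall (r / 2) (half_pos hr)
    refine ⟨δ, hδ, fun π hπ π' => ?_⟩
    rw [← stepSum_sub_left]
    simp only [← smul_sub]
    have h1 := norm_sq_stepSum_le hT.le m hm hq0 hρ hqρ
      (hvar (by rw [hstep0, hk0, sub_zero]) (h π hπ)) hxR π'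
    refine (abs_le_of_sq_le_sq' (h1.trans (hη ?_).le) hε.le).2
    rw [Real.dist_eq, sub_zero, abs_of_pos (half_pos hr)]
    linarith
  rw [Metric.tendsto_nhds]
  intro ε hε
  obtain ⟨δ, hδ, h⟩ := herr (ε / 2) (half_pos hε)
  have h2 := (Metric.tendsto_nhds.1 hLlim) (ε / 2) (half_pos hε)
  filter_upwards [(eventually_mesh_lt hδ).prod_mk h2] with π hπ
  rw [dist_eq_norm] at hπ ⊢
  calc _ = ‖(stepSum m (fun t => a t • stepInt ((Set.Iio t).indicator b) x π.1) x' π.2 -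
        stepSum m (fun t => a t • k t) x' π.2) +
        (stepSum m (fun t => a t • k t) x' π.2 - L ())‖ := by congr 1; abel
    _ < ε / 2 + ε / 2 := (norm_add_le _ _).trans_lt (add_lt_add_of_le_of_lt (h _ hπ.1 _) hπ.2)
    _ = ε := by ring

theorem exists_limit_stepInt [CompleteSpace H] (hT : 0 < T) {q : ℝ} {x : Time T → H}
    (hx : IsYoungPath q x) {b : Time T → ℝ} (hb : BoundedVar q b) :
    ∃ h : H, Tendsto (stepInt b x) (meshZero T) (𝓝 h) := by
  obtain ⟨hq2, hxc, ρ, CR, hρ, hqρ, hxR⟩ := hx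
  obtain ⟨B, C, hB, hb⟩ := hb
  obtain ⟨L, hL⟩ := exists_limit_stepSum (ι := Unit) hT _ inner_smul_smul_eq (by linarith) hρ hqρ
    hxc hxR (Φ := fun _ => b)
    (fun _ => (VarBound1.extZero hT.le (by linarith) hB hb).covKer)
  refine ⟨L (), ?_⟩
  rw [Metric.tendsto_nhds]
  intro ε hε
  obtain ⟨δ, hδ, h⟩ := hL (ε / 2) (half_pos hε)
  refine eventually_meshZero_of_mesh_lt hδ fun π hπ => ?_
  rw [dist_eq_norm]
  exact (h () π hπ).trans_lt (half_lt_self hε)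

end Volterra

end YoungMalliavin

namespace YoungMalliavin

/-! ### Piecewise paths of finite variation -/

section Piecewise

variable {T : ℝ}

theorem BoundedVar.add {q : ℝ} (hq : 0 ≤ q) {f g : Time T → ℝ} (hf : BoundedVar q f)
    (hg : BoundedVar q g) : BoundedVar q (fun t => f t + g t) := by
  obtain ⟨B, C, hB, hC⟩ := hf
  obtain ⟨B', C', hB', hC'⟩ := hg
  exact ⟨B + B', _, fun t => (abs_add_le _ _).trans (add_le_add (hB t) (hB' t)), hC.add hq hC'⟩

theorem boundedVar_zero {q : ℝ} (hq : 0 < q) : BoundedVar q (fun _ : Time T => 0) :=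
  ⟨0, 0, fun _ => by simp, fun u _ m => by simp [Real.zero_rpow hq.ne']⟩

theorem BoundedVar.mono_exponent {q q' : ℝ} (hq : 0 < q) (hqq' : q ≤ q') {f : Time T → ℝ}
    (hf : BoundedVar q f) : BoundedVar q' f := by
  obtain ⟨B, C, hB, hC⟩ := hf
  exact ⟨B, _, hB, hC.mono_exponent hq hqq'⟩

/-- Sequences taking only two values bound the oscillation on `U \ V`, hence the function there;
extending it by zero then costs two jumps. -/
theorem boundedVar_indicator_of_finitePVarOn {p : ℝ} (hp : 0 < p) {U V : Set (Time T)}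
    (hU : IsUpperSet U) (hV : IsUpperSet V) {f : Time T → ℝ} (hf : FinitePVarOn p f (U \ V)) :
    BoundedVar p ((U \ V).indicator f) := by
  obtain ⟨C, hC⟩ := hf
  have hC' : ∀ u : ℕ → Time T, Monotone u → (∀ i, u i ∈ U \ V) → ∀ m,
      ∑ i ∈ Finset.range m, |f (u (i + 1)) - f (u i)| ^ p ≤ max C 0 := fun u hu huI m => by
    refine le_trans (le_of_eq (Finset.sum_congr rfl fun i _ => ?_))
      ((hC m u hu huI).trans (le_max_left _ _))
    rw [Real.dist_eq, abs_sub_comm]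
  obtain ⟨B, hB⟩ : ∃ B, ∀ t ∈ U \ V, |f t| ≤ B := by
    rcases (U \ V).eq_empty_or_nonempty with h | ⟨s, hs⟩
    · exact ⟨0, fun t ht => by rw [h] at ht; exact ht.elim⟩
    refine ⟨|f s| + (max C 0) ^ (1 / p), fun t ht => ?_⟩
    have key : ∀ s t : Time T, s ≤ t → s ∈ U \ V → t ∈ U \ V →
        |f t - f s| ≤ (max C 0) ^ (1 / p) := fun s t hst hs ht => by
      have h := hC' (fun i => if i = 0 then s else t) (monotone_nat_of_le_succ fun i => by
        by_cases hi : i = 0 <;> simp [hi, hst]) (fun i => by split_ifs <;> assumption) 1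
      simp only [Finset.sum_range_one, zero_add, one_ne_zero, if_true, if_false] at h
      calc |f t - f s| = (|f t - f s| ^ p) ^ (1 / p) := by
            rw [← Real.rpow_mul (abs_nonneg _), mul_one_div_cancel hp.ne', Real.rpow_one]
        _ ≤ _ := Real.rpow_le_rpow (by positivity) h (by positivity)
    have h1 : |f t - f s| ≤ (max C 0) ^ (1 / p) := by
      rcases le_total s t with h | h
      · exact key s t h hs ht
      · rw [abs_sub_comm]; exact key t s h ht hs
    calc |f t| = |f s + (f t - f s)| := by congr 1; ring
      _ ≤ _ := (abs_add_le _ _).trans (add_le_add le_rfl h1)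
  refine ⟨|B|, _, fun t => ?_, varBound1_indicator hU hV hp (le_max_right C 0) hB hC'⟩
  by_cases ht : t ∈ U \ V
  · rw [Set.indicator_of_mem ht]; exact (hB t ht).trans (le_abs_self _)
  · rw [Set.indicator_of_notMem ht, abs_zero]; exact abs_nonneg _

theorem finitePVarOn_singleton {p : ℝ} (hp : 0 < p) (f : Time T → ℝ) (t : Time T) :
    FinitePVarOn p f (Set.Ici t \ Set.Ioi t) := by
  refine ⟨0, fun m u _ h => ?_⟩
  have : ∀ i, u i = t := fun i => le_antisymm (not_lt.1 (h i).2) (h i).1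
  simp [this, Real.zero_rpow hp.ne']

/-- The function is the finite sum of its restrictions to the open intervals and to the partition
points, each an order-convex set. Its values at the partition points are arbitrary and cost only
jumps. -/
theorem boundedVar_of_piecewise {p : ℝ} (hp : 0 < p) {f : Time T → ℝ} (π : TimePartition T)
    (hf : ∀ i < π.n, FinitePVarOn p f (Set.Ioo (π.pt i) (π.pt (i + 1)))) : BoundedVar p f := by
  have hpt : ∀ t : Time T, BoundedVar p ((Set.Ici t \ Set.Ioi t).indicator f) := fun t =>
    boundedVar_indicator_of_finitePVarOn hp (isUpperSet_Ici t) (isUpperSet_Ioi t)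
      (finitePVarOn_singleton hp f t)
  have key : ∀ k ≤ π.n, BoundedVar p ((Set.Iio (π.pt k)).indicator f) := by
    intro k
    induction k with
    | zero =>
      intro _
      have : Set.Iio (π.pt 0) = ∅ := by
        ext t; simpa using π.first_le t
      simpa [this] using boundedVar_zero hp
    | succ k ih =>
      intro hk
      have hoo : Set.Ioo (π.pt k) (π.pt (k + 1)) = Set.Ioi (π.pt k) \ Set.Ici (π.pt (k + 1)) := by
        ext t; simp
      have h1 := hf k hk
      rw [hoo] at h1
      have h2 := ((ih (by omega)).add hp.le (hpt (π.pt k))).add hp.le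
        (boundedVar_indicator_of_finitePVarOn hp (isUpperSet_Ioi _) (isUpperSet_Ici _) h1)
      refine (congrArg (BoundedVar p) (funext fun t => ?_)).mp h2
      have hlt := π.pt_lt k hk
      rcases lt_trichotomy t (π.pt k) with h | h | h
      · simp [Set.indicator, h, h.trans hlt, h.ne, not_lt.2 h.le]
      · subst h
        simp [Set.indicator, hlt]
      · simp [Set.indicator, h, h.ne', not_lt.2 h.le]
  have h := (key π.n le_rfl).add hp.le (hpt (π.pt π.n))
  refine (congrArg (BoundedVar p) (funext fun t => ?_)).mp h
  rcases (π.le_last t).lt_or_eq with h | h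
  · simp [Set.indicator, h, h.ne]
  · subst h; simp [Set.indicator]

theorem PiecewisePVar.boundedVar {E : Type*} [PseudoMetricSpace E] {p : ℝ} (hp : 0 < p)
    {f : Time T → E} (hf : PiecewisePVar p f) {φ : E → ℝ} (hφ : ∀ x y, dist (φ x) (φ y) ≤ dist x y) :
    BoundedVar p (fun t => φ (f t)) := by
  obtain ⟨π, h⟩ := hf
  refine boundedVar_of_piecewise hp π fun i hi => ?_
  obtain ⟨C, hC⟩ := (h i hi).2
  exact ⟨C, fun m u hu huS => (Finset.sum_le_sum fun i _ =>
    Real.rpow_le_rpow dist_nonneg (hφ _ _) hp.le).trans (hC m u hu huS)⟩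

/-- Repeated terms are deleted; they do not contribute when `F` vanishes on the diagonal. -/
theorem exists_strict_refinement {S : Type*} [PartialOrder S] (u : ℕ → S) (hu : Monotone u)
    (m : ℕ) : ∃ (n : ℕ) (w : ℕ → S), (∀ i < n, w i < w (i + 1)) ∧ w 0 = u 0 ∧ w n = u m ∧
      ∀ F : S → S → ℝ, (∀ s, F s s = 0) →
        ∑ i ∈ Finset.range m, F (u i) (u (i + 1)) = ∑ i ∈ Finset.range n, F (w i) (w (i + 1)) := by
  induction m with
  | zero => exact ⟨0, u, by simp, rfl, rfl, by simp⟩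
  | succ m ih =>
    obtain ⟨n, w, hw, h0, hn, hF⟩ := ih
    rcases (hu (Nat.le_succ m)).eq_or_lt with h | h
    · refine ⟨n, w, hw, h0, hn.trans h, fun F hF0 => ?_⟩
      rw [Finset.sum_range_succ, hF F hF0, show u (m + 1) = u m from h.symm, hF0, add_zero]
    · refine ⟨n + 1, fun i => if i ≤ n then w i else u (m + 1), fun i hi => ?_, by simp [h0],
        by simp, fun F hF0 => ?_⟩
      · rcases (Nat.lt_succ_iff.1 hi).lt_or_eq with h' | h'
        · simp [h'.le, Nat.succ_le_of_lt h', hw i h']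
        · subst h'; simpa [hn] using h
      · rw [Finset.sum_range_succ, hF F hF0, Finset.sum_range_succ]
        congr 1
        · refine Finset.sum_congr rfl fun i hi => ?_
          rw [Finset.mem_range] at hi
          simp [hi.le, Nat.succ_le_of_lt hi]
        · simp [hn]

/-- Passage from arbitrary monotone sequences to partitions: the endpoints $0$ and $T$ are added and
the repetitions deleted. The new terms are nonnegative. -/
theorem exists_partition_sum_le (hT : 0 ≤ T) (u : ℕ → Time T) (hu : Monotone u) (m : ℕ) :
    ∃ π : TimePartition T, ∀ F : Time T → Time T → ℝ, (∀ s, F s s = 0) → (∀ s t, 0 ≤ F s t) →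
      ∑ i ∈ Finset.range m, F (u i) (u (i + 1)) ≤
        ∑ i ∈ Finset.range π.n, F (π.pt i) (π.pt (i + 1)) := by
  set u' : ℕ → Time T := fun i => if i = 0 then zeroTime hT else if i ≤ m + 1 then u (i - 1) else
    ⟨T, Set.right_mem_Icc.2 hT⟩ with hu'
  have hmono : Monotone u' := monotone_nat_of_le_succ fun i => by
    rcases Nat.eq_zero_or_pos i with h | h
    · simp only [hu', h, if_true]
      exact (u' 1).2.1
    · by_cases h1 : i + 1 ≤ m + 1
      · simp only [hu', h.ne', h1, show i ≤ m + 1 by omega, if_true, if_false,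
          Nat.add_eq_zero_iff, one_ne_zero, and_false]
        exact hu (by omega)
      · simp only [hu', h1, if_false, Nat.add_eq_zero_iff, one_ne_zero, and_false]
        exact (u' i).2.2
  obtain ⟨n, w, hw, h0, hn, hF⟩ := exists_strict_refinement u' hmono (m + 2)
  refine ⟨⟨n, w, by rw [h0]; simp [hu', zeroTime], by rw [hn]; simp [hu'], hw⟩,
    fun F hF0 hFn => ?_⟩
  show _ ≤ ∑ i ∈ Finset.range n, F (w i) (w (i + 1))
  rw [← hF F hF0, Finset.sum_range_succ, Finset.sum_range_succ']
  have h1 : ∑ i ∈ Finset.range m, F (u' (i + 1)) (u' (i + 1 + 1)) =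
      ∑ i ∈ Finset.range m, F (u i) (u (i + 1)) := by
    refine Finset.sum_congr rfl fun i hi => ?_
    rw [Finset.mem_range] at hi
    simp only [hu', Nat.add_eq_zero_iff, one_ne_zero, and_false, if_false,
      show i + 1 ≤ m + 1 by omega, show i + 1 + 1 ≤ m + 1 by omega, if_true, Nat.add_sub_cancel]
  rw [h1]
  linarith [hFn (u' 0) (u' (0 + 1)), hFn (u' (m + 1)) (u' (m + 1 + 1))]

theorem FinitePVar2D.exists_varBound2 (hT : 0 ≤ T) {ρ : ℝ} (hρ : 0 < ρ) {f : Time T → Time T → ℝ}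
    (hf : FinitePVar2D ρ f) : ∃ C, VarBound2 ρ f C := by
  obtain ⟨C, hC⟩ := hf
  refine ⟨C, fun u v hu hv m n => ?_⟩
  obtain ⟨π, hπ⟩ := exists_partition_sum_le hT u hu m
  obtain ⟨σ, hσ⟩ := exists_partition_sum_le hT v hv n
  have hz : ∀ s t t' : Time T, |box f s s t t'| ^ ρ = 0 := fun s t t' => by
    rw [show box f s s t t' = 0 by unfold box; ring, abs_zero, Real.zero_rpow hρ.ne']
  have hz' : ∀ s s' t : Time T, |box f s s' t t| ^ ρ = 0 := fun s s' t => by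
    rw [show box f s s' t t = 0 by unfold box; ring, abs_zero, Real.zero_rpow hρ.ne']
  calc _ ≤ ∑ i ∈ Finset.range π.n, ∑ j ∈ Finset.range n,
        |box f (π.pt i) (π.pt (i + 1)) (v j) (v (j + 1))| ^ ρ :=
        hπ (fun s s' => ∑ j ∈ Finset.range n, |box f s s' (v j) (v (j + 1))| ^ ρ)
          (fun s => Finset.sum_eq_zero fun j _ => hz _ _ _)
          (fun s t => Finset.sum_nonneg fun j _ => by positivity)
    _ ≤ ∑ i ∈ Finset.range π.n, ∑ j ∈ Finset.range σ.n,
        |box f (π.pt i) (π.pt (i + 1)) (σ.pt j) (σ.pt (j + 1))| ^ ρ :=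
        Finset.sum_le_sum fun i _ => hσ (fun t t' => |box f (π.pt i) (π.pt (i + 1)) t t'| ^ ρ)
          (fun t => hz' _ _ _) (fun s t => by positivity)
    _ ≤ C := hC π σ

/-- The reciprocal $1/q$ is the midpoint of $1-1/\rho$ and $\min(1/2,1/p)$. The former is smaller
because $1/\rho>1/2$ and $1/p+1/\rho>1$. -/
theorem exists_young_exponent {p ρ : ℝ} (hp : 1 ≤ p) (hρ : 1 ≤ ρ) (hρ' : ρ < 3 / 2)
    (hpρ : 1 / p + 1 / ρ > 1) : ∃ q : ℝ, 2 < q ∧ p ≤ q ∧ 1 < 1 / q + 1 / ρ := by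
  have hp0 : 0 < p := by linarith
  have hρ0 : 0 < ρ := by linarith
  have h1 : 1 / ρ ≤ 1 := by rw [div_le_one hρ0]; exact hρ
  have h2 : 1 / 2 < 1 / ρ := by rw [one_div_lt_one_div two_pos hρ0]; linarith
  have h3 : 0 < min (1 / 2) (1 / p) := lt_min (by norm_num) (by positivity)
  have h4 : 1 - 1 / ρ < min (1 / 2) (1 / p) := lt_min (by linarith) (by linarith)
  have h5 : 0 < (min (1 / 2) (1 / p) + (1 - 1 / ρ)) / 2 := by linarith
  refine ⟨1 / ((min (1 / 2) (1 / p) + (1 - 1 / ρ)) / 2), ?_, ?_, ?_⟩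
  · rw [lt_one_div two_pos h5]
    linarith [min_le_left (1 / 2) (1 / p)]
  · rw [le_one_div hp0 h5]
    linarith [min_le_right (1 / 2) (1 / p)]
  · rw [one_div_one_div]; linarith

end Piecewise

/-! ### Step functions as integrands -/

section StepFun

variable {T : ℝ} {G H K : Type*} [NormedAddCommGroup G] [InnerProductSpace ℝ G]
  [NormedAddCommGroup H] [InnerProductSpace ℝ H] [NormedAddCommGroup K] [InnerProductSpace ℝ K]

/-- The sum telescopes up to the first partition point at or after `c`. -/
theorem stepInt_Iio_one (x : Time T → H) (c : Time T) (σ : TimePartition T) :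
    stepInt ((Set.Iio c).indicator fun _ => 1) x σ = x (σ.ceilPt c) - x (σ.pt 0) := by
  have key : ∀ k, ∑ i ∈ Finset.range k, (Set.Iio c).indicator (fun _ => (1 : ℝ)) (σ.pt i) •
      (x (σ.pt (i + 1)) - x (σ.pt i)) = x (σ.pt (min k (σ.ceilIdx c))) - x (σ.pt 0) ∨ σ.n < k := by
    intro k
    induction k with
    | zero => left; simp
    | succ k ih =>
      by_cases hk : σ.n < k + 1
      · exact Or.inr hk
      left
      have ih' := ih.resolve_right (by omega)
      rw [Finset.sum_range_succ, ih']
      by_cases h : σ.pt k < c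
      · have : k + 1 ≤ σ.ceilIdx c := by
          by_contra hcon
          exact absurd (h.trans_le (σ.le_pt_ceilIdx c))
            (not_lt.2 (σ.pt_mono (by omega) (by omega)))
        rw [Set.indicator_of_mem (Set.mem_Iio.2 h), min_eq_left this,
          min_eq_left (by omega), one_smul]
        abel
      · have : σ.ceilIdx c ≤ k := σ.ceilIdx_le (not_lt.1 h)
        rw [Set.indicator_of_notMem (fun h' => h (Set.mem_Iio.1 h')), min_eq_right this,
          min_eq_right (by omega), zero_smul, add_zero]
  have h := (key σ.n).resolve_right (lt_irrefl _)
  rw [min_eq_right (σ.ceilIdx_le_n c)] at h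
  exact h

omit [InnerProductSpace ℝ H] in
theorem tendsto_ceilPt {x : Time T → H} (hx : UniformContinuous x) (c : Time T) :
    Tendsto (fun σ : TimePartition T => x (σ.ceilPt c)) (meshZero T) (𝓝 (x c)) := by
  rw [Metric.tendsto_nhds]
  intro ε hε
  obtain ⟨δ, hδ, h⟩ := Metric.uniformContinuous_iff.1 hx ε hε
  refine eventually_meshZero_of_mesh_lt hδ fun σ hσ => ?_
  rw [dist_comm]
  exact h ((σ.dist_ceilPt_le c).trans_lt hσ)

theorem tendsto_stepInt_Ico {x : Time T → H} (hx : UniformContinuous x) {a c : Time T}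
    (hac : a ≤ c) :
    Tendsto (stepInt ((Set.Ico a c).indicator fun _ => 1) x) (meshZero T) (𝓝 (x c - x a)) := by
  have e : ∀ σ : TimePartition T, stepInt ((Set.Ico a c).indicator fun _ => 1) x σ =
      x (σ.ceilPt c) - x (σ.ceilPt a) := fun σ => by
    have hd : Set.Ico a c = Set.Ici a \ Set.Ici c := by ext; simp
    rw [hd, ← stepInt_Iio_sub _ _ _ hac, stepInt_Iio_one, stepInt_Iio_one]
    abel
  simp only [funext e]
  exact (tendsto_ceilPt hx c).sub (tendsto_ceilPt hx a)

theorem stepSum_stepFun (m : G →ₗ[ℝ] H →ₗ[ℝ] K) (Φ : Time T → G) (x : Time T → H)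
    (π σ : TimePartition T) : stepSum m (stepFun π Φ) x σ = ∑ i ∈ Finset.range π.n, m (Φ (π.pt i))
      (stepInt ((Set.Ico (π.pt i) (π.pt (i + 1))).indicator fun _ => 1) x σ) := by
  unfold stepInt stepSum stepFun
  simp only [map_sum, LinearMap.sum_apply]
  rw [Finset.sum_comm]
  refine Finset.sum_congr rfl fun i _ => Finset.sum_congr rfl fun j _ => ?_
  by_cases h : σ.pt j ∈ Set.Ico (π.pt i) (π.pt (i + 1))
  · rw [Set.indicator_of_mem h, Set.indicator_of_mem h, LinearMap.lsmul_apply, one_smul]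
  · rw [Set.indicator_of_notMem h, Set.indicator_of_notMem h]
    simp

/-- With $\pi$ fixed and $\sigma$ refined, each indicator integrates to an increment of $x$ between
points of $\sigma$ just above $r_i$ and $r_{i+1}$. Continuity of $x$ then replaces them by $r_i$ and
$r_{i+1}$. -/
theorem tendsto_stepSum_stepFun (m : G →ₗ[ℝ] H →ₗ[ℝ] K) (hm : ∀ g, Continuous (m g))
    (Φ : Time T → G) {x : Time T → H} (hx : UniformContinuous x) (π : TimePartition T) :
    Tendsto (stepSum m (stepFun π Φ) x) (meshZero T) (𝓝 (stepSum m Φ x π)) := by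
  simp only [funext (stepSum_stepFun m Φ x π)]
  refine tendsto_finsetSum _ fun i hi => ?_
  exact ((hm _).tendsto _).comp (tendsto_stepInt_Ico hx (π.pt_lt i (Finset.mem_range.1 hi)).le)

end StepFun

end YoungMalliavin

namespace YoungMalliavin

variable {Ω : Type*} [mΩ : MeasurableSpace Ω] {P : Measure Ω} {d : ℕ} [NeZero d] {T : ℝ}
  {X : Time T → Ω → EuclideanSpace ℝ (Fin d)} (hX : IsGaussianDriver P X)

/-! ### The generators of `H_1^d` as Young paths -/

theorem inner_ind (t s : Time T) (u v : Fin d) :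
    ⟪ind hX t u, ind hX s v⟫ = if u = v then covFun P X t s else 0 := by
  have h : ⟪ind hX t u, ind hX s v⟫ = PreH1.form hX (PreH1.gen hX t u) (PreH1.gen hX s v) :=
    UniformSpace.Completion.inner_coe _ _
  rw [h]
  unfold PreH1.form PreH1.gen
  rw [Finsupp.sum_single_index, Finsupp.sum_single_index] <;> simp

theorem covFun_comm (s t : Time T) : covFun P X s t = covFun P X t s := by
  unfold covFun
  simp only [mul_comm]

theorem inner_ind_sub (s s' t t' : Time T) (u v : Fin d) :
    ⟪ind hX s' u - ind hX s u, ind hX t' v - ind hX t v⟫ =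
      if u = v then rectInc (covFun P X) s s' t t' else 0 := by
  simp only [inner_sub_left, inner_sub_right, inner_ind, rectInc]
  split_ifs <;> ring

/-- The squared norm of an increment is a rectangular increment of $R$. -/
theorem continuous_ind (hR : Continuous (Function.uncurry (covFun P X))) (u : Fin d) :
    Continuous fun t => ind hX t u := by
  refine continuous_iff_continuousAt.2 fun t => ?_
  rw [ContinuousAt, tendsto_iff_norm_sub_tendsto_zero]
  have h1 : ∀ s, ‖ind hX s u - ind hX t u‖ = √(rectInc (covFun P X) t s t s) := fun s => by
    rw [← Real.sqrt_sq (norm_nonneg _), ← real_inner_self_eq_norm_sq, inner_ind_sub, if_pos rfl]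
  simp only [h1]
  have h2 : Continuous fun s => √(rectInc (covFun P X) t s t s) := by
    unfold rectInc
    have hc : ∀ {f g : Time T → Time T}, Continuous f → Continuous g →
        Continuous fun s => covFun P X (f s) (g s) := fun hf hg => hR.comp (hf.prodMk hg)
    exact Real.continuous_sqrt.comp ((((hc continuous_const continuous_const).add
      (hc continuous_id continuous_id)).sub (hc continuous_const continuous_id)).sub
      (hc continuous_id continuous_const))
  have h3 := h2.tendsto t
  simpa [rectInc] using h3

theorem isYoungPath_ind (hT : 0 < T) {q ρ : ℝ} (hq : 2 < q) (hρ : 0 < ρ)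
    (hqρ : 1 < 1 / q + 1 / ρ) (hR : Continuous (Function.uncurry (covFun P X)))
    (hRvar : FinitePVar2D ρ (covFun P X)) (u : Fin d) : IsYoungPath q fun t => ind hX t u := by
  obtain ⟨C, hC⟩ := hRvar.exists_varBound2 hT.le hρ
  refine ⟨hq, CompactSpace.uniformContinuous_of_continuous (continuous_ind hX hR u),
    ρ, C, hρ, hqρ, ?_⟩
  refine (congrArg (fun A => VarBound2 ρ A C) ?_).mp hC
  funext s t
  rw [covKer, inner_ind, if_pos rfl]

/-! ### Riemann sums as inner products -/

theorem stepH_eq_sum (π : TimePartition T) (f : Time T → EuclideanSpace ℝ (Fin d)) :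
    stepH hX π f = ∑ u, stepInt (fun t => f t u) (fun t => ind hX t u) π := by
  unfold stepH stepInt stepSum
  rw [Finset.sum_comm]
  rfl

/-- Independence of the components kills the mixed coordinates, so the double sum over coordinates
collapses to the Euclidean inner product. -/
theorem inner_stepH (π π' : TimePartition T) (f g : Time T → EuclideanSpace ℝ (Fin d)) :
    ⟪stepH hX π f, stepH hX π' g⟫ =
      riemannSum2 (fun s t => ⟪f s, g t⟫) (covFun P X) (π, π') := by
  unfold stepH riemannSum2
  rw [sum_inner]
  refine Finset.sum_congr rfl fun i _ => ?_
  rw [inner_sum]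
  refine Finset.sum_congr rfl fun j _ => ?_
  simp only [sum_inner, inner_sum, real_inner_smul_left, real_inner_smul_right, inner_ind_sub,
    mul_ite, mul_zero, Finset.sum_ite_eq', Finset.mem_univ, if_true,
    PiLp.inner_apply,
    RCLike.inner_apply, conj_trivial, Finset.sum_mul]
  refine Finset.sum_congr rfl fun u _ => ?_
  ring

theorem inner_stepH_ind_sub (π : TimePartition T) (f : Time T → EuclideanSpace ℝ (Fin d))
    (s s' : Time T) (v : Fin d) :
    ⟪stepH hX π f, ind hX s' v - ind hX s v⟫ = ∑ k ∈ Finset.range π.n,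
      f (π.pt k) v * rectInc (covFun P X) s s' (π.pt k) (π.pt (k + 1)) := by
  have hr : ∀ a a' b b' : Time T, rectInc (covFun P X) a a' b b' =
      rectInc (covFun P X) b b' a a' := fun a a' b b' => by
    simp only [rectInc, covFun_comm b, covFun_comm b']; ring
  unfold stepH
  rw [sum_inner]
  refine Finset.sum_congr rfl fun k _ => ?_
  simp only [sum_inner, real_inner_smul_left, inner_ind_sub, mul_ite, mul_zero,
    Finset.sum_ite_eq', Finset.mem_univ, if_true]
  rw [hr]

theorem Represents.toH1_eq {hX : IsGaussianDriver P X} (hT : 0 < T)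
    {f : Time T → EuclideanSpace ℝ (Fin d)} {h : H1 hX} (hf : Represents hX f h) :
    toH1 hX f = h :=
  have := meshZero_neBot hT
  hf.limUnder_eq

theorem Represents.zero : Represents hX (fun _ => 0) (0 : H1 hX) := by
  have : ∀ π, stepH hX π (fun _ => (0 : EuclideanSpace ℝ (Fin d))) = 0 := fun π => by simp [stepH]
  simp only [Represents, this]
  exact tendsto_const_nhds

theorem stepH_add (π : TimePartition T) (f g : Time T → EuclideanSpace ℝ (Fin d)) :
    stepH hX π (fun t => f t + g t) = stepH hX π f + stepH hX π g := by
  simp only [stepH, ← Finset.sum_add_distrib, ← add_smul, PiLp.add_apply]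

theorem stepH_sub (π : TimePartition T) (f g : Time T → EuclideanSpace ℝ (Fin d)) :
    stepH hX π (fun t => f t - g t) = stepH hX π f - stepH hX π g := by
  simp only [stepH, ← Finset.sum_sub_distrib, ← sub_smul, PiLp.sub_apply]

variable {hX}

theorem Represents.add {f g : Time T → EuclideanSpace ℝ (Fin d)} {h k : H1 hX}
    (hf : Represents hX f h) (hg : Represents hX g k) :
    Represents hX (fun t => f t + g t) (h + k) := by
  unfold Represents
  simp only [stepH_add]
  exact Tendsto.add hf hg

theorem Represents.sub {f g : Time T → EuclideanSpace ℝ (Fin d)} {h k : H1 hX}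
    (hf : Represents hX f h) (hg : Represents hX g k) :
    Represents hX (fun t => f t - g t) (h - k) := by
  unfold Represents
  simp only [stepH_sub]
  exact Tendsto.sub hf hg

theorem Represents.sum {ι : Type*} (s : Finset ι) {f : ι → Time T → EuclideanSpace ℝ (Fin d)}
    {h : ι → H1 hX} (hf : ∀ i ∈ s, Represents hX (f i) (h i)) :
    Represents hX (fun t => ∑ i ∈ s, f i t) (∑ i ∈ s, h i) := by
  classical
  induction s using Finset.induction_on with
  | empty => simpa using Represents.zero hX
  | insert a s ha ih =>
    simp only [Finset.sum_insert ha]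
    exact (hf a (Finset.mem_insert_self _ _)).add
      (ih fun i hi => hf i (Finset.mem_insert_of_mem hi))

/-- By continuity of the inner product, the 2D integral exists along independent meshes as soon as
both paths are identified with elements of $\mathcal H_1^d$. -/
theorem Represents.tendsto_riemannSum2 {f g : Time T → EuclideanSpace ℝ (Fin d)} {h k : H1 hX}
    (hf : Represents hX f h) (hg : Represents hX g k) :
    Tendsto (riemannSum2 (fun s t => ⟪f s, g t⟫) (covFun P X)) (meshZero T ×ˢ meshZero T)
      (𝓝 ⟪h, k⟫) := by
  have h1 := (hf.comp tendsto_fst).inner (𝕜 := ℝ) (hg.comp tendsto_snd)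
  refine h1.congr fun π => ?_
  exact inner_stepH hX π.1 π.2 f g

theorem represents_of_boundedVar (hT : 0 < T) {q : ℝ}
    (hpath : ∀ u, IsYoungPath q fun t => ind hX t u) {f : Time T → EuclideanSpace ℝ (Fin d)}
    (hf : ∀ u, BoundedVar q fun t => f t u) : Represents hX f (toH1 hX f) := by
  have : ∀ u, ∃ h : H1 hX, Tendsto (stepInt (fun t => f t u) fun t => ind hX t u) (meshZero T)
      (𝓝 h) := fun u => exists_limit_stepInt hT (hpath u) (hf u)
  choose h hh using this
  have hrep : Represents hX f (∑ u, h u) := by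
    unfold Represents
    simp only [stepH_eq_sum]
    exact tendsto_finsetSum _ fun u _ => hh u
  rwa [hrep.toH1_eq hT]

omit [NeZero d] in
theorem stepFun_apply_coord (π : TimePartition T) (f : Time T → EuclideanSpace ℝ (Fin d))
    (t : Time T) (u : Fin d) : stepFun π f t u = stepFun π (fun s => f s u) t := by
  unfold stepFun
  rw [WithLp.ofLp_sum, Finset.sum_apply]
  refine Finset.sum_congr rfl fun i _ => ?_
  by_cases h : t ∈ Set.Ico (π.pt i) (π.pt (i + 1)) <;> simp [h]

theorem represents_stepFun {q : ℝ} (hpath : ∀ u, IsYoungPath q fun t => ind hX t u)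
    (π : TimePartition T) (f : Time T → EuclideanSpace ℝ (Fin d)) :
    Represents hX (stepFun π f) (stepH hX π f) := by
  unfold Represents
  simp only [stepH_eq_sum, stepFun_apply_coord]
  exact tendsto_finsetSum _ fun u _ => tendsto_stepSum_stepFun _
    (fun g => continuous_const_smul g) _ (hpath u).uniformContinuous π

end YoungMalliavin

namespace YoungMalliavin

variable {Ω : Type*} [mΩ : MeasurableSpace Ω] {P : Measure Ω} {d : ℕ} [NeZero d] {T : ℝ}
  {X : Time T → Ω → EuclideanSpace ℝ (Fin d)} (hX : IsGaussianDriver P X)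

/-! ### The completed tensor product -/

/-- The elementary tensors, as a bilinear map into the completed tensor product. -/
def tmulH : H1 hX →ₗ[ℝ] H1 hX →ₗ[ℝ] H1Tensor hX :=
  (TensorProduct.mk ℝ (H1 hX) (H1 hX)).compr₂
    (UniformSpace.Completion.toComplL (𝕜 := ℝ) (E := H1 hX ⊗[ℝ] H1 hX)).toLinearMap

theorem tmulH_apply (g h : H1 hX) :
    tmulH hX g h = ((g ⊗ₜ[ℝ] h : H1 hX ⊗[ℝ] H1 hX) : H1Tensor hX) := rfl

theorem inner_tmulH (g h g' h' : H1 hX) :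
    ⟪tmulH hX g h, tmulH hX g' h'⟫ = ⟪g, g'⟫ * ⟪h, h'⟫ := by
  rw [tmulH_apply, tmulH_apply, UniformSpace.Completion.inner_coe, TensorProduct.inner_tmul]

theorem norm_tmulH (g h : H1 hX) : ‖tmulH hX g h‖ = ‖g‖ * ‖h‖ := by
  rw [tmulH_apply, UniformSpace.Completion.norm_coe, TensorProduct.norm_tmul]

theorem continuous_tmulH (g : H1 hX) : Continuous (tmulH hX g) :=
  AddMonoidHomClass.continuous_of_bound (tmulH hX g) ‖g‖ fun h => (norm_tmulH hX g h).le

theorem continuous_tmulH_left (h : H1 hX) : Continuous fun g => tmulH hX g h :=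
  AddMonoidHomClass.continuous_of_bound ((tmulH hX).flip h) ‖h‖ fun g => by
    rw [LinearMap.flip_apply, norm_tmulH, mul_comm]

/-- The exchange of the factors of the completed tensor product. -/
def swapH : H1Tensor hX →L[ℝ] H1Tensor hX :=
  ContinuousLinearMap.extend
    ((UniformSpace.Completion.toComplL (𝕜 := ℝ) (E := H1 hX ⊗[ℝ] H1 hX)).comp
      (TensorProduct.commIsometry ℝ (H1 hX) (H1 hX)).toLinearIsometry.toContinuousLinearMap)
    (UniformSpace.Completion.toComplL (𝕜 := ℝ) (E := H1 hX ⊗[ℝ] H1 hX))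

theorem swapH_coe (z : H1 hX ⊗[ℝ] H1 hX) :
    swapH hX (z : H1Tensor hX) = ((TensorProduct.comm ℝ (H1 hX) (H1 hX) z : H1 hX ⊗[ℝ] H1 hX) :
      H1Tensor hX) :=
  ContinuousLinearMap.extend_eq _ UniformSpace.Completion.denseRange_coe
    (UniformSpace.Completion.isUniformInducing_coe _) z

theorem swapH_tmulH (g h : H1 hX) : swapH hX (tmulH hX g h) = tmulH hX h g := by
  rw [tmulH_apply, swapH_coe, TensorProduct.comm_tmul, tmulH_apply]

theorem norm_swapH (z : H1Tensor hX) : ‖swapH hX z‖ = ‖z‖ := by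
  refine UniformSpace.Completion.induction_on z
    (isClosed_eq (swapH hX).continuous.norm continuous_norm) fun w => ?_
  rw [swapH_coe, UniformSpace.Completion.norm_coe, UniformSpace.Completion.norm_coe,
    TensorProduct.norm_comm]

/-! ### The Malliavin derivative of the integrand as a tensor -/

section Rows

variable (g₁ g₂ : Time T → Matrix (Fin d) (Fin d) ℝ)

/-- The element of `H_1^d` identified with the `i`-th row of `s ↦ 1_{[0,t)}(s) g₁(t) g₂(s)`. -/
def rowElt (i : Fin d) (t : Time T) : H1 hX := toH1 hX fun s => rowVec (volterra g₁ g₂ s t) i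

/-- The Riemann sum `∑_a ∑_i Z^i(r_a) ⊗ 1_{[r_a, r_{a+1})} e_i` of `H_1^d`-valued paths `Z^i`. -/
def tensorSum (Z : Fin d → Time T → H1 hX) (π : TimePartition T) : H1Tensor hX :=
  ∑ i, stepSum (tmulH hX) (Z i) (fun t => ind hX t i) π

variable {hX g₁ g₂}

/-- The matrix product splits a row into $d^2$ scalar Volterra kernels $\mathbf
1_{[0,t)}(s)a(t)b(s)$, to which the scalar theory applies. -/
theorem stepH_row (i : Fin d) (t : Time T) (π : TimePartition T) :
    stepH hX π (fun s => rowVec (volterra g₁ g₂ s t) i) = ∑ z : Fin d × Fin d,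
      g₁ t i z.2 • stepInt ((Set.Iio t).indicator fun s => g₂ s z.2 z.1)
        (fun t => ind hX t z.1) π := by
  rw [stepH_eq_sum, Fintype.sum_prod_type]
  refine Finset.sum_congr rfl fun j _ => ?_
  unfold stepInt stepSum
  simp only [Finset.smul_sum]
  rw [Finset.sum_comm]
  refine Finset.sum_congr rfl fun a _ => ?_
  simp only [LinearMap.lsmul_apply, smul_smul, ← Finset.sum_smul]
  congr 1
  by_cases h : π.pt a < t
  · simp [rowVec, volterra, h, Matrix.mul_apply]
  · simp [rowVec, volterra, h]

theorem stepSum_sum_left {ι : Type*} {H K : Type*} [NormedAddCommGroup H] [InnerProductSpace ℝ H]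
    [NormedAddCommGroup K] [InnerProductSpace ℝ K] (m : H →ₗ[ℝ] H →ₗ[ℝ] K) (s : Finset ι)
    (Φ : ι → Time T → H) (x : Time T → H) (π : TimePartition T) :
    stepSum m (fun t => ∑ i ∈ s, Φ i t) x π = ∑ i ∈ s, stepSum m (Φ i) x π := by
  unfold stepSum
  rw [Finset.sum_comm]
  refine Finset.sum_congr rfl fun a _ => ?_
  rw [map_sum, LinearMap.sum_apply]

/-- Two routes to the same tensor. In the first the inner integrals are already performed, which is
the form of $\mathcal D Y^\pi$. In the second both meshes tend to $0$ jointly, which is the form of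
the 4D Riemann sums. -/
theorem exists_limit_tensorSum (hT : 0 < T) {q : ℝ}
    (hpath : ∀ u, IsYoungPath q fun t => ind hX t u)
    (h₁ : ∀ i j, BoundedVar q fun t => g₁ t i j) (h₂ : ∀ i j, BoundedVar q fun t => g₂ t i j) :
    (∀ i t, Represents hX (fun s => rowVec (volterra g₁ g₂ s t) i) (rowElt hX g₁ g₂ i t)) ∧
    ∃ Λ : H1Tensor hX, Tendsto (tensorSum hX (rowElt hX g₁ g₂)) (meshZero T) (𝓝 Λ) ∧
      Tendsto (fun π : TimePartition T × TimePartition T => tensorSum hX (fun i t =>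
        stepH hX π.1 (fun s => rowVec (volterra g₁ g₂ s t) i)) π.2)
        (meshZero T ×ˢ meshZero T) (𝓝 Λ) := by
  have h := fun (i : Fin d) (z : Fin d × Fin d) => exists_volterra_integral hT (hpath z.1)
    (hpath i) (tmulH hX) (inner_tmulH hX) (h₁ i z.2) (h₂ z.2 z.1)
  choose k Λ hk hΛ hΛ' using h
  have hrep : ∀ i t, Represents hX (fun s => rowVec (volterra g₁ g₂ s t) i)
      (∑ z : Fin d × Fin d, g₁ t i z.2 • k i z t) := fun i t => by
    unfold Represents
    simp only [stepH_row]
    exact tendsto_finsetSum _ fun z _ => (hk i z t).const_smul _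
  have hrow : ∀ i, rowElt hX g₁ g₂ i = fun t => ∑ z : Fin d × Fin d, g₁ t i z.2 • k i z t :=
    fun i => funext fun t => (hrep i t).toH1_eq hT
  refine ⟨fun i t => by rw [hrow]; exact hrep i t, ∑ i, ∑ z, Λ i z, ?_, ?_⟩
  · unfold tensorSum
    simp only [hrow, stepSum_sum_left]
    exact tendsto_finsetSum _ fun i _ => tendsto_finsetSum _ fun z _ => hΛ i z
  · unfold tensorSum
    simp only [stepH_row, stepSum_sum_left]
    exact tendsto_finsetSum _ fun i _ => tendsto_finsetSum _ fun z _ => hΛ' i z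

theorem inner_tensorSum (E E' : Fin d → Time T → H1 hX) (π π' : TimePartition T) :
    ⟪tensorSum hX E π, tensorSum hX E' π'⟫ =
      riemannSum2 (fun s t => ∑ i, ⟪E i s, E' i t⟫) (covFun P X) (π, π') := by
  unfold tensorSum stepSum riemannSum2
  rw [Finset.sum_comm, sum_inner]
  refine Finset.sum_congr rfl fun i _ => ?_
  rw [Finset.sum_comm, inner_sum]
  refine Finset.sum_congr rfl fun j _ => ?_
  simp only [sum_inner, inner_sum, inner_tmulH, inner_ind_sub,
    mul_ite, mul_zero, Finset.sum_ite_eq', Finset.mem_univ, if_true, Finset.sum_mul]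

theorem tensorSum_sub (E E' : Fin d → Time T → H1 hX) (π : TimePartition T) :
    tensorSum hX (fun i t => E i t - E' i t) π = tensorSum hX E π - tensorSum hX E' π := by
  unfold tensorSum
  simp only [stepSum_sub_left, Finset.sum_sub_distrib]

theorem tendsto_tensorSum_stepFun {q : ℝ} (hpath : ∀ u, IsYoungPath q fun t => ind hX t u)
    (Z : Fin d → Time T → H1 hX) (π : TimePartition T) :
    Tendsto (tensorSum hX fun i => stepFun π (Z i)) (meshZero T) (𝓝 (tensorSum hX Z π)) :=
  tendsto_finsetSum _ fun i _ => tendsto_stepSum_stepFun _ (continuous_tmulH hX) _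
    (hpath i).uniformContinuous π

/-! ### The pathwise integrals -/

theorem represents_rowVec_kernelErr (π : TimePartition T)
    (hrep : ∀ i t, Represents hX (fun s => rowVec (volterra g₁ g₂ s t) i) (rowElt hX g₁ g₂ i t))
    (i : Fin d) (t : Time T) :
    Represents hX (fun r => rowVec (kernelErr π (volterra g₁ g₂) r t) i)
      (stepFun π (rowElt hX g₁ g₂ i) t - rowElt hX g₁ g₂ i t) := by
  have e : (fun r => rowVec (kernelErr π (volterra g₁ g₂) r t) i) = fun r =>
      (∑ a ∈ Finset.range π.n, (Set.Ico (π.pt a) (π.pt (a + 1))).indicator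
        (fun _ => rowVec (volterra g₁ g₂ r (π.pt a)) i) t) - rowVec (volterra g₁ g₂ r t) i := by
    funext r
    ext j
    simp only [kernelErr, stepFun, rowVec, PiLp.sub_apply, WithLp.ofLp_sum, Finset.sum_apply,
      Matrix.sub_apply, Matrix.sum_apply]
    congr 1
    refine Finset.sum_congr rfl fun a _ => ?_
    by_cases h : t ∈ Set.Ico (π.pt a) (π.pt (a + 1)) <;> simp [h]
  rw [e]
  refine Represents.sub (Represents.sum _ fun a _ => ?_) (hrep i t)
  by_cases h : t ∈ Set.Ico (π.pt a) (π.pt (a + 1))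
  · simp only [Set.indicator_of_mem h]; exact hrep i _
  · simp only [Set.indicator_of_notMem h]; exact Represents.zero hX

omit [NeZero d] in
theorem frob_eq_sum_inner (A B : Matrix (Fin d) (Fin d) ℝ) :
    frob A B = ∑ i, ⟪rowVec A i, rowVec B i⟫ := by
  unfold frob
  refine Finset.sum_congr rfl fun i _ => ?_
  simp only [PiLp.inner_apply, rowVec, RCLike.inner_apply, conj_trivial, mul_comm]

theorem riemannSum2_sum {ι : Type*} (s : Finset ι) (f : ι → Time T → Time T → ℝ)
    (R : Time T → Time T → ℝ) (π : TimePartition T × TimePartition T) :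
    riemannSum2 (fun u v => ∑ i ∈ s, f i u v) R π = ∑ i ∈ s, riemannSum2 (f i) R π := by
  unfold riemannSum2
  simp only [Finset.sum_mul]
  rw [Finset.sum_comm (s := s)]
  exact Finset.sum_congr rfl fun a _ => Finset.sum_comm

theorem tendsto_riemannSum2_kernelErr (π : TimePartition T)
    (hrep : ∀ i t, Represents hX (fun s => rowVec (volterra g₁ g₂ s t) i) (rowElt hX g₁ g₂ i t))
    (s t : Time T) :
    Tendsto (riemannSum2 (fun r q => frob (kernelErr π (volterra g₁ g₂) r t)
      (kernelErr π (volterra g₁ g₂) q s)) (covFun P X)) (meshZero T ×ˢ meshZero T)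
      (𝓝 (∑ i, ⟪stepFun π (rowElt hX g₁ g₂ i) t - rowElt hX g₁ g₂ i t,
        stepFun π (rowElt hX g₁ g₂ i) s - rowElt hX g₁ g₂ i s⟫)) := by
  have e : riemannSum2 (fun r q => frob (kernelErr π (volterra g₁ g₂) r t)
      (kernelErr π (volterra g₁ g₂) q s)) (covFun P X) = fun σ => ∑ i, riemannSum2
        (fun r q => ⟪rowVec (kernelErr π (volterra g₁ g₂) r t) i,
          rowVec (kernelErr π (volterra g₁ g₂) q s) i⟫) (covFun P X) σ := by
    funext σ
    simp only [frob_eq_sum_inner]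
    exact riemannSum2_sum _ (fun i r q => ⟪rowVec (kernelErr π (volterra g₁ g₂) r t) i,
      rowVec (kernelErr π (volterra g₁ g₂) q s) i⟫) _ _
  rw [e]
  exact tendsto_finsetSum _ fun i _ => (represents_rowVec_kernelErr π hrep i t).tendsto_riemannSum2
    (represents_rowVec_kernelErr π hrep i s)

theorem young2_eq (hT : 0 < T) {f R : Time T → Time T → ℝ} {I : ℝ}
    (h : Tendsto (riemannSum2 f R) (meshZero T ×ˢ meshZero T) (𝓝 I)) : young2 f R = I :=
  have := meshZero_neBot hT
  h.limUnder_eq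

/-- The inner integrals are exact inner products of row errors $E(t)$ and $E(s)$, so the outer
Riemann sum is the inner product of two tensor sums of $E$. These converge to the step tensor minus
its limit. -/
theorem tendsto_riemannSum2_young2_kernelErr (hT : 0 < T) {q : ℝ}
    (hpath : ∀ u, IsYoungPath q fun t => ind hX t u) (π : TimePartition T)
    (hrep : ∀ i t, Represents hX (fun s => rowVec (volterra g₁ g₂ s t) i) (rowElt hX g₁ g₂ i t))
    {Λ : H1Tensor hX} (hΛ : Tendsto (tensorSum hX (rowElt hX g₁ g₂)) (meshZero T) (𝓝 Λ)) :
    Tendsto (riemannSum2 (fun s t => young2 (fun r q => frob (kernelErr π (volterra g₁ g₂) r t)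
      (kernelErr π (volterra g₁ g₂) q s)) (covFun P X)) (covFun P X)) (meshZero T ×ˢ meshZero T)
      (𝓝 (‖tensorSum hX (rowElt hX g₁ g₂) π - Λ‖ ^ 2)) := by
  set E : Fin d → Time T → H1 hX := fun i t => stepFun π (rowElt hX g₁ g₂ i) t -
    rowElt hX g₁ g₂ i t with hE
  have hlim : Tendsto (tensorSum hX E) (meshZero T)
      (𝓝 (tensorSum hX (rowElt hX g₁ g₂) π - Λ)) := by
    rw [hE, funext (tensorSum_sub _ _)]
    exact (tendsto_tensorSum_stepFun hpath _ π).sub hΛ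
  have h1 := (hlim.comp tendsto_fst).inner (𝕜 := ℝ)
    (hlim.comp (tendsto_snd (f := meshZero T) (g := meshZero T)))
  rw [real_inner_self_eq_norm_sq] at h1
  refine h1.congr fun σ => ?_
  rw [Function.comp_apply, Function.comp_apply, inner_tensorSum]
  congr 1
  funext s t
  rw [young2_eq hT (tendsto_riemannSum2_kernelErr π hrep s t)]
  exact Finset.sum_congr rfl fun i _ => real_inner_comm _ _

omit [NeZero d] in
theorem sum_trace_mul {ι κ : Type*} (s : Finset ι) (t : Finset κ) (V : ι → Fin d → Fin d → ℝ)
    (W : κ → Fin d → Fin d → ℝ) (a : ι → ℝ) (b : κ → ℝ) :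
    ∑ k ∈ s, ∑ l ∈ t, (∑ i, ∑ j, V k i j * W l j i) * a k * b l =
      ∑ i, ∑ j, (∑ k ∈ s, V k i j * a k) * ∑ l ∈ t, W l j i * b l := by
  simp only [Finset.sum_mul (s := Finset.univ)]
  simp_rw [Finset.sum_comm (s := t) (t := Finset.univ)]
  rw [Finset.sum_comm]
  refine Finset.sum_congr rfl fun i _ => ?_
  rw [Finset.sum_comm]
  refine Finset.sum_congr rfl fun j _ => ?_
  rw [Finset.sum_mul_sum]
  exact Finset.sum_congr rfl fun k _ => Finset.sum_congr rfl fun l _ => by ring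

/-- The kernel $\mathcal D_rY_t$ gives a tensor in the slots $(r,t)$, and $\mathcal D_qY_s$ one in
the slots $(q,s)$. The measures $dR(s,r)\,dR(t,q)$ couple the first slot of each with the second
slot of the other, and the trace couples the matrix indices in the same crossed way; hence the
exchange of factors. -/
theorem riemannSum4_eq_inner (π : (TimePartition T × TimePartition T) ×
    (TimePartition T × TimePartition T)) :
    riemannSum4 (fun s r t q => (volterra g₁ g₂ r t * volterra g₁ g₂ q s).trace) (covFun P X) π =
    ⟪tensorSum hX (fun i t => stepH hX π.1.2 (fun s => rowVec (volterra g₁ g₂ s t) i)) π.2.1,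
      swapH hX (tensorSum hX (fun i t => stepH hX π.2.2
        (fun s => rowVec (volterra g₁ g₂ s t) i)) π.1.1)⟫ := by
  obtain ⟨⟨σ₁, σ₂⟩, σ₃, σ₄⟩ := π
  unfold riemannSum4 tensorSum stepSum
  simp only [map_sum, swapH_tmulH]
  rw [Finset.sum_comm (s := Finset.univ), Finset.sum_comm (s := Finset.univ), inner_sum]
  refine Finset.sum_congr rfl fun a _ => ?_
  rw [Finset.sum_comm, sum_inner]
  refine Finset.sum_congr rfl fun j _ => ?_
  simp only [sum_inner, inner_sum, inner_tmulH, inner_stepH_ind_sub]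
  have hc : ∀ (i : Fin d) (f : Time T → EuclideanSpace ℝ (Fin d)),
      ⟪ind hX (σ₃.pt (j + 1)) i - ind hX (σ₃.pt j) i, stepH hX σ₄ f⟫ =
      ∑ l ∈ Finset.range σ₄.n, f (σ₄.pt l) i *
        rectInc (covFun P X) (σ₃.pt j) (σ₃.pt (j + 1)) (σ₄.pt l) (σ₄.pt (l + 1)) :=
    fun i f => by rw [real_inner_comm, inner_stepH_ind_sub]
  simp only [hc, Matrix.trace, Matrix.diag, Matrix.mul_apply, rowVec]
  exact (sum_trace_mul _ _ (fun k i u => volterra g₁ g₂ (σ₂.pt k) (σ₃.pt j) i u)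
    (fun l u i => volterra g₁ g₂ (σ₄.pt l) (σ₁.pt a) u i) _ _).trans Finset.sum_comm

theorem tendsto_riemannSum4 {Λ : H1Tensor hX}
    (hΛ : Tendsto (fun π : TimePartition T × TimePartition T => tensorSum hX (fun i t =>
        stepH hX π.1 (fun s => rowVec (volterra g₁ g₂ s t) i)) π.2)
        (meshZero T ×ˢ meshZero T) (𝓝 Λ)) :
    Tendsto (riemannSum4 (fun s r t q => (volterra g₁ g₂ r t * volterra g₁ g₂ q s).trace)
      (covFun P X)) ((meshZero T ×ˢ meshZero T) ×ˢ (meshZero T ×ˢ meshZero T))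
      (𝓝 ⟪Λ, swapH hX Λ⟫) := by
  have h12 : Tendsto (fun π : (TimePartition T × TimePartition T) ×
      (TimePartition T × TimePartition T) => (π.1.2, π.2.1))
      ((meshZero T ×ˢ meshZero T) ×ˢ (meshZero T ×ˢ meshZero T)) (meshZero T ×ˢ meshZero T) :=
    (tendsto_snd.comp tendsto_fst).prodMk (tendsto_fst.comp tendsto_snd)
  have h21 : Tendsto (fun π : (TimePartition T × TimePartition T) ×
      (TimePartition T × TimePartition T) => (π.2.2, π.1.1))
      ((meshZero T ×ˢ meshZero T) ×ˢ (meshZero T ×ˢ meshZero T)) (meshZero T ×ˢ meshZero T) :=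
    (tendsto_snd.comp tendsto_snd).prodMk (tendsto_fst.comp tendsto_fst)
  refine ((hΛ.comp h12).inner (𝕜 := ℝ)
    (((swapH hX).continuous.tendsto Λ).comp (hΛ.comp h21))).congr fun π => ?_
  exact (riemannSum4_eq_inner π).symm

end Rows

variable {hX} in
theorem tendsto_riemannSum2_pathErr {q : ℝ} (hpath : ∀ u, IsYoungPath q fun t => ind hX t u)
    (π : TimePartition T) {y : Time T → EuclideanSpace ℝ (Fin d)} {h : H1 hX}
    (hy : Represents hX y h) :
    Tendsto (riemannSum2 (pathErr π y) (covFun P X)) (meshZero T ×ˢ meshZero T)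
      (𝓝 (‖stepH hX π y - h‖ ^ 2)) := by
  have h1 := (represents_stepFun hpath π y).sub hy
  rw [← real_inner_self_eq_norm_sq]
  exact h1.tendsto_riemannSum2 h1

end YoungMalliavin

namespace YoungMalliavin

/-! ### Stein's identity -/

theorem memLp_comp_of_growth {Ω' E F : Type*} [MeasurableSpace Ω'] {μ : Measure Ω'}
    [NormedAddCommGroup E] [NormedAddCommGroup F]
    [MeasurableSpace E] [OpensMeasurableSpace E] [SecondCountableTopology E]
    {Z : Ω' → E} (hZm : AEMeasurable Z μ)
    (hZ : ∀ q : ℝ≥0∞, q ≠ ⊤ → MemLp Z q μ) [IsProbabilityMeasure μ] {f : E → F}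
    (hf : Continuous f) {C : ℝ} {N : ℕ} (hC : ∀ x, ‖f x‖ ≤ C * (1 + ‖x‖) ^ N) {q : ℝ≥0∞}
    (hq : q ≠ ⊤) : MemLp (fun ω => f (Z ω)) q μ := by
  have h1 : MemLp (fun ω => 1 + ‖Z ω‖) (N * q) μ :=
    (memLp_const (1 : ℝ)).add (hZ (N * q) (ENNReal.mul_ne_top (ENNReal.natCast_ne_top N) hq)).norm
  have h2 : MemLp (fun ω => C * (1 + ‖Z ω‖) ^ N) q μ := by
    rcases Nat.eq_zero_or_pos N with rfl | hN
    · simp only [pow_zero]; exact memLp_const _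
    have h3 := (h1.norm_rpow_div N).const_mul C
    rw [mul_comm, ENNReal.mul_div_cancel_right (by simpa using hN.ne') (by simp)] at h3
    refine h3.congr_norm ?_ (Eventually.of_forall fun ω => ?_)
    · exact (((aemeasurable_const.add hZm.norm).pow_const N).const_mul C).aestronglyMeasurable
    · simp only [ENNReal.toReal_natCast, Real.rpow_natCast]
      rw [Real.norm_of_nonneg (by positivity : (0 : ℝ) ≤ 1 + ‖Z ω‖)]
  refine h2.of_le (hf.comp_aestronglyMeasurable hZm.aestronglyMeasurable)
    (Eventually.of_forall fun ω => (hC _).trans (le_abs_self _))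

/-- The Gaussian density satisfies $\varphi'(x)=-x\varphi(x)/v$, and the derivative of $\varphi f$
has integral zero. -/
theorem integral_mul_id_gaussianReal {v : NNReal} (hv : v ≠ 0) {f f' : ℝ → ℝ}
    (hf : ∀ x, HasDerivAt f (f' x) x) (hint : Integrable f (gaussianReal 0 v))
    (hint' : Integrable f' (gaussianReal 0 v))
    (hintx : Integrable (fun x => f x * x) (gaussianReal 0 v)) :
    ∫ x, f x * x ∂gaussianReal 0 v = v * ∫ x, f' x ∂gaussianReal 0 v := by
  have key : ∀ {g : ℝ → ℝ}, Integrable g (gaussianReal 0 v) →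
      Integrable (fun x => gaussianPDFReal 0 v x * g x) volume := fun {g} hg => by
    rw [gaussianReal_of_var_ne_zero _ hv, integrable_withDensity_iff_integrable_smul'
      (measurable_gaussianPDF _ _) (Eventually.of_forall fun _ => gaussianPDF_lt_top)] at hg
    simpa only [toReal_gaussianPDF, smul_eq_mul] using hg
  have hv' : (v : ℝ) ≠ 0 := by exact_mod_cast hv
  have hpdf : ∀ x, HasDerivAt (gaussianPDFReal 0 v) (gaussianPDFReal 0 v x * (-x / v)) x := by
    intro x
    have h1 : HasDerivAt (fun x : ℝ => -(x - 0) ^ 2 / (2 * (v : ℝ))) (-x / v) x := by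
      have := ((((hasDerivAt_id x).sub_const 0).pow 2).neg.div_const (2 * (v : ℝ)))
      refine this.congr_deriv ?_
      simp only [id, sub_zero]
      field_simp
      norm_num
    have h2 := (h1.exp).const_mul (√(2 * Real.pi * v))⁻¹
    refine h2.congr_deriv ?_
    simp only [gaussianPDFReal]
    ring
  have h0 := integral_eq_zero_of_hasDerivAt_of_integrable
    (f := fun x => gaussianPDFReal 0 v x * f x)
    (f' := fun x => gaussianPDFReal 0 v x * f' x - (gaussianPDFReal 0 v x * (f x * x)) / v)
    (fun x => ((hpdf x).mul (hf x)).congr_deriv (by ring))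
    ((key hint').sub ((key hintx).div_const _)) (key hint)
  rw [integral_sub (key hint') ((key hintx).div_const _), integral_div, sub_eq_zero] at h0
  rw [integral_gaussianReal_eq_integral_smul hv, integral_gaussianReal_eq_integral_smul hv]
  simp only [smul_eq_mul]
  rw [h0]
  field_simp

theorem hasTemperateGrowth_fderiv {E F : Type*} [NormedAddCommGroup E] [NormedSpace ℝ E]
    [NormedAddCommGroup F] [NormedSpace ℝ F] {f : E → F} (hf : f.HasTemperateGrowth) :
    (fderiv ℝ f).HasTemperateGrowth := by
  refine ⟨hf.1.fderiv_right (by simp), fun n => ?_⟩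
  obtain ⟨k, C, h⟩ := hf.2 (n + 1)
  exact ⟨k, C, fun x => by rw [norm_iteratedFDeriv_fderiv]; exact h x⟩

theorem exists_norm_le_of_hasTemperateGrowth {E F : Type*} [NormedAddCommGroup E]
    [NormedSpace ℝ E] [NormedAddCommGroup F] [NormedSpace ℝ F] {f : E → F}
    (hf : f.HasTemperateGrowth) : ∃ (N : ℕ) (C : ℝ), ∀ x, ‖f x‖ ≤ C * (1 + ‖x‖) ^ N := by
  obtain ⟨k, C, h⟩ := hf.2 0
  exact ⟨k, C, fun x => by simpa using h x⟩

/-- Gaussian integration by parts for `W + Z c` with `W` and `Z` independent. -/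
theorem integral_comp_add_smul_mul {Ω' E : Type*} [MeasurableSpace Ω'] {μ : Measure Ω'}
    [IsProbabilityMeasure μ] [NormedAddCommGroup E] [NormedSpace ℝ E] [MeasurableSpace E]
    [BorelSpace E] [SecondCountableTopology E] {W : Ω' → E} {Z : Ω' → ℝ} {v : NNReal}
    (hv : v ≠ 0) (hWm : AEMeasurable W μ) (hZm : AEMeasurable Z μ)
    (hW : ∀ q : ℝ≥0∞, q ≠ ⊤ → MemLp W q μ)
    (hZ : μ.map Z = gaussianReal 0 v) (hind : IndepFun W Z μ) (c : E) {f : E → ℝ}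
    (hf : f.HasTemperateGrowth) :
    ∫ ω, f (W ω + Z ω • c) * Z ω ∂μ = v * ∫ ω, fderiv ℝ f (W ω + Z ω • c) c ∂μ := by
  have hlaw := (indepFun_iff_map_prod_eq_prod_map_map hWm hZm).1 hind
  rw [hZ] at hlaw
  have : IsProbabilityMeasure (μ.map W) := Measure.isProbabilityMeasure_map hWm
  have hZp : ∀ q : ℝ≥0∞, q ≠ ⊤ → MemLp Z q μ := fun q hq => by
    have h := memLp_id_gaussianReal' (μ := 0) (v := v) q hq
    rw [← hZ] at h
    exact (memLp_map_measure_iff aestronglyMeasurable_id hZm).1 h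
  have hWZ : ∀ q : ℝ≥0∞, q ≠ ⊤ → MemLp (fun ω => (W ω, Z ω)) q μ := fun q hq =>
    memLp_prod_iff.2 ⟨hW q hq, hZp q hq⟩
  have hWZm : AEMeasurable (fun ω => (W ω, Z ω)) μ := hWm.prodMk hZm
  have hf1 := hf.1.continuous
  have hf2 := (hasTemperateGrowth_fderiv hf).1.continuous
  have hL : (fun z : E × ℝ => z.1 + z.2 • c).HasTemperateGrowth :=
    (ContinuousLinearMap.fst ℝ E ℝ + (ContinuousLinearMap.snd ℝ E ℝ).smulRight
      c).hasTemperateGrowth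
  have hL2 : (fun z : E × ℝ => z.2).HasTemperateGrowth :=
    (ContinuousLinearMap.snd ℝ E ℝ).hasTemperateGrowth
  have hF1 : (fun z : E × ℝ => f (z.1 + z.2 • c) * z.2).HasTemperateGrowth :=
    (hf.comp hL).mul hL2
  have hF2 : (fun z : E × ℝ => fderiv ℝ f (z.1 + z.2 • c) c).HasTemperateGrowth :=
    (ContinuousLinearMap.apply ℝ ℝ c).hasTemperateGrowth.comp
      ((hasTemperateGrowth_fderiv hf).comp hL)
  have hint : ∀ {F : E × ℝ → ℝ}, F.HasTemperateGrowth →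
      Integrable F ((μ.map W).prod (gaussianReal 0 v)) := fun {F} hF => by
    obtain ⟨N, C, hC⟩ := exists_norm_le_of_hasTemperateGrowth hF
    rw [← hlaw, integrable_map_measure hF.1.continuous.aestronglyMeasurable hWZm,
      ← memLp_one_iff_integrable]
    exact memLp_comp_of_growth hWZm hWZ hF.1.continuous hC ENNReal.one_ne_top
  have hint1 : ∀ {F : ℝ → ℝ}, F.HasTemperateGrowth → Integrable F (gaussianReal 0 v) :=
    fun {F} hF => by
      obtain ⟨N, C, hC⟩ := exists_norm_le_of_hasTemperateGrowth hF
      rw [← memLp_one_iff_integrable]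
      exact memLp_comp_of_growth aemeasurable_id (fun q hq => memLp_id_gaussianReal' q hq)
        hF.1.continuous hC ENNReal.one_ne_top
  have e1 : ∫ ω, f (W ω + Z ω • c) * Z ω ∂μ =
      ∫ z, f (z.1 + z.2 • c) * z.2 ∂((μ.map W).prod (gaussianReal 0 v)) := by
    rw [← hlaw, integral_map hWZm hF1.1.continuous.aestronglyMeasurable]
  have e2 : ∫ ω, fderiv ℝ f (W ω + Z ω • c) c ∂μ =
      ∫ z, fderiv ℝ f (z.1 + z.2 • c) c ∂((μ.map W).prod (gaussianReal 0 v)) := by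
    rw [← hlaw, integral_map hWZm hF2.1.continuous.aestronglyMeasurable]
  -- By Fubini, integrate in $Z$ first; for a fixed value of $W$ the claim is the one-dimensional
  -- identity.
  rw [e1, e2, integral_prod _ (hint hF1), integral_prod _ (hint hF2), ← integral_const_mul]
  refine integral_congr_ae (Eventually.of_forall fun w => ?_)
  have hLw : (fun x : ℝ => w + x • c).HasTemperateGrowth :=
    (Function.HasTemperateGrowth.const w).add
      ((ContinuousLinearMap.id ℝ ℝ).smulRight c).hasTemperateGrowth
  refine integral_mul_id_gaussianReal hv (fun x => ?_) (hint1 (hf.comp hLw))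
    (hint1 ((ContinuousLinearMap.apply ℝ ℝ c).hasTemperateGrowth.comp
      ((hasTemperateGrowth_fderiv hf).comp hLw)))
    (hint1 ((hf.comp hLw).mul (ContinuousLinearMap.id ℝ ℝ).hasTemperateGrowth))
  have h1 : HasDerivAt (fun x : ℝ => w + x • c) c x := by
    simpa using ((hasDerivAt_id x).smul_const c).const_add w
  exact ((hf.1.differentiable (by simp)) _).hasFDerivAt.comp_hasDerivAt x h1

end YoungMalliavin

namespace YoungMalliavin

variable {Ω : Type*} [mΩ : MeasurableSpace Ω] {P : Measure Ω} {d : ℕ} [NeZero d] {T : ℝ}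
  {X : Time T → Ω → EuclideanSpace ℝ (Fin d)} (hX : IsGaussianDriver P X)

/-! ### The isonormal process -/

theorem wiener_coe (a : PreH1 hX) : wiener hX (a : H1 hX) = preWiener hX a :=
  ContinuousLinearMap.extend_eq _ UniformSpace.Completion.denseRange_coe
    (UniformSpace.Completion.isUniformInducing_coe _) a

theorem wiener_coe_ae (a : PreH1 hX) : wiener hX (a : H1 hX) =ᵐ[P] PreH1.eval hX a := by
  rw [wiener_coe]
  exact (PreH1.memLp_eval hX a).coeFn_toLp

theorem wiener_ind (t : Time T) (u : Fin d) : wiener hX (ind hX t u) =ᵐ[P] fun ω => X t ω u := by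
  refine (wiener_coe_ae hX _).trans (Eventually.of_forall fun ω => ?_)
  unfold PreH1.eval PreH1.gen
  rw [Finsupp.sum_single_index] <;> simp

theorem norm_wiener (h : H1 hX) : ‖wiener hX h‖ = ‖h‖ := by
  refine UniformSpace.Completion.induction_on h
    (isClosed_eq (wiener hX).continuous.norm continuous_norm) fun a => ?_
  rw [wiener_coe, norm_preWiener, UniformSpace.Completion.norm_coe]

/-- `I` as a linear isometry. -/
def wienerIso : H1 hX →ₗᵢ[ℝ] Lp ℝ 2 P := ⟨(wiener hX).toLinearMap, norm_wiener hX⟩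

theorem integral_wiener_mul (h k : H1 hX) :
    ∫ ω, wiener hX h ω * wiener hX k ω ∂P = ⟪h, k⟫ := by
  have h1 : ⟪wiener hX h, wiener hX k⟫ = ⟪h, k⟫ := (wienerIso hX).inner_map_map h k
  rw [← h1, L2.inner_def]
  simp only [RCLike.inner_apply, conj_trivial, mul_comm]

theorem memLp_wiener (h : H1 hX) : MemLp (wiener hX h) 2 P := Lp.memLp _

theorem wiener_sum_ae {ι : Type*} (s : Finset ι) (c : ι → ℝ) (h : ι → H1 hX) :
    wiener hX (∑ i ∈ s, c i • h i) =ᵐ[P] fun ω => ∑ i ∈ s, c i * wiener hX (h i) ω := by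
  classical
  rw [map_sum]
  induction s using Finset.induction_on with
  | empty =>
    simp only [Finset.sum_empty]
    exact Lp.coeFn_zero ℝ 2 P
  | insert a s ha ih =>
    simp only [Finset.sum_insert ha, map_smul] at ih ⊢
    filter_upwards [Lp.coeFn_add (c a • wiener hX (h a)) (∑ i ∈ s, c i • wiener hX (h i)),
      Lp.coeFn_smul (c a) (wiener hX (h a)), ih] with ω h1 h2 h3
    rw [h1, Pi.add_apply, h2, h3, Pi.smul_apply, smul_eq_mul]

variable [IsProbabilityMeasure P]

omit [NeZero d] [IsProbabilityMeasure P] in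
theorem hasGaussianLaw_eval (a : PreH1 hX) : HasGaussianLaw (PreH1.eval hX a) P := by
  classical
  let I : Finset (Time T) := (Finsupp.support (M := ℝ) a).image Prod.fst
  have hI : ∀ x ∈ Finsupp.support (M := ℝ) a, x.1 ∈ I := fun x hx =>
    Finset.mem_image_of_mem _ hx
  let L : ((I → EuclideanSpace ℝ (Fin d)) →L[ℝ] ℝ) :=
    ∑ x : Finsupp.support (M := ℝ) a, (DFunLike.coe (F := (Time T × Fin d) →₀ ℝ) a x.1) •
      ((EuclideanSpace.proj (𝕜 := ℝ) x.1.2).comp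
        (ContinuousLinearMap.proj (R := ℝ) (φ := fun _ : I => EuclideanSpace ℝ (Fin d))
          ⟨x.1.1, hI x.1 x.2⟩))
  refine (((hX.gaussian.hasGaussianLaw I).map_fun L)).congr (Eventually.of_forall fun ω => ?_)
  simp only [L, PreH1.eval, Finsupp.sum, sum_apply]
  exact Finset.sum_coe_sort (Finsupp.support (M := ℝ) a)
    fun x => DFunLike.coe (F := (Time T × Fin d) →₀ ℝ) a x * X x.1 ω x.2

theorem integral_eval (a : PreH1 hX) : ∫ ω, PreH1.eval hX a ω ∂P = 0 := by
  unfold PreH1.eval Finsupp.sum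
  rw [integral_finsetSum _ fun x _ =>
    ((hX.memLp_coord x.1 x.2).integrable one_le_two).const_mul _]
  exact Finset.sum_eq_zero fun x _ => by rw [integral_const_mul, hX.centered, mul_zero]

theorem map_eval (a : PreH1 hX) :
    P.map (PreH1.eval hX a) = gaussianReal 0 (‖a‖₊ ^ 2) := by
  rw [(hasGaussianLaw_eval hX a).map_eq_gaussianReal, integral_eval]
  congr 1
  rw [variance_of_integral_eq_zero (PreH1.memLp_eval hX a).aestronglyMeasurable.aemeasurable
    (integral_eval hX a)]
  have h2 : ∫ ω, PreH1.eval hX a ω ^ 2 ∂P = ‖a‖ ^ 2 := by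
    have h3 : ‖a‖ ^ 2 = PreH1.form hX a a := (real_inner_self_eq_norm_sq a).symm
    rw [h3, PreH1.form_eq]
    simp only [sq]
  rw [h2]
  ext
  simp

/-- From $|e^{ia}-e^{ib}|\le|a-b|$ and $L^1\le L^2$. This continuity in `h` carries the Gaussian law
from finite combinations of the generators to the whole completion. -/
theorem lipschitz_charFun_wiener (t : ℝ) (h k : H1 hX) :
    ‖charFun (P.map (wiener hX h)) t - charFun (P.map (wiener hX k)) t‖ ≤ |t| * ‖h - k‖ := by
  have hm : ∀ h, AEMeasurable (wiener hX h) P := fun h =>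
    (memLp_wiener hX h).aestronglyMeasurable.aemeasurable
  have hc : Continuous fun x : ℝ => Complex.exp (t * x * Complex.I) := by fun_prop
  have e : ∀ h, charFun (P.map (wiener hX h)) t =
      ∫ ω, Complex.exp (t * wiener hX h ω * Complex.I) ∂P := fun h => by
    rw [charFun_apply_real, integral_map (hm h) hc.aestronglyMeasurable]
  have hint : ∀ h, Integrable (fun ω => Complex.exp (t * wiener hX h ω * Complex.I)) P := fun h =>
    (integrable_const (1 : ℝ)).mono' (hc.comp_aestronglyMeasurable
      (memLp_wiener hX h).aestronglyMeasurable) (Eventually.of_forall fun ω => by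
        rw [← Complex.ofReal_mul, Complex.norm_exp_ofReal_mul_I])
  have hsub : ∀ᵐ ω ∂P, wiener hX (h - k) ω = wiener hX h ω - wiener hX k ω := by
    rw [map_sub]; exact Lp.coeFn_sub _ _
  have hI1 : Integrable (wiener hX (h - k)) P := (memLp_wiener hX (h - k)).integrable one_le_two
  rw [e, e, ← integral_sub (hint h) (hint k)]
  refine (norm_integral_le_integral_norm _).trans ?_
  calc ∫ ω, ‖Complex.exp (t * wiener hX h ω * Complex.I) -
        Complex.exp (t * wiener hX k ω * Complex.I)‖ ∂P
      ≤ ∫ ω, |t| * ‖wiener hX (h - k) ω‖ ∂P := by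
        refine integral_mono_ae ((hint h).sub (hint k)).norm (hI1.norm.const_mul _) ?_
        filter_upwards [hsub] with ω hω
        have e2 : Complex.exp (t * wiener hX h ω * Complex.I) -
            Complex.exp (t * wiener hX k ω * Complex.I) =
            Complex.exp ((t * wiener hX k ω : ℝ) * Complex.I) *
            (Complex.exp (Complex.I * (t * (wiener hX h ω - wiener hX k ω) : ℝ)) - 1) := by
          rw [mul_sub, ← Complex.exp_add, mul_one]
          push_cast
          ring_nf
        simp only [e2, norm_mul, Complex.norm_exp_ofReal_mul_I, one_mul, hω]
        exact Real.norm_exp_I_mul_ofReal_sub_one_le.trans (by rw [norm_mul, Real.norm_eq_abs,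
          Real.norm_eq_abs])
    _ = |t| * (eLpNorm (wiener hX (h - k)) 1 P).toReal := by
        rw [integral_const_mul, eLpNorm_one_eq_lintegral_enorm,
          integral_norm_eq_lintegral_enorm hI1.aestronglyMeasurable]
    _ ≤ |t| * ‖h - k‖ := by
        refine mul_le_mul_of_nonneg_left ?_ (abs_nonneg _)
        rw [← norm_wiener, Lp.norm_def]
        exact ENNReal.toReal_mono (Lp.eLpNorm_ne_top _)
          (eLpNorm_le_eLpNorm_of_exponent_le one_le_two (Lp.aestronglyMeasurable _))

theorem map_wiener (h : H1 hX) : P.map (wiener hX h) = gaussianReal 0 (‖h‖₊ ^ 2) := by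
  have hm : ∀ h, AEMeasurable (wiener hX h) P := fun h =>
    (memLp_wiener hX h).aestronglyMeasurable.aemeasurable
  have := Measure.isProbabilityMeasure_map (hm h)
  refine Measure.ext_of_charFun (funext fun t => ?_)
  rw [charFun_gaussianReal]
  refine UniformSpace.Completion.induction_on h (isClosed_eq ?_ ?_) fun a => ?_
  · refine (LipschitzWith.of_dist_le_mul (K := ⟨|t|, abs_nonneg t⟩) fun x y => ?_).continuous
    rw [dist_eq_norm, dist_eq_norm]
    exact lipschitz_charFun_wiener hX t x y
  · have : Continuous fun h : H1 hX => ((‖h‖₊ ^ 2 : NNReal) : ℝ) := by fun_prop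
    fun_prop
  · rw [Measure.map_congr (wiener_coe_ae hX a), map_eval, charFun_gaussianReal,
      UniformSpace.Completion.nnnorm_coe]

/-- Every linear functional of the vector is almost surely $I$ of a linear combination of the `h i`,
hence Gaussian. -/
theorem hasGaussianLaw_wiener {ι : Type*} [Fintype ι] (h : ι → H1 hX) :
    HasGaussianLaw (fun ω i => wiener hX (h i) ω) P := by
  classical
  have hm : AEMeasurable (fun ω i => wiener hX (h i) ω) P :=
    aemeasurable_pi_lambda _ fun i => (memLp_wiener hX (h i)).aestronglyMeasurable.aemeasurable
  refine ⟨isGaussian_of_map_eq_gaussianReal fun L =>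
    ⟨0, ‖∑ i, L (Pi.single i 1) • h i‖₊ ^ 2, ?_⟩⟩
  rw [AEMeasurable.map_map_of_aemeasurable L.continuous.measurable.aemeasurable hm, ← map_wiener]
  refine Measure.map_congr ?_
  filter_upwards [wiener_sum_ae hX Finset.univ (fun i => L (Pi.single i 1)) h] with ω hω
  rw [hω, Function.comp_apply]
  conv_lhs => rw [pi_eq_sum_univ' (fun i => wiener hX (h i) ω)]
  rw [map_sum]
  refine Finset.sum_congr rfl fun i _ => ?_
  rw [map_smul, smul_eq_mul, mul_comm]

theorem integral_wiener (h : H1 hX) : ∫ ω, wiener hX h ω ∂P = 0 := by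
  have h1 := integral_id_gaussianReal (μ := 0) (v := ‖h‖₊ ^ 2)
  rwa [← map_wiener hX h, integral_map
    (memLp_wiener hX h).aestronglyMeasurable.aemeasurable
    (f := fun x : ℝ => x) aestronglyMeasurable_id] at h1

/-- Integration by parts for functions of finitely many Gaussian variables `I(h_i)`. -/
theorem integral_comp_wiener_mul {ι : Type*} [Fintype ι] [DecidableEq ι] (h : ι → H1 hX)
    (k : H1 hX) {f : (ι → ℝ) → ℝ} (hf : f.HasTemperateGrowth) :
    ∫ ω, f (fun i => wiener hX (h i) ω) * wiener hX k ω ∂P =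
      ∫ ω, ∑ i, fderiv ℝ f (fun i => wiener hX (h i) ω) (Pi.single i 1) * ⟪h i, k⟫ ∂P := by
  have hmw : ∀ h, AEMeasurable (wiener hX h) P := fun h =>
    (memLp_wiener hX h).aestronglyMeasurable.aemeasurable
  by_cases hk : k = 0
  · subst hk
    simp only [inner_zero_right, mul_zero, Finset.sum_const_zero, integral_zero]
    refine integral_eq_zero_of_ae ?_
    rw [map_zero]
    filter_upwards [Lp.coeFn_zero ℝ 2 P] with ω hω
    rw [hω]; simp
  have hk2 : ‖k‖ ^ 2 ≠ 0 := pow_ne_zero _ (norm_ne_zero_iff.2 hk)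
  have hv : ‖k‖₊ ^ 2 ≠ 0 := pow_ne_zero _ (nnnorm_ne_zero_iff.2 hk)
  -- Regression on $I(k)$: the residual $I(h_i)-c_iI(k)$ is uncorrelated with $I(k)$, hence
  -- independent of it by joint Gaussianity.
  set c : ι → ℝ := fun i => ⟪h i, k⟫ / ‖k‖ ^ 2 with hc
  set W : Ω → ι → ℝ := fun ω i => wiener hX (h i) ω - c i * wiener hX k ω with hW
  have hjoint : HasGaussianLaw (fun ω => (fun i => W ω i, fun _ : Unit => wiener hX k ω)) P := by
    let L : ((ι ⊕ Unit → ℝ) →L[ℝ] ((ι → ℝ) × (Unit → ℝ))) :=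
      (ContinuousLinearMap.pi fun i => ContinuousLinearMap.proj (R := ℝ) (Sum.inl i) -
        c i • ContinuousLinearMap.proj (R := ℝ) (Sum.inr ())).prod
      (ContinuousLinearMap.pi fun _ => ContinuousLinearMap.proj (R := ℝ) (Sum.inr ()))
    exact (hasGaussianLaw_wiener hX (Sum.elim h fun _ => k)).map_fun L
  have hWG : HasGaussianLaw W P := hjoint.fst
  have hind : IndepFun W (wiener hX k) P := by
    have h1 := hjoint.indepFun_of_covariance_eval (X := fun i ω => W ω i) fun i _ => ?_
    · exact h1.comp (φ := id) (ψ := fun x : Unit → ℝ => x ()) measurable_id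
        (measurable_pi_apply _)
    have hWi : MemLp (fun ω => W ω i) 2 P :=
      (memLp_wiener hX (h i)).sub ((memLp_wiener hX k).const_mul _)
    rw [covariance_eq_sub hWi (memLp_wiener hX k), integral_wiener, mul_zero, sub_zero]
    have e : ∀ ω, ((fun ω => W ω i) * fun ω => wiener hX k ω) ω =
        wiener hX (h i) ω * wiener hX k ω - c i * (wiener hX k ω * wiener hX k ω) := fun ω => by
      simp only [hW, Pi.mul_apply]; ring
    simp only [e]
    have hmul : ∀ h, Integrable (fun ω => wiener hX h ω * wiener hX k ω) P := fun h =>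
      (memLp_wiener hX h).integrable_mul (memLp_wiener hX k)
    rw [integral_sub (hmul _) ((hmul k).const_mul _), integral_const_mul, integral_wiener_mul, integral_wiener_mul, real_inner_self_eq_norm_sq,
      hc, div_mul_cancel₀ _ hk2, sub_self]
  have hvec : ∀ ω, (fun i => wiener hX (h i) ω) = W ω + wiener hX k ω • c := fun ω => by
    funext i
    simp only [hW, Pi.add_apply, Pi.smul_apply, smul_eq_mul]; ring
  simp only [hvec]
  rw [integral_comp_add_smul_mul hv hWG.aemeasurable (hmw k) (fun q hq => hWG.memLp hq)
    (map_wiener hX k) hind c hf, ← integral_const_mul]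
  have key : ∀ A : (ι → ℝ) →L[ℝ] ℝ, ((‖k‖₊ ^ 2 : NNReal) : ℝ) * A c =
      ∑ i, A (Pi.single i 1) * ⟪h i, k⟫ := fun A => by
    have e3 : A c = ∑ i, c i * A (Pi.single i 1) := by
      conv_lhs => rw [pi_eq_sum_univ' c]
      rw [map_sum]
      exact Finset.sum_congr rfl fun i _ => by rw [map_smul, smul_eq_mul]
    rw [e3, Finset.mul_sum]
    refine Finset.sum_congr rfl fun i _ => ?_
    simp only [hc]
    push_cast
    field_simp
  exact integral_congr_ae (Eventually.of_forall fun ω => key _)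

end YoungMalliavin

namespace YoungMalliavin

/-! ### Gradients as vectors of a Hilbert space -/

section Grad

variable {ι κ H : Type*} [Fintype ι] [DecidableEq ι] [Fintype κ] [DecidableEq κ]
  [NormedAddCommGroup H] [InnerProductSpace ℝ H]

/-- The vector `∑ L(e_i) h_i`. -/
def gradH (h : ι → H) : ((ι → ℝ) →L[ℝ] ℝ) →L[ℝ] H :=
  ∑ i, (ContinuousLinearMap.apply ℝ ℝ (Pi.single i (1 : ℝ) : ι → ℝ)).smulRight (h i)

theorem gradH_apply (h : ι → H) (L : (ι → ℝ) →L[ℝ] ℝ) :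
    gradH h L = ∑ i, L (Pi.single i 1) • h i := by
  simp [gradH, sum_apply]

theorem inner_gradH (h : ι → H) (L : (ι → ℝ) →L[ℝ] ℝ) (k : H) :
    ⟪gradH h L, k⟫ = L fun i => ⟪h i, k⟫ := by
  rw [gradH_apply, sum_inner]
  conv_rhs => rw [pi_eq_sum_univ' (fun i => ⟪h i, k⟫)]
  rw [map_sum]
  refine Finset.sum_congr rfl fun i _ => ?_
  rw [map_smul, smul_eq_mul, real_inner_smul_left, mul_comm]

/-- The restriction to the left coordinates. -/
def projInl : (ι ⊕ κ → ℝ) →L[ℝ] (ι → ℝ) :=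
  ContinuousLinearMap.pi fun i => ContinuousLinearMap.proj (R := ℝ) (Sum.inl i)

/-- The restriction to the right coordinates. -/
def projInr : (ι ⊕ κ → ℝ) →L[ℝ] (κ → ℝ) :=
  ContinuousLinearMap.pi fun i => ContinuousLinearMap.proj (R := ℝ) (Sum.inr i)

theorem gradH_comp_projInl (h : ι → H) (h' : κ → H) (L : (ι → ℝ) →L[ℝ] ℝ) :
    gradH (Sum.elim h h') (L.comp projInl) = gradH h L := by
  refine ext_inner_right ℝ fun k => ?_
  rw [inner_gradH, inner_gradH]
  rfl

theorem gradH_comp_projInr (h : ι → H) (h' : κ → H) (L : (κ → ℝ) →L[ℝ] ℝ) :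
    gradH (Sum.elim h h') (L.comp projInr) = gradH h' L := by
  refine ext_inner_right ℝ fun k => ?_
  rw [inner_gradH, inner_gradH]
  rfl

end Grad

variable {Ω : Type*} [mΩ : MeasurableSpace Ω] {P : Measure Ω} {d : ℕ} [NeZero d] {T : ℝ}
  {X : Time T → Ω → EuclideanSpace ℝ (Fin d)} (hX : IsGaussianDriver P X)

/-! ### Cylinder functionals of temperate growth -/

/-- `F = f(I(h_i))` and `DF = ∑ ∂_i f(I(h_i)) h_i` for a smooth `f` of temperate growth. -/
def IsCyl (F : Ω → ℝ) (DF : Ω → H1 hX) : Prop :=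
  ∃ (ι : Type) (_ : Fintype ι) (_ : DecidableEq ι) (h : ι → H1 hX) (f : (ι → ℝ) → ℝ),
    f.HasTemperateGrowth ∧ (∀ ω, F ω = f fun i => wiener hX (h i) ω) ∧
      ∀ ω, DF ω = gradH h (fderiv ℝ f fun i => wiener hX (h i) ω)

variable {hX}

namespace IsCyl

variable {F G : Ω → ℝ} {DF DG : Ω → H1 hX}

/-- Both functionals are functions of the concatenated Gaussian family, each ignoring the
coordinates of the other. -/
theorem exists_common (hF : IsCyl hX F DF) (hG : IsCyl hX G DG) :
    ∃ (ι : Type) (_ : Fintype ι) (_ : DecidableEq ι) (h : ι → H1 hX) (f g : (ι → ℝ) → ℝ),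
      f.HasTemperateGrowth ∧ g.HasTemperateGrowth ∧
      (∀ ω, F ω = f fun i => wiener hX (h i) ω) ∧
      (∀ ω, DF ω = gradH h (fderiv ℝ f fun i => wiener hX (h i) ω)) ∧
      (∀ ω, G ω = g fun i => wiener hX (h i) ω) ∧
      ∀ ω, DG ω = gradH h (fderiv ℝ g fun i => wiener hX (h i) ω) := by
  obtain ⟨ι, _, _, h, f, hf, hF1, hF2⟩ := hF
  obtain ⟨κ, _, _, h', g, hg, hG1, hG2⟩ := hG
  refine ⟨ι ⊕ κ, inferInstance, inferInstance, Sum.elim h h', f ∘ projInl, g ∘ projInr,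
    hf.comp (projInl (ι := ι) (κ := κ)).hasTemperateGrowth, hg.comp (projInr (ι := ι) (κ := κ)).hasTemperateGrowth, hF1, fun ω => ?_,
    hG1, fun ω => ?_⟩
  · rw [fderiv_comp _ (hf.1.differentiable (by simp) _) projInl.differentiableAt,
      ContinuousLinearMap.fderiv, gradH_comp_projInl]
    exact hF2 ω
  · rw [fderiv_comp _ (hg.1.differentiable (by simp) _) projInr.differentiableAt,
      ContinuousLinearMap.fderiv, gradH_comp_projInr]
    exact hG2 ω

/-- Temperate growth, unlike boundedness, is compatible with factors $I(k)$. It keeps the divergence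
$F\,I(k)-\langle DF,k\rangle$ inside the class, so that it can be integrated by parts again. -/
theorem mul (hF : IsCyl hX F DF) (hG : IsCyl hX G DG) :
    IsCyl hX (fun ω => F ω * G ω) (fun ω => F ω • DG ω + G ω • DF ω) := by
  obtain ⟨ι, i1, i2, h, f, g, hf, hg, hF1, hF2, hG1, hG2⟩ := exists_common hF hG
  refine ⟨ι, i1, i2, h, f * g, hf.mul hg, fun ω => ?_, fun ω => ?_⟩
  · beta_reduce
    rw [hF1, hG1, Pi.mul_apply]
  · beta_reduce
    rw [hF2, hG2, hF1, hG1, fderiv_mul (hf.1.differentiable (by simp) _)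
      (hg.1.differentiable (by simp) _), map_add, map_smul, map_smul]

theorem sub (hF : IsCyl hX F DF) (hG : IsCyl hX G DG) :
    IsCyl hX (fun ω => F ω - G ω) (fun ω => DF ω - DG ω) := by
  obtain ⟨ι, i1, i2, h, f, g, hf, hg, hF1, hF2, hG1, hG2⟩ := exists_common hF hG
  refine ⟨ι, i1, i2, h, f - g, hf.sub hg, fun ω => ?_, fun ω => ?_⟩
  · beta_reduce
    rw [hF1, hG1, Pi.sub_apply]
  · beta_reduce
    rw [hF2, hG2, fderiv_sub (hf.1.differentiable (by simp) _)
      (hg.1.differentiable (by simp) _), map_sub]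

variable (hX) in
theorem const (c : ℝ) : IsCyl hX (fun _ => c) (fun _ => 0) := by
  refine ⟨Empty, inferInstance, inferInstance, Empty.elim, fun _ => c, .const c, fun _ => rfl,
    fun ω => ?_⟩
  simp [gradH_apply]

variable (hX) in
theorem wiener (k : H1 hX) : IsCyl hX (fun ω => wiener hX k ω) (fun _ => k) := by
  refine ⟨Unit, inferInstance, inferInstance, fun _ => k, fun x => x (),
    (ContinuousLinearMap.proj (R := ℝ) (φ := fun _ : Unit => ℝ) ()).hasTemperateGrowth,
    fun _ => rfl, fun ω => ?_⟩
  have : fderiv ℝ (fun x : Unit → ℝ => x ()) (fun _ => YoungMalliavin.wiener hX k ω) =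
      ContinuousLinearMap.proj (R := ℝ) (φ := fun _ : Unit => ℝ) () :=
    (ContinuousLinearMap.proj (R := ℝ) (φ := fun _ : Unit => ℝ) ()).fderiv
  rw [this]
  simp [gradH_apply]

/-- The symmetry of the second derivative is what cancels the second-order terms in the isometry. -/
theorem exists_second_deriv (hF : IsCyl hX F DF) : ∃ D2 : H1 hX → Ω → H1 hX,
    (∀ k, IsCyl hX (fun ω => ⟪DF ω, k⟫) (D2 k)) ∧ ∀ k l ω, ⟪D2 k ω, l⟫ = ⟪D2 l ω, k⟫ := by
  obtain ⟨ι, i1, i2, h, f, hf, hF1, hF2⟩ := hF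
  have hdf : ∀ x, DifferentiableAt ℝ (fderiv ℝ f) x := fun x =>
    (hasTemperateGrowth_fderiv hf).1.differentiable (by simp) x
  have hder : ∀ (c x : ι → ℝ), fderiv ℝ (fun x => fderiv ℝ f x c) x =
      (ContinuousLinearMap.apply ℝ ℝ c).comp (fderiv ℝ (fderiv ℝ f) x) := fun c x =>
    ((ContinuousLinearMap.apply ℝ ℝ c).hasFDerivAt.comp x (hdf x).hasFDerivAt).fderiv
  refine ⟨fun k ω => gradH h (fderiv ℝ (fun x => fderiv ℝ f x fun i => ⟪h i, k⟫)
    fun i => YoungMalliavin.wiener hX (h i) ω), fun k => ⟨ι, i1, i2, h,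
      fun x => fderiv ℝ f x fun i => ⟪h i, k⟫, ?_, fun ω => ?_, fun _ => rfl⟩, fun k l ω => ?_⟩
  · exact (ContinuousLinearMap.apply ℝ ℝ fun i => ⟪h i, k⟫).hasTemperateGrowth.comp
      (hasTemperateGrowth_fderiv hf)
  · beta_reduce
    rw [hF2, inner_gradH]
  · rw [inner_gradH, inner_gradH, hder, hder]
    exact (hf.1.contDiffAt.isSymmSndFDerivAt
      (by
        simp only [minSmoothness_of_isRCLikeNormedField]
        exact WithTop.coe_le_coe.2 (le_top (a := (2 : ℕ∞))))) _ _

variable [IsProbabilityMeasure P]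

theorem memLp (hF : IsCyl hX F DF) {q : ℝ≥0∞} (hq : q ≠ ⊤) : MemLp F q P := by
  obtain ⟨ι, i1, i2, h, f, hf, hF1, hF2⟩ := hF
  obtain ⟨N, C, hC⟩ := exists_norm_le_of_hasTemperateGrowth hf
  rw [funext hF1]
  have hG := hasGaussianLaw_wiener hX h
  exact memLp_comp_of_growth hG.aemeasurable (fun q hq => hG.memLp hq) hf.1.continuous hC hq

theorem memLp_deriv (hF : IsCyl hX F DF) {q : ℝ≥0∞} (hq : q ≠ ⊤) : MemLp DF q P := by
  obtain ⟨ι, i1, i2, h, f, hf, hF1, hF2⟩ := hF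
  have hf2 : (fun x => gradH h (fderiv ℝ f x)).HasTemperateGrowth :=
    (gradH h).hasTemperateGrowth.comp (hasTemperateGrowth_fderiv hf)
  obtain ⟨N, C, hC⟩ := exists_norm_le_of_hasTemperateGrowth hf2
  rw [funext hF2]
  have hG := hasGaussianLaw_wiener hX h
  exact memLp_comp_of_growth hG.aemeasurable (fun q hq => hG.memLp hq) hf2.1.continuous hC hq

theorem integrable (hF : IsCyl hX F DF) : Integrable F P :=
  memLp_one_iff_integrable.1 (hF.memLp ENNReal.one_ne_top)

theorem integrable_div (hF : IsCyl hX F DF) (k : H1 hX) :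
    Integrable (fun ω => F ω * YoungMalliavin.wiener hX k ω - ⟪DF ω, k⟫) P := by
  obtain ⟨D2, h2, -⟩ := hF.exists_second_deriv
  exact ((hF.mul (wiener hX k)).sub (h2 k)).integrable

/-- Gaussian integration by parts: the divergence `F I(k) - ⟨DF, k⟩` is centered. -/
theorem integral_div (hF : IsCyl hX F DF) (k : H1 hX) :
    ∫ ω, (F ω * YoungMalliavin.wiener hX k ω - ⟪DF ω, k⟫) ∂P = 0 := by
  obtain ⟨D2, h2, -⟩ := hF.exists_second_deriv
  rw [integral_sub (hF.mul (wiener hX k)).integrable (h2 k).integrable, sub_eq_zero]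
  obtain ⟨ι, i1, i2, h, f, hf, hF1, hF2⟩ := hF
  simp only [hF1, hF2]
  rw [integral_comp_wiener_mul hX h k hf]
  simp only [gradH_apply, sum_inner, real_inner_smul_left]

/-- The isometry for the divergence of elementary integrands. -/
theorem integral_div_mul_div (hF : IsCyl hX F DF) (hG : IsCyl hX G DG) (k l : H1 hX) :
    Integrable (fun ω => (F ω * YoungMalliavin.wiener hX k ω - ⟪DF ω, k⟫) *
      (G ω * YoungMalliavin.wiener hX l ω - ⟪DG ω, l⟫)) P ∧
    Integrable (fun ω => F ω * G ω * ⟪k, l⟫ + ⟪DF ω, l⟫ * ⟪DG ω, k⟫) P ∧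
    ∫ ω, (F ω * YoungMalliavin.wiener hX k ω - ⟪DF ω, k⟫) *
      (G ω * YoungMalliavin.wiener hX l ω - ⟪DG ω, l⟫) ∂P =
    ∫ ω, (F ω * G ω * ⟪k, l⟫ + ⟪DF ω, l⟫ * ⟪DG ω, k⟫) ∂P := by
  obtain ⟨D2F, hF2, -⟩ := hF.exists_second_deriv
  obtain ⟨D2G, hG2, hsymm⟩ := hG.exists_second_deriv
  have hV := (hG.mul (wiener hX l)).sub (hG2 l)
  have hU := (hF.mul (wiener hX k)).sub (hF2 k)
  have i1 := (hU.mul hV).integrable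
  have i2 : Integrable (fun ω => F ω * G ω * ⟪k, l⟫ + ⟪DF ω, l⟫ * ⟪DG ω, k⟫) P :=
    ((hF.mul hG).mul (const hX ⟪k, l⟫)).integrable.add ((hF2 l).mul (hG2 k)).integrable
  refine ⟨i1, i2, ?_⟩
  -- The difference of the two integrands is the sum of two centered divergences: that of
  -- $F\,(G\,I(l)-\langle DG,l\rangle)$ in direction $k$ and that of $F\langle DG,k\rangle$ in
  -- direction $l$.
  have h1 := (hF.mul hV).integral_div k
  have h2 := (hF.mul (hG2 k)).integral_div l
  have h3 := integral_add ((hF.mul hV).integrable_div k) ((hF.mul (hG2 k)).integrable_div l)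
  rw [h1, h2, add_zero] at h3
  rw [← sub_eq_zero, ← integral_sub i1 i2, ← h3]
  refine integral_congr_ae (Eventually.of_forall fun ω => ?_)
  simp only [inner_add_left, inner_sub_left, real_inner_smul_left]
  rw [hsymm k l ω, real_inner_comm k l]
  ring

end IsCyl

theorem SmoothFunctional.isCyl (S : SmoothFunctional hX) : IsCyl hX S.val S.deriv := by
  refine ⟨Fin S.n, inferInstance, inferInstance, S.h, S.f, ⟨S.smooth, fun n => ?_⟩,
    fun _ => rfl, fun ω => (gradH_apply _ _).symm⟩
  obtain ⟨C, hC⟩ := S.bounded n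
  exact ⟨0, C, fun x => by simpa using hC x⟩

end YoungMalliavin

namespace YoungMalliavin

/-! ### Limits in `L²` -/

section L2

variable {Ω : Type*} [MeasurableSpace Ω] {P : Measure Ω} {E : Type*} [NormedAddCommGroup E]
  [InnerProductSpace ℝ E] {ι : Type*} {l : Filter ι}

theorem integral_inner_eq_inner_toLp {f g : Ω → E} (hf : MemLp f 2 P) (hg : MemLp g 2 P) :
    ∫ ω, ⟪f ω, g ω⟫ ∂P = ⟪hf.toLp f, hg.toLp g⟫ := by
  rw [L2.inner_def]
  refine integral_congr_ae ?_
  filter_upwards [hf.coeFn_toLp, hg.coeFn_toLp] with ω h1 h2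
  rw [h1, h2]

theorem integrable_inner_of_memLp {f g : Ω → E} (hf : MemLp f 2 P) (hg : MemLp g 2 P) :
    Integrable (fun ω => ⟪f ω, g ω⟫) P :=
  memLp_one_iff_integrable.1 ((hf.norm.mul hg.norm (r := 1)).of_le
    (hf.aestronglyMeasurable.inner hg.aestronglyMeasurable)
    (Eventually.of_forall fun ω => (norm_inner_le_norm _ _).trans (by
      rw [Pi.mul_apply, mul_comm]; exact le_abs_self _)))

theorem integral_norm_sq_eq {f : Ω → E} (hf : MemLp f 2 P) :
    ∫ ω, ‖f ω‖ ^ 2 ∂P = ‖hf.toLp f‖ ^ 2 := by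
  rw [← real_inner_self_eq_norm_sq, ← integral_inner_eq_inner_toLp hf hf]
  simp only [real_inner_self_eq_norm_sq]

omit [InnerProductSpace ℝ E] in
theorem tendsto_toLp_of_tendsto_eLpNorm {f : ι → Ω → E} {g : Ω → E} (hf : ∀ i, MemLp (f i) 2 P)
    (hg : MemLp g 2 P) (h : Tendsto (fun i => eLpNorm (fun ω => f i ω - g ω) 2 P) l (𝓝 0)) :
    Tendsto (fun i => (hf i).toLp (f i)) l (𝓝 (hg.toLp g)) :=
  (Lp.tendsto_Lp_iff_tendsto_eLpNorm'' f hf g hg).2 h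

theorem tendsto_integral_inner {f f' : ι → Ω → E} {g g' : Ω → E} (hf : ∀ i, MemLp (f i) 2 P)
    (hg : MemLp g 2 P) (h : Tendsto (fun i => eLpNorm (fun ω => f i ω - g ω) 2 P) l (𝓝 0))
    (hf' : ∀ i, MemLp (f' i) 2 P) (hg' : MemLp g' 2 P)
    (h' : Tendsto (fun i => eLpNorm (fun ω => f' i ω - g' ω) 2 P) l (𝓝 0)) :
    Tendsto (fun i => ∫ ω, ⟪f i ω, f' i ω⟫ ∂P) l (𝓝 (∫ ω, ⟪g ω, g' ω⟫ ∂P)) := by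
  rw [integral_inner_eq_inner_toLp hg hg']
  exact ((tendsto_toLp_of_tendsto_eLpNorm hf hg h).inner (𝕜 := ℝ)
    (tendsto_toLp_of_tendsto_eLpNorm hf' hg' h')).congr fun i =>
    (integral_inner_eq_inner_toLp (hf i) (hf' i)).symm

theorem tendsto_integral_inner_const {f : ι → Ω → E} {g k : Ω → E} (hf : ∀ i, MemLp (f i) 2 P)
    (hg : MemLp g 2 P) (h : Tendsto (fun i => eLpNorm (fun ω => f i ω - g ω) 2 P) l (𝓝 0))
    (hk : MemLp k 2 P) :
    Tendsto (fun i => ∫ ω, ⟪f i ω, k ω⟫ ∂P) l (𝓝 (∫ ω, ⟪g ω, k ω⟫ ∂P)) :=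
  tendsto_integral_inner hf hg h (fun _ => hk) hk (by
    simpa using tendsto_const_nhds)

theorem eLpNorm_two_eq_ofReal {f : Ω → E} (hf : MemLp f 2 P) :
    eLpNorm f 2 P = ENNReal.ofReal (√(∫ ω, ‖f ω‖ ^ 2 ∂P)) := by
  rw [integral_norm_sq_eq hf, Real.sqrt_sq (norm_nonneg _), Lp.norm_toLp,
    ENNReal.ofReal_toReal hf.2.ne]

theorem tendsto_eLpNorm_iff {f : ι → Ω → E} (hf : ∀ᶠ i in l, MemLp (f i) 2 P) :
    Tendsto (fun i => eLpNorm (f i) 2 P) l (𝓝 0) ↔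
      Tendsto (fun i => ∫ ω, ‖f i ω‖ ^ 2 ∂P) l (𝓝 0) := by
  have h1 : (fun i => eLpNorm (f i) 2 P) =ᶠ[l]
      fun i => ENNReal.ofReal (√(∫ ω, ‖f i ω‖ ^ 2 ∂P)) := hf.mono fun i hi => eLpNorm_two_eq_ofReal hi
  rw [tendsto_congr' h1]
  have h0 : ∀ i, 0 ≤ ∫ ω, ‖f i ω‖ ^ 2 ∂P := fun i => integral_nonneg fun ω => by positivity
  constructor
  · intro h
    have h2 := ((ENNReal.tendsto_toReal ENNReal.zero_ne_top).comp h).pow 2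
    simp only [Function.comp_def, ENNReal.toReal_ofReal (Real.sqrt_nonneg _), Real.sq_sqrt (h0 _),
      ENNReal.toReal_zero] at h2
    simpa using h2
  · intro h
    have h2 := ENNReal.tendsto_ofReal ((Real.continuous_sqrt.tendsto 0).comp h)
    simpa using h2

end L2

variable {Ω : Type*} [mΩ : MeasurableSpace Ω] {P : Measure Ω} {d : ℕ} [NeZero d] {T : ℝ}
  {X : Time T → Ω → EuclideanSpace ℝ (Fin d)} {hX : IsGaussianDriver P X}

/-! ### The divergence of smooth functionals -/

variable (hX) in
/-- The continuous linear map `g ↦ g ⊗ k`. -/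
def tmulRight (k : H1 hX) : H1 hX →L[ℝ] H1Tensor hX := ⟨(tmulH hX).flip k, continuous_tmulH_left hX k⟩

namespace SmoothFunctionalH

theorem deriv_eq (S : SmoothFunctionalH hX) (ω : Ω) :
    S.deriv ω = ∑ j, tmulH hX ((S.F j).deriv ω) (S.k j) := by
  unfold deriv
  exact map_sum (UniformSpace.Completion.toComplL (𝕜 := ℝ) (E := H1 hX ⊗[ℝ] H1 hX)) _ _

/-- The divergence `∑ (F_j I(k_j) - ⟨DF_j, k_j⟩)`. -/
def div (S : SmoothFunctionalH hX) (ω : Ω) : ℝ :=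
  ∑ j, ((S.F j).val ω * wiener hX (S.k j) ω - ⟪(S.F j).deriv ω, S.k j⟫)

theorem exists_of_fintype {ι : Type*} [Fintype ι] (F : ι → SmoothFunctional hX) (k : ι → H1 hX) :
    ∃ S : SmoothFunctionalH hX, (∀ ω, S.val ω = ∑ j, (F j).val ω • k j) ∧
      (∀ ω, S.deriv ω = ∑ j, tmulH hX ((F j).deriv ω) (k j)) ∧
      ∀ ω, S.div ω = ∑ j, ((F j).val ω * wiener hX (k j) ω - ⟪(F j).deriv ω, k j⟫) := by
  let e := (Fintype.equivFin ι).symm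
  refine ⟨⟨Fintype.card ι, fun j => F (e j), fun j => k (e j)⟩, fun ω => ?_, fun ω => ?_,
    fun ω => ?_⟩
  · exact e.sum_comp fun j => (F j).val ω • k j
  · rw [deriv_eq]
    exact e.sum_comp fun j => tmulH hX ((F j).deriv ω) (k j)
  · exact e.sum_comp fun j => (F j).val ω * wiener hX (k j) ω - ⟪(F j).deriv ω, k j⟫

theorem wiener_neg_ae (k : H1 hX) : wiener hX (-k) =ᵐ[P] fun ω => -wiener hX k ω := by
  rw [map_neg]; exact Lp.coeFn_neg _

/-- The divergences agree only almost everywhere, because $I$ is linear only up to null sets. -/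
theorem exists_sub (S S' : SmoothFunctionalH hX) : ∃ D : SmoothFunctionalH hX,
    (∀ ω, D.val ω = S.val ω - S'.val ω) ∧ (∀ ω, D.deriv ω = S.deriv ω - S'.deriv ω) ∧
      ∀ᵐ ω ∂P, D.div ω = S.div ω - S'.div ω := by
  obtain ⟨D, h1, h2, h3⟩ := exists_of_fintype (Sum.elim S.F S'.F)
    (Sum.elim S.k fun j => -S'.k j)
  refine ⟨D, fun ω => ?_, fun ω => ?_, ?_⟩
  · rw [h1, Fintype.sum_sum_type]
    simp [val, sub_eq_add_neg]
  · rw [h2, Fintype.sum_sum_type, deriv_eq, deriv_eq]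
    simp [sub_eq_add_neg]
  · filter_upwards [ae_all_iff.2 fun j => wiener_neg_ae (S'.k j)] with ω hω
    rw [h3, Fintype.sum_sum_type]
    simp only [div, Sum.elim_inl, Sum.elim_inr, hω, inner_neg_right]
    rw [sub_eq_add_neg, ← Finset.sum_neg_distrib]
    congr 1
    exact Finset.sum_congr rfl fun j _ => by ring

variable [IsProbabilityMeasure P]

theorem memLp_val (S : SmoothFunctionalH hX) : MemLp S.val 2 P :=
  memLp_finsetSum _ fun j _ => (((1 : ℝ →L[ℝ] ℝ).smulRight (S.k j)).comp_memLp'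
    ((S.F j).isCyl.memLp ENNReal.ofNat_ne_top))

theorem memLp_deriv (S : SmoothFunctionalH hX) : MemLp S.deriv 2 P := by
  rw [funext S.deriv_eq]
  exact memLp_finsetSum _ fun j _ => ((tmulRight hX (S.k j)).comp_memLp'
    ((S.F j).isCyl.memLp_deriv ENNReal.ofNat_ne_top))

theorem memLp_div (S : SmoothFunctionalH hX) : MemLp S.div 2 P := by
  refine memLp_finsetSum _ fun j _ => ?_
  obtain ⟨D2, h2, -⟩ := (S.F j).isCyl.exists_second_deriv
  exact (((S.F j).isCyl.mul (IsCyl.wiener hX (S.k j))).sub (h2 (S.k j))).memLp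
    ENNReal.ofNat_ne_top

theorem memLp_swap_deriv (S : SmoothFunctionalH hX) : MemLp (fun ω => swapH hX (S.deriv ω)) 2 P :=
  (swapH hX).comp_memLp' S.memLp_deriv

/-- The duality between the divergence and the derivative. -/
theorem integral_inner_deriv (S : SmoothFunctionalH hX) (F : SmoothFunctional hX) :
    ∫ ω, ⟪F.deriv ω, S.val ω⟫ ∂P = ∫ ω, F.val ω * S.div ω ∂P := by
  have hF := F.isCyl
  have i1 : Integrable (fun ω => ⟪F.deriv ω, S.val ω⟫) P :=
    integrable_inner_of_memLp (hF.memLp_deriv ENNReal.ofNat_ne_top) S.memLp_val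
  have i2 : Integrable (fun ω => F.val ω * S.div ω) P :=
    (hF.memLp (q := 2) ENNReal.ofNat_ne_top).integrable_mul S.memLp_div
  have h := fun j => (hF.mul (S.F j).isCyl).integral_div (S.k j)
  have h3 := integral_finsetSum (μ := P) Finset.univ fun j _ =>
    (hF.mul (S.F j).isCyl).integrable_div (S.k j)
  simp only [h, Finset.sum_const_zero] at h3
  rw [eq_comm, ← sub_eq_zero, ← integral_sub i2 i1, ← h3]
  refine integral_congr_ae (Eventually.of_forall fun ω => ?_)
  simp only [div, val, Finset.mul_sum, inner_sum, ← Finset.sum_sub_distrib,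
    real_inner_smul_right, inner_add_left, real_inner_smul_left]
  exact Finset.sum_congr rfl fun j _ => by ring

/-- The Skorohod isometry for smooth integrands. -/
theorem integral_div_sq (S : SmoothFunctionalH hX) :
    ∫ ω, S.div ω ^ 2 ∂P =
      ∫ ω, ‖S.val ω‖ ^ 2 ∂P + ∫ ω, ⟪S.deriv ω, swapH hX (S.deriv ω)⟫ ∂P := by
  have i1 : Integrable (fun ω => ‖S.val ω‖ ^ 2) P := by
    simpa only [real_inner_self_eq_norm_sq] using integrable_inner_of_memLp S.memLp_val S.memLp_val
  rw [← integral_add i1 (integrable_inner_of_memLp S.memLp_deriv S.memLp_swap_deriv)]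
  have h := fun i j => (S.F i).isCyl.integral_div_mul_div (S.F j).isCyl (S.k i) (S.k j)
  have e1 : ∀ ω, S.div ω ^ 2 = ∑ i, ∑ j,
      ((S.F i).val ω * wiener hX (S.k i) ω - ⟪(S.F i).deriv ω, S.k i⟫) *
      ((S.F j).val ω * wiener hX (S.k j) ω - ⟪(S.F j).deriv ω, S.k j⟫) := fun ω => by
    rw [sq, div, Finset.sum_mul_sum]
  have e2 : ∀ ω, ‖S.val ω‖ ^ 2 + ⟪S.deriv ω, swapH hX (S.deriv ω)⟫ = ∑ i, ∑ j,
      ((S.F i).val ω * (S.F j).val ω * ⟪S.k i, S.k j⟫ +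
        ⟪(S.F i).deriv ω, S.k j⟫ * ⟪(S.F j).deriv ω, S.k i⟫) := fun ω => by
    rw [← real_inner_self_eq_norm_sq, deriv_eq, map_sum, val, sum_inner, sum_inner,
      ← Finset.sum_add_distrib]
    refine Finset.sum_congr rfl fun i _ => ?_
    rw [inner_sum, inner_sum, ← Finset.sum_add_distrib]
    refine Finset.sum_congr rfl fun j _ => ?_
    rw [swapH_tmulH, inner_tmulH, real_inner_smul_left, real_inner_smul_right,
      real_inner_comm ((S.F j).deriv ω) (S.k i)]
    ring
  simp only [e1, e2]
  rw [integral_finsetSum _ fun i _ => integrable_finsetSum _ fun j _ => (h i j).1,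
    integral_finsetSum _ fun i _ => integrable_finsetSum _ fun j _ => (h i j).2.1]
  refine Finset.sum_congr rfl fun i _ => ?_
  rw [integral_finsetSum _ fun j _ => (h i j).1, integral_finsetSum _ fun j _ => (h i j).2.1]
  exact Finset.sum_congr rfl fun j _ => (h i j).2.2

end SmoothFunctionalH

variable [IsProbabilityMeasure P]

/-- The isometry for the difference, with the exchange of factors norm-preserving, gives
$\|\delta\|^2\le\|U\|^2+\|DU\|^2$. The divergence is therefore continuous for the norm of $\mathbb
D^{1,2}(\mathcal H_1^d)$ and extends to the closure. -/
theorem norm_toLp_div_sub_le (S S' : SmoothFunctionalH hX) :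
    ‖S.memLp_div.toLp S.div - S'.memLp_div.toLp S'.div‖ ≤
      ‖S.memLp_val.toLp S.val - S'.memLp_val.toLp S'.val‖ +
      ‖S.memLp_deriv.toLp S.deriv - S'.memLp_deriv.toLp S'.deriv‖ := by
  obtain ⟨D, h1, h2, h3⟩ := S.exists_sub S'
  have e1 : S.memLp_div.toLp S.div - S'.memLp_div.toLp S'.div = D.memLp_div.toLp D.div := by
    rw [← MemLp.toLp_sub]
    exact MemLp.toLp_congr _ _ (h3.mono fun ω hω => hω.symm)
  have e2 : S.memLp_val.toLp S.val - S'.memLp_val.toLp S'.val = D.memLp_val.toLp D.val := by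
    rw [← MemLp.toLp_sub]
    exact MemLp.toLp_congr _ _ (Eventually.of_forall fun ω => (h1 ω).symm)
  have e3 : S.memLp_deriv.toLp S.deriv - S'.memLp_deriv.toLp S'.deriv =
      D.memLp_deriv.toLp D.deriv := by
    rw [← MemLp.toLp_sub]
    exact MemLp.toLp_congr _ _ (Eventually.of_forall fun ω => (h2 ω).symm)
  rw [e1, e2, e3]
  refine abs_le_of_sq_le_sq' ?_ (by positivity) |>.2
  rw [← integral_norm_sq_eq]
  simp only [Real.norm_eq_abs, sq_abs]
  have h4 : ∫ ω, ⟪D.deriv ω, swapH hX (D.deriv ω)⟫ ∂P ≤ ‖D.memLp_deriv.toLp D.deriv‖ ^ 2 := by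
    rw [← integral_norm_sq_eq]
    refine integral_mono (integrable_inner_of_memLp D.memLp_deriv D.memLp_swap_deriv) ?_
      fun ω => ?_
    · simpa only [real_inner_self_eq_norm_sq] using
        integrable_inner_of_memLp D.memLp_deriv D.memLp_deriv
    · refine (real_inner_le_norm _ _).trans ?_
      rw [norm_swapH, sq]
  rw [D.integral_div_sq, integral_norm_sq_eq D.memLp_val]
  nlinarith [norm_nonneg (D.memLp_val.toLp D.val), norm_nonneg (D.memLp_deriv.toLp D.deriv)]

/-- Elements of `𝔻^{1,2}(H_1^d)` lie in the domain of the divergence, and satisfy the Skorohod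
isometry. -/
theorem IsMalliavinDerivH.exists_skorohod {U : Ω → H1 hX} {G : Ω → H1Tensor hX}
    (h : IsMalliavinDerivH hX U G) : ∃ Z : Ω → ℝ, IsSkorohodIntegral hX U Z ∧
      ∫ ω, Z ω ^ 2 ∂P = ∫ ω, ‖U ω‖ ^ 2 ∂P + ∫ ω, ⟪G ω, swapH hX (G ω)⟫ ∂P := by
  obtain ⟨hU, hG, S, hSU, hSG⟩ := h
  have hu := tendsto_toLp_of_tendsto_eLpNorm (fun n => (S n).memLp_val) hU hSU
  have hg := tendsto_toLp_of_tendsto_eLpNorm (fun n => (S n).memLp_deriv) hG hSG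
  have hz : CauchySeq fun n => (S n).memLp_div.toLp (S n).div := by
    have hu' := cauchySeq_iff_tendsto_dist_atTop_0.1 hu.cauchySeq
    have hg' := cauchySeq_iff_tendsto_dist_atTop_0.1 hg.cauchySeq
    rw [cauchySeq_iff_tendsto_dist_atTop_0]
    have hs := hu'.add hg'
    rw [add_zero] at hs
    refine squeeze_zero (fun _ => dist_nonneg) (fun n => ?_) hs
    simp only [dist_eq_norm]
    exact norm_toLp_div_sub_le _ _
  obtain ⟨z, hz⟩ := cauchySeq_tendsto_of_complete hz
  have hzm : MemLp z 2 P := Lp.memLp z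
  have hz' : Tendsto (fun n => eLpNorm (fun ω => (S n).div ω - z ω) 2 P) atTop (𝓝 0) := by
    refine (Lp.tendsto_Lp_iff_tendsto_eLpNorm'' _ (fun n => (S n).memLp_div) _ hzm).1 ?_
    rwa [Lp.toLp_coeFn]
  refine ⟨z, ⟨hU, hzm, fun F => ?_⟩, ?_⟩
  · have hF1 : MemLp F.deriv 2 P := F.isCyl.memLp_deriv ENNReal.ofNat_ne_top
    have hF2 : MemLp F.val 2 P := F.isCyl.memLp ENNReal.ofNat_ne_top
    have t1 := tendsto_integral_inner_const (fun n => (S n).memLp_val) hU hSU hF1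
    have t2 := tendsto_integral_inner_const (fun n => (S n).memLp_div) hzm hz' hF2
    simp only [RCLike.inner_apply, conj_trivial] at t2
    have e' : ∫ ω, ⟪F.deriv ω, U ω⟫ ∂P = ∫ ω, ⟪U ω, F.deriv ω⟫ ∂P := by
      simp only [real_inner_comm]
    rw [e']
    refine tendsto_nhds_unique t1 (t2.congr fun n => ?_)
    simp only [real_inner_comm (F.deriv _)]
    exact ((S n).integral_inner_deriv F).symm
  · have t1 := tendsto_integral_inner (fun n => (S n).memLp_div) hzm hz'
      (fun n => (S n).memLp_div) hzm hz'
    have t2 := tendsto_integral_inner (fun n => (S n).memLp_val) hU hSU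
      (fun n => (S n).memLp_val) hU hSU
    have t3 := tendsto_integral_inner (fun n => (S n).memLp_deriv) hG hSG
      (fun n => (S n).memLp_swap_deriv) ((swapH hX).comp_memLp' hG) (by
        refine hSG.congr fun n => ?_
        refine eLpNorm_congr_norm_ae (Eventually.of_forall fun ω => ?_)
        rw [Function.comp_apply, ← map_sub, norm_swapH])
    simp only [real_inner_self_eq_norm_sq] at t1 t2
    simp only [Real.norm_eq_abs, sq_abs] at t1
    exact tendsto_nhds_unique t1 ((t2.add t3).congr fun n => ((S n).integral_div_sq).symm)

end YoungMalliavin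

namespace YoungMalliavin

variable {Ω : Type*} [mΩ : MeasurableSpace Ω] {P : Measure Ω} {d : ℕ} [NeZero d] {T : ℝ}
  {X : Time T → Ω → EuclideanSpace ℝ (Fin d)} {hX : IsGaussianDriver P X}

/-! ### Closure properties of `𝔻^{1,2}(H_1^d)` -/

section Approx

variable {E : Type*} [NormedAddCommGroup E] {ι : Type*} {l : Filter ι}

omit [NeZero d] in
theorem tendsto_eLpNorm_sub_add {f g f' g' : ι → Ω → E}
    (hf : ∀ n, AEStronglyMeasurable (fun ω => f n ω - g n ω) P)
    (hf' : ∀ n, AEStronglyMeasurable (fun ω => f' n ω - g' n ω) P)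
    (h : Tendsto (fun n => eLpNorm (fun ω => f n ω - g n ω) 2 P) l (𝓝 0))
    (h' : Tendsto (fun n => eLpNorm (fun ω => f' n ω - g' n ω) 2 P) l (𝓝 0)) :
    Tendsto (fun n => eLpNorm (fun ω => f n ω + f' n ω - (g n ω + g' n ω)) 2 P) l (𝓝 0) := by
  have hs := h.add h'
  rw [add_zero] at hs
  refine tendsto_of_tendsto_of_tendsto_of_le_of_le tendsto_const_nhds hs (fun _ => zero_le)
    fun n => ?_
  have e : (fun ω => f n ω + f' n ω - (g n ω + g' n ω)) =
      (fun ω => f n ω - g n ω) + fun ω => f' n ω - g' n ω := by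
    funext ω; simp only [Pi.add_apply]; abel
  rw [e]
  exact eLpNorm_add_le (hf n) (hf' n) one_le_two

theorem tendsto_eLpNorm_sub_sub {f g f' g' : ι → Ω → E}
    (hf : ∀ n, AEStronglyMeasurable (fun ω => f n ω - g n ω) P)
    (hf' : ∀ n, AEStronglyMeasurable (fun ω => f' n ω - g' n ω) P)
    (h : Tendsto (fun n => eLpNorm (fun ω => f n ω - g n ω) 2 P) l (𝓝 0))
    (h' : Tendsto (fun n => eLpNorm (fun ω => f' n ω - g' n ω) 2 P) l (𝓝 0)) :
    Tendsto (fun n => eLpNorm (fun ω => f n ω - f' n ω - (g n ω - g' n ω)) 2 P) l (𝓝 0) := by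
  have hs := h.add h'
  rw [add_zero] at hs
  refine tendsto_of_tendsto_of_tendsto_of_le_of_le tendsto_const_nhds hs (fun _ => zero_le)
    fun n => ?_
  have e : (fun ω => f n ω - f' n ω - (g n ω - g' n ω)) =
      (fun ω => f n ω - g n ω) - fun ω => f' n ω - g' n ω := by
    funext ω; simp only [Pi.sub_apply]; abel
  rw [e]
  exact eLpNorm_sub_le (hf n) (hf' n) one_le_two

theorem tendsto_eLpNorm_sum {κ : Type*} [Fintype κ] {F : Type*} [NormedAddCommGroup F]
    [NormedSpace ℝ E] [NormedSpace ℝ F] (L : κ → E →L[ℝ] F) {f : κ → ι → Ω → E} {g : κ → Ω → E}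
    (hf : ∀ j n, AEStronglyMeasurable (fun ω => f j n ω - g j ω) P)
    (h : ∀ j, Tendsto (fun n => eLpNorm (fun ω => f j n ω - g j ω) 2 P) l (𝓝 0)) :
    Tendsto (fun n => eLpNorm (fun ω => ∑ j, L j (f j n ω) - ∑ j, L j (g j ω)) 2 P) l (𝓝 0) := by
  have hs : Tendsto (fun n => ∑ j, ENNReal.ofReal ‖L j‖ * eLpNorm (fun ω => f j n ω - g j ω) 2 P)
      l (𝓝 0) := by
    have := tendsto_finsetSum Finset.univ fun j _ =>
      ENNReal.Tendsto.const_mul (a := ENNReal.ofReal ‖L j‖) (h j) (Or.inr ENNReal.ofReal_ne_top)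
    simpa using this
  refine tendsto_of_tendsto_of_tendsto_of_le_of_le tendsto_const_nhds hs (fun _ => zero_le)
    fun n => ?_
  have e : (fun ω => ∑ j, L j (f j n ω) - ∑ j, L j (g j ω)) =
      ∑ j, fun ω => L j (f j n ω - g j ω) := by
    funext ω
    simp only [Finset.sum_apply, map_sub, Finset.sum_sub_distrib]
  rw [e]
  refine (eLpNorm_sum_le (fun j _ => (L j).continuous.comp_aestronglyMeasurable (hf j n))
    one_le_two).trans (Finset.sum_le_sum fun j _ => ?_)
  exact eLpNorm_le_mul_eLpNorm_of_ae_le_mul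
    (Eventually.of_forall fun ω => (L j).le_opNorm _) 2

end Approx

variable [IsProbabilityMeasure P]

omit [IsProbabilityMeasure P] in
theorem IsMalliavinDerivH.congr {U U' : Ω → H1 hX} {G G' : Ω → H1Tensor hX}
    (h : IsMalliavinDerivH hX U G) (hU : U =ᵐ[P] U') (hG : G =ᵐ[P] G') :
    IsMalliavinDerivH hX U' G' := by
  obtain ⟨h1, h2, S, h3, h4⟩ := h
  refine ⟨h1.ae_eq hU, h2.ae_eq hG, S, h3.congr fun n => eLpNorm_congr_ae ?_,
    h4.congr fun n => eLpNorm_congr_ae ?_⟩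
  · filter_upwards [hU] with ω hω; rw [hω]
  · filter_upwards [hG] with ω hω; rw [hω]

theorem IsMalliavinDerivH.sub {U U' : Ω → H1 hX} {G G' : Ω → H1Tensor hX}
    (h : IsMalliavinDerivH hX U G) (h' : IsMalliavinDerivH hX U' G') :
    IsMalliavinDerivH hX (fun ω => U ω - U' ω) (fun ω => G ω - G' ω) := by
  obtain ⟨h1, h2, S, h3, h4⟩ := h
  obtain ⟨h1', h2', S', h3', h4'⟩ := h'
  choose D hD1 hD2 _ using fun n => (S n).exists_sub (S' n)
  refine ⟨h1.sub h1', h2.sub h2', D, ?_, ?_⟩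
  · simp only [hD1]
    exact tendsto_eLpNorm_sub_sub (fun n => ((S n).memLp_val.sub h1).1)
      (fun n => ((S' n).memLp_val.sub h1').1) h3 h3'
  · simp only [hD2]
    exact tendsto_eLpNorm_sub_sub (fun n => ((S n).memLp_deriv.sub h2).1)
      (fun n => ((S' n).memLp_deriv.sub h2').1) h4 h4'

/-- The graph of the derivative is closed: choose for the $n$-th pair a smooth functional within
$1/(n+1)$ of it. -/
theorem IsMalliavinDerivH.of_tendsto {U : ℕ → Ω → H1 hX} {G : ℕ → Ω → H1Tensor hX}
    {V : Ω → H1 hX} {W : Ω → H1Tensor hX} (h : ∀ n, IsMalliavinDerivH hX (U n) (G n))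
    (hV : MemLp V 2 P) (hW : MemLp W 2 P)
    (hUV : Tendsto (fun n => eLpNorm (fun ω => U n ω - V ω) 2 P) atTop (𝓝 0))
    (hGW : Tendsto (fun n => eLpNorm (fun ω => G n ω - W ω) 2 P) atTop (𝓝 0)) :
    IsMalliavinDerivH hX V W := by
  have hε : ∀ n : ℕ, (0 : ℝ≥0∞) < ((n : ℝ≥0∞) + 1)⁻¹ := fun n => by simp
  have hex : ∀ n, ∃ S : SmoothFunctionalH hX,
      eLpNorm (fun ω => S.val ω - U n ω) 2 P < ((n : ℝ≥0∞) + 1)⁻¹ ∧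
      eLpNorm (fun ω => S.deriv ω - G n ω) 2 P < ((n : ℝ≥0∞) + 1)⁻¹ := fun n => by
    obtain ⟨-, -, S, h3, h4⟩ := h n
    obtain ⟨m, hm1, hm2⟩ := ((h3.eventually_lt_const (hε n)).and
      (h4.eventually_lt_const (hε n))).exists
    exact ⟨S m, hm1, hm2⟩
  choose S hS1 hS2 using hex
  have hlim : Tendsto (fun n : ℕ => ((n : ℝ≥0∞) + 1)⁻¹) atTop (𝓝 0) := by
    have := ENNReal.tendsto_inv_nat_nhds_zero.comp (tendsto_add_atTop_nat 1)
    simpa [Function.comp_def] using this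
  have key : ∀ {E : Type _} [NormedAddCommGroup E] {f g : ℕ → Ω → E} {w : Ω → E},
      (∀ n, AEStronglyMeasurable (f n) P) → (∀ n, AEStronglyMeasurable (g n) P) →
      AEStronglyMeasurable w P →
      (∀ n, eLpNorm (fun ω => f n ω - g n ω) 2 P < ((n : ℝ≥0∞) + 1)⁻¹) →
      Tendsto (fun n => eLpNorm (fun ω => g n ω - w ω) 2 P) atTop (𝓝 0) →
      Tendsto (fun n => eLpNorm (fun ω => f n ω - w ω) 2 P) atTop (𝓝 0) := by
    intro E _ f g w hf hg hw hfg hgw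
    have h1 : Tendsto (fun n => eLpNorm (fun ω => f n ω - g n ω) 2 P) atTop (𝓝 0) :=
      tendsto_of_tendsto_of_tendsto_of_le_of_le tendsto_const_nhds hlim (fun _ => zero_le)
        fun n => (hfg n).le
    have h2 := tendsto_eLpNorm_sub_add (fun n => (hf n).sub (hg n)) (fun n => (hg n).sub hw) h1 hgw
    refine h2.congr fun n => ?_
    congr 1
    funext ω
    abel
  exact ⟨hV, hW, S, key (fun n => (S n).memLp_val.1) (fun n => (h n).1.1) hV.1 hS1 hUV,
    key (fun n => (S n).memLp_deriv.1) (fun n => (h n).2.1.1) hW.1 hS2 hGW⟩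

theorem isMalliavinDerivH_sum {κ : Type*} [Fintype κ] {F : κ → Ω → ℝ} {DF : κ → Ω → H1 hX}
    (h : ∀ j, IsMalliavinDeriv hX (F j) (DF j)) (k : κ → H1 hX) :
    IsMalliavinDerivH hX (fun ω => ∑ j, F j ω • k j) (fun ω => ∑ j, tmulH hX (DF j ω) (k j)) := by
  choose h1 h2 S h3 h4 using h
  choose D hD1 hD2 _ using fun n => SmoothFunctionalH.exists_of_fintype (fun j => S j n) k
  refine ⟨memLp_finsetSum _ fun j _ => ((1 : ℝ →L[ℝ] ℝ).smulRight (k j)).comp_memLp' (h1 j),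
    memLp_finsetSum _ fun j _ => (tmulRight hX (k j)).comp_memLp' (h2 j), D, ?_, ?_⟩
  · simp only [hD1]
    exact tendsto_eLpNorm_sum (fun j => (1 : ℝ →L[ℝ] ℝ).smulRight (k j))
      (fun j n => (((S j n).isCyl.memLp (q := 2) ENNReal.ofNat_ne_top).sub (h1 j)).1) h3
  · simp only [hD2]
    exact tendsto_eLpNorm_sum (fun j => tmulRight hX (k j))
      (fun j n => (((S j n).isCyl.memLp_deriv (q := 2) ENNReal.ofNat_ne_top).sub (h2 j)).1) h4

theorem isMalliavinDerivH_stepH {Y : Ω → Time T → EuclideanSpace ℝ (Fin d)}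
    {Z : Ω → Fin d → Time T → H1 hX}
    (h : ∀ t i, IsMalliavinDeriv hX (fun ω => Y ω t i) (fun ω => Z ω i t)) (π : TimePartition T) :
    IsMalliavinDerivH hX (fun ω => stepH hX π (Y ω)) (fun ω => tensorSum hX (Z ω) π) := by
  have := isMalliavinDerivH_sum (κ := Fin π.n × Fin d) (fun j => h (π.pt j.1) j.2)
    fun j => ind hX (π.pt (j.1 + 1)) j.2 - ind hX (π.pt j.1) j.2
  have e1 : (fun ω => stepH hX π (Y ω)) = fun ω => ∑ j : Fin π.n × Fin d, Y ω (π.pt j.1) j.2 •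
      (ind hX (π.pt (j.1 + 1)) j.2 - ind hX (π.pt j.1) j.2) := by
    funext ω
    rw [stepH, Finset.sum_range, Fintype.sum_prod_type]
  have e2 : (fun ω => tensorSum hX (Z ω) π) = fun ω => ∑ j : Fin π.n × Fin d,
      tmulH hX (Z ω j.2 (π.pt j.1)) (ind hX (π.pt (j.1 + 1)) j.2 - ind hX (π.pt j.1) j.2) := by
    funext ω
    rw [tensorSum, Fintype.sum_prod_type_right]
    refine Finset.sum_congr rfl fun i _ => ?_
    rw [stepSum, Finset.sum_range]
  rw [e1, e2]
  exact this

end YoungMalliavin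

namespace YoungMalliavin

variable {Ω : Type*} [mΩ : MeasurableSpace Ω] {P : Measure Ω} {d : ℕ} [NeZero d] {T : ℝ}
  {X : Time T → Ω → EuclideanSpace ℝ (Fin d)} {hX : IsGaussianDriver P X}

/-! ### Smooth functionals separate integrable random variables -/

theorem exists_bound_iteratedFDeriv_comp_eval {f : ℝ → ℝ} (hf : ContDiff ℝ (⊤ : ℕ∞) f) {C : ℝ}
    (hC : ∀ n x, |iteratedDeriv n f x| ≤ C) (n : ℕ) : ∃ C' : ℝ, ∀ x : Fin 1 → ℝ,
      ‖iteratedFDeriv ℝ n (fun x : Fin 1 → ℝ => f (x 0)) x‖ ≤ C' := by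
  let L : (Fin 1 → ℝ) →L[ℝ] ℝ := ContinuousLinearMap.proj (R := ℝ) (φ := fun _ : Fin 1 => ℝ) 0
  refine ⟨C * ∏ _i : Fin n, ‖L‖, fun x => ?_⟩
  have h := L.iteratedFDeriv_comp_right hf x (i := n) (by exact_mod_cast le_top)
  have h' : iteratedFDeriv ℝ n (fun x : Fin 1 → ℝ => f (x 0)) x =
      (iteratedFDeriv ℝ n f (L x)).compContinuousLinearMap fun _ => L := h
  rw [h']
  refine (ContinuousMultilinearMap.norm_compContinuousLinearMap_le _ _).trans ?_
  refine mul_le_mul_of_nonneg_right ?_ (Finset.prod_nonneg fun _ _ => norm_nonneg _)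
  rw [norm_iteratedFDeriv_eq_norm_iteratedDeriv]
  exact hC n _

variable (hX) in
/-- The functional `f(I(h))` for `f` with uniformly bounded derivatives. -/
def SmoothFunctional.ofReal {f : ℝ → ℝ} (hf : ContDiff ℝ (⊤ : ℕ∞) f) {C : ℝ}
    (hC : ∀ n x, |iteratedDeriv n f x| ≤ C) (h : H1 hX) : SmoothFunctional hX where
  n := 1
  h := fun _ => h
  f := fun x => f (x 0)
  smooth := hf.comp (ContinuousLinearMap.proj (R := ℝ) (φ := fun _ : Fin 1 => ℝ) 0).contDiff
  bounded := exists_bound_iteratedFDeriv_comp_eval hf hC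

omit [NeZero d] in
theorem measurable_driver (hX : IsGaussianDriver P X) (t : Time T) : Measurable (X t) := by
  have h : MeasurableSpace.comap (X t) inferInstance ≤ mΩ := by
    conv_rhs => rw [hX.generated]
    exact le_iSup (fun t => MeasurableSpace.comap (X t) inferInstance) t
  exact measurable_iff_comap_le.2 h

omit [NeZero d] in
theorem exists_preimage_of_measurableSet (hX : IsGaussianDriver P X) {A : Set Ω}
    (hA : MeasurableSet A) : ∃ B : Set (Time T → EuclideanSpace ℝ (Fin d)), MeasurableSet B ∧
      (fun ω t => X t ω) ⁻¹' B = A := by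
  have h : mΩ = MeasurableSpace.comap (fun ω t => X t ω) MeasurableSpace.pi := by
    conv_lhs => rw [hX.generated]
    simp only [MeasurableSpace.pi, MeasurableSpace.comap_iSup, MeasurableSpace.comap_comp]
    rfl
  rw [h] at hA
  exact hA

variable [IsProbabilityMeasure P]

omit [IsProbabilityMeasure P] in
theorem exists_wiener_eq_strongDual (J : Finset (Time T))
    (L : StrongDual ℝ (J → EuclideanSpace ℝ (Fin d))) :
    ∃ h : H1 hX, ∀ᵐ ω ∂P, L (J.restrict fun t => X t ω) = wiener hX h ω := by
  classical
  refine ⟨∑ z : J × Fin d, L (Pi.single z.1 (EuclideanSpace.single z.2 1)) • ind hX z.1 z.2, ?_⟩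
  filter_upwards [wiener_sum_ae hX Finset.univ
      (fun z : J × Fin d => L (Pi.single z.1 (EuclideanSpace.single z.2 1)))
      fun z => ind hX z.1 z.2,
    ae_all_iff.2 fun z : J × Fin d => wiener_ind hX z.1 z.2] with ω h1 h2
  rw [h1]
  simp only [h2]
  have e : (J.restrict fun t => X t ω) = ∑ z : J × Fin d, X z.1 ω z.2 •
      (Pi.single z.1 (EuclideanSpace.single z.2 1) : J → EuclideanSpace ℝ (Fin d)) := by
    funext t
    ext u
    rw [Finset.sum_apply, WithLp.ofLp_sum, Finset.sum_apply, Finset.sum_eq_single (t, u)]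
    · simp
    · intro z _ hz
      by_cases h : z.1 = t
      · have : z.2 ≠ u := fun h' => hz (Prod.ext h h')
        subst h
        simp [this.symm]
      · simp [Ne.symm h]
    · simp
  rw [e, map_sum]
  exact Finset.sum_congr rfl fun z _ => by rw [map_smul, smul_eq_mul, mul_comm]

-- Testing with $\cos I(k)$ and $\sin I(k)$ gives $E[e^{iI(k)}\psi]=0$. The finite measures
-- $\psi^+P$ and $\psi^-P$ then have the same characteristic functions on all finite-dimensional
-- marginals of $X$, hence give the same law to $X$. They agree on every event because $X$ generates
-- the $\sigma$-algebra.
omit [IsProbabilityMeasure P] in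
theorem ae_eq_zero_of_integral_mul_smooth {ψ : Ω → ℝ} (hψ : Integrable ψ P)
    (h : ∀ F : SmoothFunctional hX, ∫ ω, F.val ω * ψ ω ∂P = 0) : ψ =ᵐ[P] 0 := by
  have hexp : ∀ k : H1 hX, ∫ ω, Complex.exp (wiener hX k ω * Complex.I) * ψ ω ∂P = 0 := by
    intro k
    have hcos := h (.ofReal hX Real.contDiff_cos Real.abs_iteratedDeriv_cos_le_one k)
    have hsin := h (.ofReal hX Real.contDiff_sin Real.abs_iteratedDeriv_sin_le_one k)
    have hc : ∫ ω, Real.cos (wiener hX k ω) * ψ ω ∂P = 0 := hcos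
    have hs : ∫ ω, Real.sin (wiener hX k ω) * ψ ω ∂P = 0 := hsin
    have hkm : AEStronglyMeasurable (wiener hX k) P := (memLp_wiener hX k).1
    have ic : Integrable (fun ω => Real.cos (wiener hX k ω) * ψ ω) P :=
      hψ.bdd_mul (Real.continuous_cos.comp_aestronglyMeasurable hkm)
        (Eventually.of_forall fun ω => Real.abs_cos_le_one _)
    have is : Integrable (fun ω => Real.sin (wiener hX k ω) * ψ ω) P :=
      hψ.bdd_mul (Real.continuous_sin.comp_aestronglyMeasurable hkm)
        (Eventually.of_forall fun ω => Real.abs_sin_le_one _)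
    have e : ∀ ω, Complex.exp (wiener hX k ω * Complex.I) * ψ ω =
        ((Real.cos (wiener hX k ω) * ψ ω : ℝ) : ℂ) +
          ((Real.sin (wiener hX k ω) * ψ ω : ℝ) : ℂ) * Complex.I := fun ω => by
      rw [Complex.exp_mul_I]
      push_cast
      ring
    simp only [e]
    have hc' : ∫ ω, ((Real.cos (wiener hX k ω) * ψ ω : ℝ) : ℂ) ∂P = 0 :=
      (integral_ofReal (𝕜 := ℂ)).trans
        ((congrArg Complex.ofReal hc).trans Complex.ofReal_zero)
    have hs' : ∫ ω, ((Real.sin (wiener hX k ω) * ψ ω : ℝ) : ℂ) ∂P = 0 :=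
      (integral_ofReal (𝕜 := ℂ)).trans
        ((congrArg Complex.ofReal hs).trans Complex.ofReal_zero)
    rw [integral_add ic.ofReal (is.ofReal.mul_const _), integral_mul_const, hc', hs', zero_mul,
      add_zero]
  set μ : Measure Ω := P.withDensity fun ω => ENNReal.ofReal (ψ ω) with hμ
  set ν : Measure Ω := P.withDensity fun ω => ENNReal.ofReal (-ψ ω) with hν
  have : IsFiniteMeasure μ := isFiniteMeasure_withDensity_ofReal hψ.2
  have : IsFiniteMeasure ν := isFiniteMeasure_withDensity_ofReal hψ.neg.2
  have hm : ∀ t, Measurable (X t) := measurable_driver hX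
  have hΦ : Measurable fun ω t => X t ω := measurable_pi_lambda _ hm
  have hint : ∀ {g : Ω → ℂ} (φ : Ω → ℝ), Integrable φ P → 
      ∫ ω, g ω ∂(P.withDensity fun ω => ENNReal.ofReal (φ ω)) = ∫ ω, g ω * (max (φ ω) 0 : ℝ) ∂P := by
    intro g φ hφ
    rw [integral_withDensity_eq_integral_toReal_smul₀ hφ.aemeasurable.ennreal_ofReal
      (Eventually.of_forall fun _ => ENNReal.ofReal_lt_top)]
    refine integral_congr_ae (Eventually.of_forall fun ω => ?_)
    simp only [ENNReal.toReal_ofReal', Complex.real_smul, mul_comm]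
  have hfin : ∀ J : Finset (Time T), (μ.map fun ω t => X t ω).map J.restrict =
      (ν.map fun ω t => X t ω).map J.restrict := fun J => by
    have hr : Measurable (J.restrict : (Time T → EuclideanSpace ℝ (Fin d)) → _) :=
      Finset.measurable_restrict J
    have := (inferInstance : IsFiniteMeasure (μ.map fun ω t => X t ω))
    refine Measure.ext_of_charFunDual (funext fun L => ?_)
    obtain ⟨k, hk⟩ := exists_wiener_eq_strongDual (hX := hX) J L
    have hcont : Continuous fun x => Complex.exp (L x * Complex.I) := by fun_prop
    rw [charFunDual_apply, charFunDual_apply, Measure.map_map hr hΦ, Measure.map_map hr hΦ,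
      integral_map (hr.comp hΦ).aemeasurable hcont.aestronglyMeasurable,
      integral_map (hr.comp hΦ).aemeasurable hcont.aestronglyMeasurable,
      hint ψ hψ, hint (fun ω => -ψ ω) hψ.neg, ← sub_eq_zero, ← hexp k]
    have hbd : ∀ {φ : Ω → ℝ}, Integrable φ P → Integrable (fun ω =>
        Complex.exp (L ((J.restrict ∘ fun ω t => X t ω) ω) * Complex.I) * (max (φ ω) 0 : ℝ)) P :=
      fun {φ} hφ => (hφ.pos_part.ofReal).bdd_mul (c := 1)
        (hcont.measurable.comp (hr.comp hΦ)).aestronglyMeasurable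
        (Eventually.of_forall fun ω => by simp [Complex.norm_exp_ofReal_mul_I])
    have hneg : Integrable (fun ω => -ψ ω) P := hψ.neg
    rw [← integral_sub (hbd hψ) (hbd hneg)]
    refine integral_congr_ae ?_
    filter_upwards [hk] with ω hω
    rw [← hω, ← mul_sub, ← Complex.ofReal_sub]
    congr 2
    rcases le_total 0 (ψ ω) with h0 | h0
    · rw [max_eq_left h0, max_eq_right (by linarith), sub_zero]
    · rw [max_eq_right h0, max_eq_left (by linarith), zero_sub, neg_neg]
  have hmap : (μ.map fun ω t => X t ω) = ν.map fun ω t => X t ω :=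
    IsProjectiveLimit.unique (P := fun J => (μ.map fun ω t => X t ω).map J.restrict)
      (fun _ => rfl) fun J => (hfin J).symm
  refine hψ.ae_eq_zero_of_forall_setIntegral_eq_zero fun A hA _ => ?_
  obtain ⟨B, hB, rfl⟩ := exists_preimage_of_measurableSet hX hA
  have h1 : μ ((fun ω t => X t ω) ⁻¹' B) = ν ((fun ω t => X t ω) ⁻¹' B) := by
    rw [← Measure.map_apply hΦ hB, hmap, Measure.map_apply hΦ hB]
  rw [hμ, hν, withDensity_apply _ hA, withDensity_apply _ hA] at h1
  rw [integral_eq_lintegral_pos_part_sub_lintegral_neg_part hψ.integrableOn, h1, sub_self]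

/-! ### Uniqueness of the divergence and of the derivative -/

theorem IsSkorohodIntegral.ae_unique {U U' : Ω → H1 hX} {Z Z' : Ω → ℝ}
    (h : IsSkorohodIntegral hX U Z) (h' : IsSkorohodIntegral hX U' Z') (hU : U =ᵐ[P] U') :
    Z =ᵐ[P] Z' := by
  have h1 : (fun ω => Z ω - Z' ω) =ᵐ[P] 0 := by
    refine ae_eq_zero_of_integral_mul_smooth (hX := hX)
      ((h.2.1.sub h'.2.1).integrable one_le_two) fun F => ?_
    have hF : MemLp F.val 2 P := F.isCyl.memLp ENNReal.ofNat_ne_top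
    have e : ∫ ω, ⟪F.deriv ω, U ω⟫ ∂P = ∫ ω, ⟪F.deriv ω, U' ω⟫ ∂P :=
      integral_congr_ae (hU.mono fun ω hω => by simp only [hω])
    have i1 : Integrable (fun ω => F.val ω * Z ω) P := hF.integrable_mul h.2.1
    have i2 : Integrable (fun ω => F.val ω * Z' ω) P := hF.integrable_mul h'.2.1
    rw [h.2.2 F, h'.2.2 F, ← sub_eq_zero, ← integral_sub i1 i2] at e
    rw [← e]
    exact integral_congr_ae (Eventually.of_forall fun ω => mul_sub _ _ _)
  filter_upwards [h1] with ω hω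
  exact sub_eq_zero.1 hω

/-- Integration by parts of the products $F\,F_j$ in direction `a`, passed to the limit. The
right-hand side contains no derivative of `U`, so `U` determines the pairings on the left. -/
theorem IsMalliavinDerivH.integral_inner_tmulH {U : Ω → H1 hX} {G : Ω → H1Tensor hX}
    (h : IsMalliavinDerivH hX U G) (F : SmoothFunctional hX) (a b : H1 hX) :
    ∫ ω, ⟪G ω, F.val ω • tmulH hX a b⟫ ∂P =
      ∫ ω, ⟪U ω, (F.val ω * wiener hX a ω - ⟪F.deriv ω, a⟫) • b⟫ ∂P := by
  obtain ⟨hU, hG, S, hSU, hSG⟩ := h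
  have hF : MemLp F.val 2 P := F.isCyl.memLp ENNReal.ofNat_ne_top
  obtain ⟨D2, h2, -⟩ := F.isCyl.exists_second_deriv
  have hD : MemLp (fun ω => F.val ω * wiener hX a ω - ⟪F.deriv ω, a⟫) 2 P :=
    ((F.isCyl.mul (IsCyl.wiener hX a)).sub (h2 a)).memLp ENNReal.ofNat_ne_top
  have m1 : MemLp (fun ω => F.val ω • tmulH hX a b) 2 P :=
    ((1 : ℝ →L[ℝ] ℝ).smulRight (tmulH hX a b)).comp_memLp' hF
  have m2 : MemLp (fun ω => (F.val ω * wiener hX a ω - ⟪F.deriv ω, a⟫) • b) 2 P :=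
    ((1 : ℝ →L[ℝ] ℝ).smulRight b).comp_memLp' hD
  have t1 := tendsto_integral_inner_const (fun n => (S n).memLp_deriv) hG hSG m1
  have t2 := tendsto_integral_inner_const (fun n => (S n).memLp_val) hU hSU m2
  refine tendsto_nhds_unique t1 (t2.congr fun n => ?_)
  have i1 := integrable_inner_of_memLp (S n).memLp_deriv m1
  have i2 := integrable_inner_of_memLp (S n).memLp_val m2
  rw [← sub_eq_zero, ← integral_sub i2 i1]
  have h0 := fun j => (F.isCyl.mul ((S n).F j).isCyl).integral_div a
  have h3 := integral_finsetSum (μ := P) Finset.univ fun j _ =>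
    ((F.isCyl.mul ((S n).F j).isCyl).integrable_div a).mul_const ⟪(S n).k j, b⟫
  simp only [integral_mul_const, h0, zero_mul, Finset.sum_const_zero] at h3
  rw [← h3]
  refine integral_congr_ae (Eventually.of_forall fun ω => ?_)
  simp only [SmoothFunctionalH.deriv_eq, SmoothFunctionalH.val, sum_inner, inner_tmulH,
    real_inner_smul_right, real_inner_smul_left, ← Finset.sum_sub_distrib,
    inner_add_left]
  exact Finset.sum_congr rfl fun j _ => by ring

omit [IsProbabilityMeasure P] in
theorem clm_eq_zero_of_ind (L : H1 hX →L[ℝ] ℝ) (h : ∀ t u, L (ind hX t u) = 0) (a : H1 hX) :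
    L a = 0 := by
  refine UniformSpace.Completion.induction_on a (isClosed_eq L.continuous continuous_const)
    fun b => ?_
  let M : PreH1 hX →ₗ[ℝ] ℝ := L.toLinearMap.comp
    (UniformSpace.Completion.toComplL (𝕜 := ℝ) (E := PreH1 hX)).toLinearMap
  have hM : M = 0 := by
    refine Finsupp.lhom_ext' (M := ℝ) fun x => LinearMap.ext_ring ?_
    exact h x.1 x.2
  exact LinearMap.congr_fun hM b

omit [IsProbabilityMeasure P] in
theorem eq_zero_of_inner_ind (z : H1Tensor hX)
    (h : ∀ t u s v, ⟪z, tmulH hX (ind hX t u) (ind hX s v)⟫ = 0) : z = 0 := by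
  have h1 : ∀ a s v, ⟪z, tmulH hX a (ind hX s v)⟫ = 0 := fun a s v =>
    clm_eq_zero_of_ind ((innerSL ℝ z).comp (tmulRight hX (ind hX s v)))
      (fun t u => h t u s v) a
  have h2 : ∀ a b, ⟪z, tmulH hX a b⟫ = 0 := fun a b =>
    clm_eq_zero_of_ind ((innerSL ℝ z).comp ⟨tmulH hX a, continuous_tmulH hX a⟩)
      (fun s v => h1 a s v) b
  have h3 : ∀ w : H1Tensor hX, ⟪z, w⟫ = 0 := fun w => by
    refine UniformSpace.Completion.induction_on w
      (isClosed_eq (continuous_const.inner continuous_id) continuous_const) fun y => ?_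
    induction y using TensorProduct.induction_on with
    | zero => rw [UniformSpace.Completion.coe_zero, inner_zero_right]
    | tmul a b => exact h2 a b
    | add x y hx hy => rw [UniformSpace.Completion.coe_add, inner_add_right, hx, hy, add_zero]
  exact inner_self_eq_zero.1 (h3 z)

/-- The exceptional null set depends on the elementary tensor, so only times from a countable dense
set are used. Continuity of the generators in time recovers all of them, and these span a dense
subspace. -/
theorem IsMalliavinDerivH.ae_eq_zero (hR : Continuous (Function.uncurry (covFun P X)))
    {G : Ω → H1Tensor hX} (h : IsMalliavinDerivH hX (fun _ => 0) G) : G =ᵐ[P] 0 := by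
  have hab : ∀ a b, ∀ᵐ ω ∂P, ⟪G ω, tmulH hX a b⟫ = 0 := fun a b => by
    refine ae_eq_zero_of_integral_mul_smooth (hX := hX)
      ((integrable_inner_of_memLp h.2.1 (memLp_const _))) fun F => ?_
    have := h.integral_inner_tmulH F a b
    simpa only [inner_zero_left, integral_zero, real_inner_smul_right] using this
  obtain ⟨D, hDc, hD⟩ := TopologicalSpace.exists_countable_dense (Time T)
  have hall : ∀ᵐ ω ∂P, ∀ t ∈ D, ∀ s ∈ D, ∀ u v,
      ⟪G ω, tmulH hX (ind hX t u) (ind hX s v)⟫ = 0 :=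
    (ae_ball_iff hDc).2 fun t _ => (ae_ball_iff hDc).2 fun s _ => ae_all_iff.2 fun u =>
      ae_all_iff.2 fun v => hab _ _
  filter_upwards [hall] with ω hω
  refine eq_zero_of_inner_ind _ fun t u s v => ?_
  have h1 : ∀ t ∈ D, ∀ s, ⟪G ω, tmulH hX (ind hX t u) (ind hX s v)⟫ = 0 := fun t ht s =>
    congrFun (Continuous.ext_on hD (continuous_const.inner
      ((continuous_tmulH hX _).comp (continuous_ind hX hR v))) continuous_const
      fun s hs => hω t ht s hs u v) s
  exact congrFun (Continuous.ext_on hD (continuous_const.inner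
      ((continuous_tmulH_left hX _).comp (continuous_ind hX hR u))) continuous_const
      fun t ht => h1 t ht s) t

theorem IsMalliavinDerivH.ae_unique (hR : Continuous (Function.uncurry (covFun P X)))
    {U U' : Ω → H1 hX} {G G' : Ω → H1Tensor hX} (h : IsMalliavinDerivH hX U G)
    (h' : IsMalliavinDerivH hX U' G') (hU : U =ᵐ[P] U') : G =ᵐ[P] G' := by
  have h1 := (h.sub h').congr (U' := fun _ => 0) (hU.mono fun ω hω => sub_eq_zero.2 hω)
    EventuallyEq.rfl
  filter_upwards [h1.ae_eq_zero hR] with ω hω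
  exact sub_eq_zero.1 hω

end YoungMalliavin

namespace YoungMalliavin

variable {Ω : Type*} [mΩ : MeasurableSpace Ω] {P : Measure Ω} {d : ℕ} [NeZero d] {T : ℝ}
  {X : Time T → Ω → EuclideanSpace ℝ (Fin d)} {hX : IsGaussianDriver P X}

/-! ### The characterization of the convergence in `𝔻^{1,2}(H_1^d)` -/

omit [NeZero d] in
theorem ExpectationTendstoZero.congr {Z Z' : TimePartition T → Ω → ℝ}
    (h : ∀ π, Z π =ᵐ[P] Z' π) : ExpectationTendstoZero P Z ↔ ExpectationTendstoZero P Z' := by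
  unfold ExpectationTendstoZero
  rw [tendsto_congr fun π => integral_congr_ae (h π),
    eventually_congr (Eventually.of_forall fun π => integrable_congr (h π))]

omit [NeZero d] in
theorem expectationTendstoZero_norm_sq {E : Type*} [NormedAddCommGroup E] [InnerProductSpace ℝ E]
    {f : TimePartition T → Ω → E} (hf : ∀ π, MemLp (f π) 2 P)
    (h : Tendsto (fun π => eLpNorm (f π) 2 P) (meshZero T) (𝓝 0)) :
    ExpectationTendstoZero P fun π ω => ‖f π ω‖ ^ 2 :=
  ⟨Eventually.of_forall fun π => (memLp_two_iff_integrable_sq_norm (hf π).1).1 (hf π),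
    (tendsto_eLpNorm_iff (Eventually.of_forall hf)).1 h⟩

-- The limit is square integrable because, for a single fine partition, both `f π` and `f π - g`
-- are.
omit [NeZero d] in
theorem ExpectationTendstoZero.memLp (hT : 0 < T) {E : Type*} [NormedAddCommGroup E]
    [InnerProductSpace ℝ E] {f : TimePartition T → Ω → E} {g : Ω → E} (hf : ∀ π, MemLp (f π) 2 P)
    (hg : AEStronglyMeasurable g P)
    (h : ExpectationTendstoZero P fun π ω => ‖f π ω - g ω‖ ^ 2) :
    MemLp g 2 P ∧ Tendsto (fun π => eLpNorm (fun ω => f π ω - g ω) 2 P) (meshZero T) (𝓝 0) := by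
  have := meshZero_neBot hT
  have h1 : ∀ᶠ π in meshZero T, MemLp (fun ω => f π ω - g ω) 2 P := h.1.mono fun π hπ =>
    (memLp_two_iff_integrable_sq_norm ((hf π).1.sub hg)).2 hπ
  refine ⟨?_, (tendsto_eLpNorm_iff h1).2 h.2⟩
  obtain ⟨π, hπ⟩ := h1.exists
  have := (hf π).sub hπ
  refine this.ae_eq (Eventually.of_forall fun ω => ?_)
  simp

variable [IsProbabilityMeasure P]

section Convergence

variable {U : TimePartition T → Ω → H1 hX} {V : Ω → H1 hX} {G : TimePartition T → Ω → H1Tensor hX}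
  {W : Ω → H1Tensor hX}

/-- If `DU^π = G^π` and `G^π → W` almost surely, then `U^π → V` in `𝔻^{1,2}(H_1^d)` means that
`U^π → V` and `G^π → W` in `L²`. -/
theorem TendstoD12.tendsto_eLpNorm (hT : 0 < T)
    (hR : Continuous (Function.uncurry (covFun P X))) (hUG : ∀ π, IsMalliavinDerivH hX (U π) (G π))
    (hG : ∀ᵐ ω ∂P, Tendsto (fun π => G π ω) (meshZero T) (𝓝 (W ω))) (h : TendstoD12 hX U V) :
    IsMalliavinDerivH hX V W ∧
      Tendsto (fun π => eLpNorm (fun ω => U π ω - V ω) 2 P) (meshZero T) (𝓝 0) ∧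
      Tendsto (fun π => eLpNorm (fun ω => G π ω - W ω) 2 P) (meshZero T) (𝓝 0) := by
  have := meshZero_neBot hT
  obtain ⟨DU, DV, h1, h2, h3, h4⟩ := h
  have hDU : ∀ π, DU π =ᵐ[P] G π := fun π => (h1 π).ae_unique hR (hUG π) EventuallyEq.rfl
  have h5 : Tendsto (fun π => eLpNorm (fun ω => G π ω - DV ω) 2 P) (meshZero T) (𝓝 0) :=
    h4.congr fun π => eLpNorm_congr_ae ((hDU π).mono fun ω hω => by simp only [hω])
  have hu := tendsto_uniformPartition hT
  -- Along uniform partitions the derivatives converge to `DV` in $L^2$ and to `W` almost surely.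
  -- Both imply convergence in measure, whose limit is unique.
  have m1 : TendstoInMeasure P (fun n => G (uniformPartition hT n)) atTop DV :=
    tendstoInMeasure_of_tendsto_eLpNorm two_ne_zero (fun n => (hUG _).2.1.1) h2.2.1.1 (h5.comp hu)
  have m2 : TendstoInMeasure P (fun n => G (uniformPartition hT n)) atTop W :=
    tendstoInMeasure_of_tendsto_ae (fun n => (hUG _).2.1.1) (hG.mono fun ω hω => hω.comp hu)
  have hDV : DV =ᵐ[P] W := tendstoInMeasure_ae_unique m1 m2
  exact ⟨h2.congr EventuallyEq.rfl hDV, h3, h5.congr fun π =>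
    eLpNorm_congr_ae (hDV.mono fun ω hω => by simp only [hω])⟩

theorem tendstoD12_iff (hT : 0 < T) (hR : Continuous (Function.uncurry (covFun P X)))
    (hUG : ∀ π, IsMalliavinDerivH hX (U π) (G π))
    (hU : ∀ᵐ ω ∂P, Tendsto (fun π => U π ω) (meshZero T) (𝓝 (V ω)))
    (hG : ∀ᵐ ω ∂P, Tendsto (fun π => G π ω) (meshZero T) (𝓝 (W ω))) :
    TendstoD12 hX U V ↔ ExpectationTendstoZero P (fun π ω => ‖U π ω - V ω‖ ^ 2) ∧
      ExpectationTendstoZero P (fun π ω => ‖G π ω - W ω‖ ^ 2) := by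
  have := meshZero_neBot hT
  constructor
  · intro h
    obtain ⟨hVW, h1, h2⟩ := h.tendsto_eLpNorm hT hR hUG hG
    exact ⟨expectationTendstoZero_norm_sq (fun π => (hUG π).1.sub hVW.1) h1,
      expectationTendstoZero_norm_sq (fun π => (hUG π).2.1.sub hVW.2.1) h2⟩
  · rintro ⟨h1, h2⟩
    -- Conversely, measurability of the limits comes from almost sure convergence and integrability
    -- from the expectations. Closedness of the graph then shows that `W` is the derivative of `V`.
    have mV : AEStronglyMeasurable V P :=
      aestronglyMeasurable_of_tendsto_ae (meshZero T) (fun π => (hUG π).1.1) hU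
    have mW : AEStronglyMeasurable W P :=
      aestronglyMeasurable_of_tendsto_ae (meshZero T) (fun π => (hUG π).2.1.1) hG
    obtain ⟨hV, h3⟩ := h1.memLp hT (fun π => (hUG π).1) mV
    obtain ⟨hW, h4⟩ := h2.memLp hT (fun π => (hUG π).2.1) mW
    have hu := tendsto_uniformPartition hT
    exact ⟨G, W, hUG, .of_tendsto (fun n => hUG _) hV hW (h3.comp hu) (h4.comp hu), h3, h4⟩

theorem IsMalliavinDerivH.inSkorohodDomain {G : Ω → H1Tensor hX}
    (h : IsMalliavinDerivH hX V G) : InSkorohodDomain hX V :=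
  let ⟨Z, hZ, _⟩ := h.exists_skorohod
  ⟨Z, hZ⟩

/-- The representative chosen in `skorohod` agrees almost surely with the one built by closure,
since the divergence is unique. -/
theorem IsMalliavinDerivH.integral_skorohod_sq {G : Ω → H1Tensor hX}
    (h : IsMalliavinDerivH hX V G) : ∫ ω, skorohod hX V ω ^ 2 ∂P =
      ∫ ω, ‖V ω‖ ^ 2 ∂P + ∫ ω, ⟪G ω, swapH hX (G ω)⟫ ∂P := by
  obtain ⟨Z, hZ, hZ2⟩ := h.exists_skorohod
  rw [← hZ2]
  have hs : IsSkorohodIntegral hX V (skorohod hX V) := by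
    unfold skorohod
    rw [dif_pos h.inSkorohodDomain]
    exact h.inSkorohodDomain.choose_spec
  exact integral_congr_ae ((hs.ae_unique hZ EventuallyEq.rfl).mono fun ω hω => by simp only [hω])

theorem tendsto_integral_skorohod_sq (hUG : ∀ π, IsMalliavinDerivH hX (U π) (G π))
    (hVW : IsMalliavinDerivH hX V W)
    (h1 : Tendsto (fun π => eLpNorm (fun ω => U π ω - V ω) 2 P) (meshZero T) (𝓝 0))
    (h2 : Tendsto (fun π => eLpNorm (fun ω => G π ω - W ω) 2 P) (meshZero T) (𝓝 0)) :
    Tendsto (fun π => ∫ ω, skorohod hX (fun ω => U π ω - V ω) ω ^ 2 ∂P) (meshZero T) (𝓝 0) := by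
  have hsub := fun π => (hUG π).sub hVW
  simp only [fun π => (hsub π).integral_skorohod_sq]
  have t1 := (tendsto_eLpNorm_iff (Eventually.of_forall fun π => (hsub π).1)).1 h1
  have m0 : MemLp (fun _ : Ω => (0 : H1Tensor hX)) 2 P := memLp_const 0
  have h2' : Tendsto (fun π => eLpNorm (fun ω => swapH hX (G π ω - W ω) - 0) 2 P)
      (meshZero T) (𝓝 0) := h2.congr fun π => eLpNorm_congr_norm_ae
        (Eventually.of_forall fun ω => by rw [sub_zero, norm_swapH])
  have t2 := tendsto_integral_inner (fun π => (hsub π).2.1) m0 (by simpa only [sub_zero] using h2)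
    (fun π => (swapH hX).comp_memLp' (hsub π).2.1) m0 h2'
  simp only [inner_zero_left, integral_zero] at t2
  simpa using t1.add t2

end Convergence

/-! ### The integrand -/

omit [IsProbabilityMeasure P] [NeZero d] in
theorem PiecewisePVar.boundedVar_coord {p q : ℝ} (hp : 1 ≤ p) (hpq : p ≤ q)
    {y : Time T → EuclideanSpace ℝ (Fin d)} (hy : PiecewisePVar p y) (u : Fin d) :
    BoundedVar q fun t => y t u := by
  have hp0 : 0 < p := by linarith
  refine (hy.boundedVar hp0 (φ := fun x => x u) fun x z => ?_).mono_exponent hp0 hpq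
  rw [dist_eq_norm, dist_eq_norm, ← PiLp.sub_apply]
  exact PiLp.norm_apply_le (x - z) u

omit [IsProbabilityMeasure P] [NeZero d] in
theorem norm_entry_le_frobenius (A : Matrix (Fin d) (Fin d) ℝ) (i j : Fin d) : ‖A i j‖ ≤ ‖A‖ := by
  rw [Matrix.frobenius_norm_def, ← Real.sqrt_eq_rpow]
  refine Real.le_sqrt_of_sq_le ?_
  have h1 : ‖A i j‖ ^ (2 : ℝ) ≤ ∑ j, ‖A i j‖ ^ (2 : ℝ) :=
    Finset.single_le_sum (f := fun j => ‖A i j‖ ^ (2 : ℝ)) (fun _ _ => by positivity)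
      (Finset.mem_univ j)
  have h2 : ∑ j, ‖A i j‖ ^ (2 : ℝ) ≤ ∑ i, ∑ j, ‖A i j‖ ^ (2 : ℝ) :=
    Finset.single_le_sum (f := fun i => ∑ j, ‖A i j‖ ^ (2 : ℝ))
      (fun _ _ => Finset.sum_nonneg fun _ _ => by positivity) (Finset.mem_univ i)
  rw [← Real.rpow_natCast]
  exact_mod_cast h1.trans h2

omit [IsProbabilityMeasure P] [NeZero d] in
theorem PiecewisePVar.boundedVar_entry {p q : ℝ} (hp : 1 ≤ p) (hpq : p ≤ q)
    {g : Time T → Matrix (Fin d) (Fin d) ℝ} (hg : PiecewisePVar p g) (i j : Fin d) :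
    BoundedVar q fun t => g t i j := by
  have hp0 : 0 < p := by linarith
  refine (hg.boundedVar hp0 (φ := fun x => x i j) fun x z => ?_).mono_exponent hp0 hpq
  rw [dist_eq_norm, dist_eq_norm, ← Matrix.sub_apply]
  exact norm_entry_le_frobenius (x - z) i j

variable (hX) in
/-- The limit of the tensors `tensorSum` of the rows of the kernel `1_{[0,t)}(s) g₁(t) g₂(s)`. -/
def tensorLim (g₁ g₂ : Time T → Matrix (Fin d) (Fin d) ℝ) : H1Tensor hX :=
  limUnder (meshZero T) (tensorSum hX (rowElt hX g₁ g₂))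

end YoungMalliavin

end

/-! ### The theorem -/

theorem mainTheorem8 {Ω : Type*} [mΩ : MeasurableSpace Ω] (P : Measure Ω) [IsProbabilityMeasure P]
    {d : ℕ} [NeZero d] {T : ℝ} (hT : 0 < T)
    (X : Time T → Ω → EuclideanSpace ℝ (Fin d)) (hX : IsGaussianDriver P X)
    (ρ p : ℝ) (hρ : 1 ≤ ρ) (hρ' : ρ < 3 / 2) (hp : 1 ≤ p) (hpρ : 1 / p + 1 / ρ > 1)
    (hRcont : Continuous (Function.uncurry (covFun P X)))
    (hRvar : FinitePVar2D ρ (covFun P X))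
    (Y : Ω → Time T → EuclideanSpace ℝ (Fin d))
    (g₁ g₂ : Ω → Time T → Matrix (Fin d) (Fin d) ℝ)
    (hY : ∀ᵐ ω ∂P, PiecewisePVar p (Y ω))
    (hg : ∀ᵐ ω ∂P, PiecewisePVar p (g₁ ω) ∧ PiecewisePVar p (g₂ ω))
    -- `D Y_t^{(i)}` is the `i`-th row of `s ↦ 1_{[0,t)}(s) g₁(t) g₂(s)`
    (hDY : ∀ (t : Time T) (i : Fin d), IsMalliavinDeriv hX (fun ω => Y ω t i)
      (fun ω => toH1 hX fun s => rowVec (volterra (g₁ ω) (g₂ ω) s t) i)) :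
    -- almost surely, all the pathwise objects below are well defined
    (∀ᵐ ω ∂P,
      Represents hX (Y ω) (toH1 hX (Y ω)) ∧
      (∀ t i, Represents hX (fun s => rowVec (volterra (g₁ ω) (g₂ ω) s t) i)
        (toH1 hX fun s => rowVec (volterra (g₁ ω) (g₂ ω) s t) i)) ∧
      YoungExists2 (fun s t => ⟪Y ω s, Y ω t⟫) (covFun P X) ∧
      YoungExists4 (fun s r t q =>
        (volterra (g₁ ω) (g₂ ω) r t * volterra (g₁ ω) (g₂ ω) q s).trace) (covFun P X) ∧
      ∀ π : TimePartition T,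
        YoungExists2 (pathErr π (Y ω)) (covFun P X) ∧
        (∀ s t, YoungExists2 (fun r q => frob (kernelErr π (volterra (g₁ ω) (g₂ ω)) r t)
          (kernelErr π (volterra (g₁ ω) (g₂ ω)) q s)) (covFun P X)) ∧
        YoungExists2 (fun s t => young2 (fun r q =>
          frob (kernelErr π (volterra (g₁ ω) (g₂ ω)) r t)
            (kernelErr π (volterra (g₁ ω) (g₂ ω)) q s)) (covFun P X)) (covFun P X)) ∧
    -- the characterization of the convergence `Y^π → Y`
    (TendstoD12 hX (fun π ω => stepH hX π (Y ω)) (fun ω => toH1 hX (Y ω)) ↔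
      ExpectationTendstoZero P
        (fun (π : TimePartition T) ω => young2 (pathErr π (Y ω)) (covFun P X)) ∧
      ExpectationTendstoZero P
        (fun (π : TimePartition T) ω => young2 (fun s t => young2 (fun r q =>
          frob (kernelErr π (volterra (g₁ ω) (g₂ ω)) r t)
            (kernelErr π (volterra (g₁ ω) (g₂ ω)) q s)) (covFun P X)) (covFun P X))) ∧
    -- the consequences of the convergence
    (TendstoD12 hX (fun π ω => stepH hX π (Y ω)) (fun ω => toH1 hX (Y ω)) →
      (∀ π : TimePartition T,
        InSkorohodDomain hX (fun ω => stepH hX π (Y ω) - toH1 hX (Y ω))) ∧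
      Tendsto (fun π : TimePartition T =>
          ∫ ω, (skorohod hX (fun ω => stepH hX π (Y ω) - toH1 hX (Y ω)) ω) ^ 2 ∂P)
        (meshZero T) (𝓝 0) ∧
      InSkorohodDomain hX (fun ω => toH1 hX (Y ω)) ∧
      Integrable (fun ω => young2 (fun s t => ⟪Y ω s, Y ω t⟫) (covFun P X)) P ∧
      Integrable (fun ω => young4 (fun s r t q =>
        (volterra (g₁ ω) (g₂ ω) r t * volterra (g₁ ω) (g₂ ω) q s).trace) (covFun P X)) P ∧
      ∫ ω, (skorohod hX (fun ω => toH1 hX (Y ω)) ω) ^ 2 ∂P =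
        ∫ ω, young2 (fun s t => ⟪Y ω s, Y ω t⟫) (covFun P X) ∂P +
        ∫ ω, young4 (fun s r t q =>
          (volterra (g₁ ω) (g₂ ω) r t * volterra (g₁ ω) (g₂ ω) q s).trace) (covFun P X) ∂P) := by
  -- One exponent serves all integrands: $p$-variation implies $q$-variation, and $q>2$ is needed
  -- for the iterated integral.
  obtain ⟨q, hq, hpq, hqρ⟩ := exists_young_exponent hp hρ hρ' hpρ
  have hpath : ∀ u, IsYoungPath q fun t => ind hX t u := fun u =>
    isYoungPath_ind hX hT hq (by linarith) hqρ hRcont hRvar u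
  set U : TimePartition T → Ω → H1 hX := fun π ω => stepH hX π (Y ω) with hUdef
  set V : Ω → H1 hX := fun ω => toH1 hX (Y ω) with hVdef
  set G : TimePartition T → Ω → H1Tensor hX := fun π ω =>
    tensorSum hX (rowElt hX (g₁ ω) (g₂ ω)) π with hGdef
  set W : Ω → H1Tensor hX := fun ω => tensorLim hX (g₁ ω) (g₂ ω) with hWdef
  have hneBot := meshZero_neBot hT
  have hrepY : ∀ᵐ ω ∂P, Represents hX (Y ω) (V ω) := hY.mono fun ω hω =>
    represents_of_boundedVar hT hpath fun u => hω.boundedVar_coord hp hpq u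
  have hrows : ∀ᵐ ω ∂P,
      (∀ i t, Represents hX (fun s => rowVec (volterra (g₁ ω) (g₂ ω) s t) i)
        (rowElt hX (g₁ ω) (g₂ ω) i t)) ∧
      Tendsto (tensorSum hX (rowElt hX (g₁ ω) (g₂ ω))) (meshZero T) (𝓝 (W ω)) ∧
      Tendsto (riemannSum4 (fun s r t q =>
        (volterra (g₁ ω) (g₂ ω) r t * volterra (g₁ ω) (g₂ ω) q s).trace) (covFun P X))
        ((meshZero T ×ˢ meshZero T) ×ˢ (meshZero T ×ˢ meshZero T))
        (𝓝 ⟪W ω, swapH hX (W ω)⟫) := hg.mono fun ω hω => by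
    obtain ⟨hrep, Λ, h1, h2⟩ := exists_limit_tensorSum hT hpath
      (fun i j => hω.1.boundedVar_entry hp hpq i j) (fun i j => hω.2.boundedVar_entry hp hpq i j)
    have hΛ : W ω = Λ := h1.limUnder_eq
    rw [hΛ]
    exact ⟨hrep, h1, tendsto_riemannSum4 h2⟩
  have hUG : ∀ π, IsMalliavinDerivH hX (U π) (G π) := fun π =>
    isMalliavinDerivH_stepH (fun t i => hDY t i) π
  have hU : ∀ᵐ ω ∂P, Tendsto (fun π => U π ω) (meshZero T) (𝓝 (V ω)) := hrepY
  have hG : ∀ᵐ ω ∂P, Tendsto (fun π => G π ω) (meshZero T) (𝓝 (W ω)) :=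
    hrows.mono fun ω hω => hω.2.1
  -- The two quantities of the criterion are, almost surely, the squared errors of $Y^\pi$ in
  -- $\mathcal H_1^d$ and of its derivative in $\mathcal H_1^d\otimes\mathcal H_1^d$.
  have hpathErr : ∀ π, (fun ω => young2 (pathErr π (Y ω)) (covFun P X)) =ᵐ[P]
      fun ω => ‖U π ω - V ω‖ ^ 2 := fun π => hrepY.mono fun ω hω =>
    young2_eq hT (tendsto_riemannSum2_pathErr hpath π hω)
  have hkernelErr : ∀ π, (fun ω => young2 (fun s t => young2 (fun r q =>
      frob (kernelErr π (volterra (g₁ ω) (g₂ ω)) r t)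
        (kernelErr π (volterra (g₁ ω) (g₂ ω)) q s)) (covFun P X)) (covFun P X)) =ᵐ[P]
      fun ω => ‖G π ω - W ω‖ ^ 2 := fun π => hrows.mono fun ω hω =>
    young2_eq hT (tendsto_riemannSum2_young2_kernelErr hT hpath π hω.1 hω.2.1)
  refine ⟨?_, ?_, fun hconv => ?_⟩
  · filter_upwards [hrepY, hrows] with ω h1 h2
    exact ⟨h1, fun t i => h2.1 i t, ⟨_, h1.tendsto_riemannSum2 h1⟩, ⟨_, h2.2.2⟩, fun π =>
      ⟨⟨_, tendsto_riemannSum2_pathErr hpath π h1⟩,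
        fun s t => ⟨_, tendsto_riemannSum2_kernelErr π h2.1 s t⟩,
        ⟨_, tendsto_riemannSum2_young2_kernelErr hT hpath π h2.1 h2.2.1⟩⟩⟩
  · rw [ExpectationTendstoZero.congr hpathErr, ExpectationTendstoZero.congr hkernelErr]
    exact tendstoD12_iff hT hRcont hUG hU hG
  · obtain ⟨hVW, h1, h2⟩ := hconv.tendsto_eLpNorm hT hRcont hUG hG
    -- The right-hand side of the isometry evaluated pathwise: the squared norm is the 2D integral,
    -- and the pairing of the derivative with its exchange is the 4D trace integral.
    have hyoung2 : (fun ω => young2 (fun s t => ⟪Y ω s, Y ω t⟫) (covFun P X)) =ᵐ[P]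
        fun ω => ‖V ω‖ ^ 2 := hrepY.mono fun ω hω => by
      beta_reduce
      rw [← real_inner_self_eq_norm_sq]
      exact young2_eq hT (hω.tendsto_riemannSum2 hω)
    have hyoung4 : (fun ω => young4 (fun s r t q =>
        (volterra (g₁ ω) (g₂ ω) r t * volterra (g₁ ω) (g₂ ω) q s).trace) (covFun P X)) =ᵐ[P]
        fun ω => ⟪W ω, swapH hX (W ω)⟫ := hrows.mono fun ω hω => hω.2.2.limUnder_eq
    refine ⟨fun π => ((hUG π).sub hVW).inSkorohodDomain,
      tendsto_integral_skorohod_sq hUG hVW h1 h2, hVW.inSkorohodDomain,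
      (integrable_congr hyoung2).2 ((memLp_two_iff_integrable_sq_norm hVW.1.1).1 hVW.1),
      (integrable_congr hyoung4).2 (integrable_inner_of_memLp hVW.2.1
        ((swapH hX).comp_memLp' hVW.2.1)), ?_⟩
    rw [integral_congr_ae hyoung2, integral_congr_ae hyoung4]
    exact hVW.integral_skorohod_sq
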